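/- Let $n\ge 2$, let $B_R$ denote the open ball of radius $R$ centered at the origin in $\mathbf R^n$, and fix $R_0>0$. Let $A$ be an $n\times n$-matrix valued function on $B_{R_0}$ whose partial derivatives up to order $k\ge 1$ exist and are bounded in $B_{R_0}$ by a constant $M_A$, and suppose that for a constant $\eta_A>0$ $$(A(x)\xi)\cdot\xi\ \ge\ \eta_A|\xi|^2\qquad\text{for all } x\in B_{R_0},\ \xi\in\mathbf R^n .$$ Let $u\in H^1(B_{R_0})$ satisfy $$\int_{B_{R_0}}(A\nabla u)\cdot\nabla v = F\cdot v\qquad\text{for all } v\in H^1_0(B_{R_0})$$ for some $F$ in the dual of $H^1_0(B_{R_0})$. Let $\theta\in(0,1)$, $\delta\in(0,R_0)$ and $\delta'\in(0,\theta\delta]$, and regard $H^1_0(B_\delta)$ as a subspace of $H^1_0(B_{R_0})$ through extension by zero. Then the following hold, where all constants may also depend on $n$. **(a)** There is a constant $C$ depending only on $\theta, R_0, M_A$ and $\eta_A$ such that, if for some constants $a,b\ge 0$ $$|F\cdot v|\le a|v|_{L^2(B_\delta)}+b|\nabla v|_{L^2(B_\delta)}\qquad\text{for all } v\in H^1_0(B_\delta),$$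 then $$|\nabla u|^2_{L^2(B_{\delta'})}\le C\Big[(\delta-\delta')^{-2}|u|^2_{L^2(B_\delta)}+a|u|_{L^2(B_\delta)}+b^2\Big].$$ **(b)** There is a constant $C$ depending only on $k,\theta,R_0,M_A$ and $\eta_A$ such that, if $$F\cdot v=\int_{B_\delta}\big(\varphi v+\Phi\cdot\nabla v\big)\qquad\text{for all } v\in H^1_0(B_\delta)$$ for some $\varphi\in H^{\max\{k-2,0\}}(B_\delta)$ and $\Phi\in[H^{k-1}(B_\delta)]^n$, then $u\in H^k(B_{\delta'})$ and for $j=1,\ldots,k$ $$\sum_{|\alpha|=j}|D^\alpha u|_{L^2(B_{\delta'})}\le C\varepsilon^{-j}\Big[|u|_{L^2}+\varepsilon^2|\varphi|_{L^2}+\varepsilon|\Phi|_{L^2}+\sum_{i=1}^{j-1}\varepsilon^{i+1}\big(|\varphi|_{H^{i-1}}+|\Phi|_{H^i}\big)\Big],$$ where $\varepsilon=\delta-\delta'$, the norms on the right are taken over $B_\delta$, and the sum on the right is omitted if $j=1$. **(c)** Let $n\ge 3$, let $\theta'\in(0,\theta)$ and $p\in(1,2]$, and set $q=np/(n-2)$.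 There is a constant $C$ depending only on $\theta,\theta',R_0,M_A,\eta_A$ and $p$ such that, if $\delta'\in[\theta'\delta,\theta\delta]$ and $$F\cdot v=\int_{B_\delta}\varphi v\qquad\text{for all } v\in H^1_0(B_\delta)$$ for some $\varphi\in L^p(B_\delta)$ (the integrals being absolutely convergent), then $u\in L^q(B_{\delta'})$ and $$|u|_{L^q(B_{\delta'})}\le C\Big[(\delta-\delta')^{-2/p}|u|_{L^p(B_\delta)}+(\delta-\delta')^{2(p-1)/p}|\varphi|_{L^p(B_\delta)}\Big].$$ -/

import Mathlib

open MeasureTheory Set Filter Topology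
open scoped ENNReal ContDiff Matrix

namespace InteriorElliptic

/-- Euclidean space of dimension `n`. -/
abbrev E (n : ℕ) : Type := EuclideanSpace ℝ (Fin n)

/-- The classical partial derivative in the `i`-th coordinate direction. -/
noncomputable def pderiv {n : ℕ} (i : Fin n) (f : E n → ℝ) : E n → ℝ :=
  fun x => lineDeriv ℝ f x (EuclideanSpace.single i (1 : ℝ))

/-- The classical iterated partial derivative `∂₀^{α 0} ∂₁^{α 1} ⋯ f` for a multi-index `α`. -/
noncomputable def multiDeriv {n : ℕ} (α : Fin n → ℕ) (f : E n → ℝ) : E n → ℝ :=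
  (List.finRange n).foldr (fun i g => (pderiv i)^[α i] g) f

/-- All classical partial derivatives of `f` of order at most `k` exist on `U`
and are bounded there by `M`. -/
def HasBoundedDerivs {n : ℕ} (U : Set (E n)) (M : ℝ) : ℕ → (E n → ℝ) → Prop
  | 0, f => ∀ x ∈ U, |f x| ≤ M
  | k + 1, f => (∀ x ∈ U, |f x| ≤ M) ∧
      ∀ i : Fin n,
        (∀ x ∈ U, LineDifferentiableAt ℝ f x (EuclideanSpace.single i (1 : ℝ))) ∧
          HasBoundedDerivs U M k (pderiv i f)

/-- Test functions: elements of `C_c^∞(U)`. -/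
structure IsTestFun {n : ℕ} (U : Set (E n)) (φ : E n → ℝ) : Prop where
  smooth : ContDiff ℝ ∞ φ
  compact : HasCompactSupport φ
  supp : tsupport φ ⊆ U

/-- `g` is the weak derivative `D^α f` on the open set `U`. -/
structure HasWeakDeriv {n : ℕ} (U : Set (E n)) (α : Fin n → ℕ) (f g : E n → ℝ) : Prop where
  locInt : LocallyIntegrableOn f U
  locInt' : LocallyIntegrableOn g U
  eq : ∀ φ : E n → ℝ, IsTestFun U φ →
    ∫ x in U, f x * multiDeriv α φ x = (-1) ^ (∑ i, α i) * ∫ x in U, g x * φ x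

open Classical in
/-- A representative of the weak derivative `D^α f` on `U` (zero if there is none). -/
noncomputable def weakDeriv {n : ℕ} (U : Set (E n)) (α : Fin n → ℕ) (f : E n → ℝ) : E n → ℝ :=
  if h : ∃ g, HasWeakDeriv U α f g then h.choose else 0

/-- The weak gradient of `f` on `U`. -/
noncomputable def weakGrad {n : ℕ} (U : Set (E n)) (f : E n → ℝ) : E n → Fin n → ℝ :=
  fun x i => weakDeriv U (Pi.single i 1) f x

/-- The `L^p(U)` norm. -/
noncomputable def normLp {n : ℕ} (p : ℝ≥0∞) (U : Set (E n)) (f : E n → ℝ) : ℝ :=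
  (eLpNorm f p (volume.restrict U)).toReal

/-- `f ∈ H^m(U)`: `f` and all its weak derivatives of order at most `m` are in `L²(U)`. -/
def MemH {n : ℕ} (m : ℕ) (U : Set (E n)) (f : E n → ℝ) : Prop :=
  MemLp f 2 (volume.restrict U) ∧
    ∀ α : Fin n → ℕ, ∑ i, α i ≤ m →
      ∃ g, HasWeakDeriv U α f g ∧ MemLp g 2 (volume.restrict U)

/-- The `H^m(U)` norm, `(∑_{|α| ≤ m} |D^α f|²_{L²(U)})^{1/2}`. -/
noncomputable def normH {n : ℕ} (m : ℕ) (U : Set (E n)) (f : E n → ℝ) : ℝ :=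
  √(∑ j ∈ Finset.range (m + 1), ∑ α ∈ Finset.piAntidiag (Finset.univ : Finset (Fin n)) j,
    normLp 2 U (weakDeriv U α f) ^ 2)

/-- The `L²(U)` norm of a vector field. -/
noncomputable def normL2Vec {n : ℕ} (U : Set (E n)) (Φ : E n → Fin n → ℝ) : ℝ :=
  √(∑ i, normLp 2 U (fun x => Φ x i) ^ 2)

/-- The `H^m(U)` norm of a vector field. -/
noncomputable def normHVec {n : ℕ} (m : ℕ) (U : Set (E n)) (Φ : E n → Fin n → ℝ) : ℝ :=
  √(∑ i, normH m U (fun x => Φ x i) ^ 2)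

/-- `v ∈ H¹₀(U)`: `v` is in the closure of `C_c^∞(U)` in `H¹(U)`. -/
def MemH10 {n : ℕ} (U : Set (E n)) (v : E n → ℝ) : Prop :=
  MemH 1 U v ∧ ∃ φ : ℕ → E n → ℝ, (∀ m, IsTestFun U (φ m)) ∧
    Tendsto (fun m => normH 1 U (fun x => φ m x - v x)) atTop (𝓝 0)

/-- `F` is an element of the dual of `H¹₀(U)`: a bounded linear functional on `H¹₀(U)`.
(Its values on functions outside `H¹₀(U)` are irrelevant. Boundedness makes `F` well defined
on classes of functions that agree almost everywhere on `U`.) -/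
structure IsDualH10 {n : ℕ} (U : Set (E n)) (F : (E n → ℝ) → ℝ) : Prop where
  map_add : ∀ v w, MemH10 U v → MemH10 U w → F (fun x => v x + w x) = F v + F w
  map_smul : ∀ (c : ℝ) (v : E n → ℝ), MemH10 U v → F (fun x => c * v x) = c * F v
  bounded : ∃ K : ℝ, ∀ v, MemH10 U v → |F v| ≤ K * normH 1 U v

/-- The assumptions on the coefficient matrix on `U`: partial derivatives up to order `k` exist
and are bounded by `M`, and `(A(x) ξ) · ξ ≥ η |ξ|²`. -/
structure IsCoeff {n : ℕ} (U : Set (E n)) (k : ℕ) (M η : ℝ)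
    (A : E n → Matrix (Fin n) (Fin n) ℝ) : Prop where
  bdd : ∀ i j, HasBoundedDerivs U M k (fun x => A x i j)
  elliptic : ∀ x ∈ U, ∀ ξ : Fin n → ℝ, η * (ξ ⬝ᵥ ξ) ≤ (A x *ᵥ ξ) ⬝ᵥ ξ

/-- `u ∈ H¹(U)` satisfies `∫_U (A ∇u) · ∇v = F · v` for all `v ∈ H¹₀(U)`,
where `F` is in the dual of `H¹₀(U)`. -/
structure IsWeakSol {n : ℕ} (U : Set (E n)) (A : E n → Matrix (Fin n) (Fin n) ℝ)
    (F : (E n → ℝ) → ℝ) (u : E n → ℝ) : Prop where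
  mem : MemH 1 U u
  dual : IsDualH10 U F
  eq : ∀ v, MemH10 U v →
    ∫ x in U, (A x *ᵥ weakGrad U u x) ⬝ᵥ weakGrad U v x = F v

/-- The open ball of radius `R` centred at the origin. -/
abbrev B (n : ℕ) (R : ℝ) : Set (E n) := Metric.ball 0 R

end InteriorElliptic

namespace InteriorElliptic

/-! ### Partial derivatives of smooth functions and test functions -/

section TestFunctions
variable {n : ℕ} {U V : Set (E n)} {f g φ ψ : E n → ℝ} {i j : Fin n}

/-! All three estimates come from testing the weak equation with a cutoff times a function of `u`.
Every such test function is a compactly supported `H¹` function, hence an `H¹` limit of its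
mollifications (`exists_testFun_approx`), and so lies in `H¹₀`.

(a) is the Caccioppoli inequality (`caccioppoli`). With `v = ζ²u`, ellipticity produces `η ∫
ζ²|∇u|²`. The cross term containing `∇ζ` and the contribution of `F` are absorbed by completing
squares, and `|∇ζ| ≲ (δ-δ')⁻¹` gives the weight of `|u|²`. The coefficients need only be measurable,
bounded and elliptic, so the same inequality serves for translated coefficients.

(b) separates existence of derivatives from estimates. For existence, the difference quotient of `u`
solves an equation with translated coefficients and a right-hand side bounded in the dual of `H¹₀`
uniformly in the step (`SolvesDiv.diffQuot_bound`). Caccioppoli then bounds the difference quotients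
of `∇u` in `L²`, and the Riesz representation turns this into weak second derivatives
(`SolvesDiv.exists_second_deriv`). For estimates, `∂ₗu` solves the differentiated equation
(`SolvesDiv.deriv`), so order `j + 1` follows from order `j` applied to `∂ₗu`
(`InteriorRegularity.succ`). The bookkeeping is scale invariant: with `q = (δ-r)⁻¹`, a quantity with
`i` derivatives is measured against `qⁱS`. The only terms with a wrong power of `q` carry too few
factors, and `1 ≤ R₀q` repairs them; this is how `R₀` enters the constant.

(c) tests with `ζ²u(u²+κ²)^((p-2)/2)`, a regularisation of `ζ²u|u|^(p-2)`, which would be singular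
at `u = 0` for `p < 2`. The outcome is an `L²` bound for the gradient of `ζ(u²+κ²)^(p/4)`
(`SolvesInLp.integral_powGrad_le`). The Sobolev inequality puts this function in `L^(2n/(n-2))`; the
power `2/p` of that bound is the `L^q` bound for `u`, with a constant independent of `κ`, and `κ →
0` finishes.

The entries of `A` are only assumed to have bounded partial derivatives in the coordinate
directions. Their continuity, the measurability of the partial derivatives and the product rule with
Sobolev functions are therefore derived from line differentiability
(`HasBoundedDerivs.continuousOn`, `HasWeakGrad.mul_boundedDerivs`). -/

theorem pderiv_eq_fderiv {x : E n} (hf : DifferentiableAt ℝ f x) :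
    pderiv i f x = fderiv ℝ f x (EuclideanSpace.single i 1) :=
  hf.lineDeriv_eq_fderiv

theorem pderiv_eq_fderiv_fun (hf : ContDiff ℝ ∞ f) :
    pderiv i f = fun x => fderiv ℝ f x (EuclideanSpace.single i 1) :=
  funext fun x => pderiv_eq_fderiv (hf.differentiable (by simp) x)

theorem contDiff_pderiv (hf : ContDiff ℝ ∞ f) : ContDiff ℝ ∞ (pderiv i f) := by
  rw [pderiv_eq_fderiv_fun hf]
  exact (hf.fderiv_right (m := ∞) (by simp)).clm_apply contDiff_const

theorem pderiv_mul {x : E n} (hf : DifferentiableAt ℝ f x) (hg : DifferentiableAt ℝ g x) :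
    pderiv i (fun y => f y * g y) x = f x * pderiv i g x + pderiv i f x * g x := by
  rw [pderiv_eq_fderiv hf, pderiv_eq_fderiv hg, pderiv_eq_fderiv (hf.fun_mul hg),
    fderiv_fun_mul hf hg]
  simp [mul_comm]

theorem pderiv_add {x : E n} (hf : DifferentiableAt ℝ f x) (hg : DifferentiableAt ℝ g x) :
    pderiv i (fun y => f y + g y) x = pderiv i f x + pderiv i g x := by
  rw [pderiv_eq_fderiv hf, pderiv_eq_fderiv hg, pderiv_eq_fderiv (hf.fun_add hg),
    fderiv_fun_add hf hg]
  simp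

theorem pderiv_sub {x : E n} (hf : DifferentiableAt ℝ f x) (hg : DifferentiableAt ℝ g x) :
    pderiv i (fun y => f y - g y) x = pderiv i f x - pderiv i g x := by
  rw [pderiv_eq_fderiv hf, pderiv_eq_fderiv hg, pderiv_eq_fderiv (hf.fun_sub hg),
    fderiv_fun_sub hf hg]
  simp

theorem pderiv_const_mul {x : E n} (c : ℝ) (hf : DifferentiableAt ℝ f x) :
    pderiv i (fun y => c * f y) x = c * pderiv i f x := by
  rw [pderiv_eq_fderiv hf, pderiv_eq_fderiv (hf.const_mul c), fderiv_const_mul hf]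
  simp

theorem pderiv_comp_add (a x : E n) :
    pderiv i (fun y => f (y + a)) x = pderiv i f (x + a) := by
  simp only [pderiv, lineDeriv]
  congr 1
  ext t
  congr 1
  abel

theorem pderiv_comm (hf : ContDiff ℝ ∞ f) : pderiv i (pderiv j f) = pderiv j (pderiv i f) := by
  ext x
  have hd : DifferentiableAt ℝ (fderiv ℝ f) x :=
    ((hf.fderiv_right (m := 1) (WithTop.coe_le_coe.2 le_top)).differentiable (by simp)) x
  have key : ∀ k l : Fin n, pderiv k (pderiv l f) x =
      fderiv ℝ (fderiv ℝ f) x (EuclideanSpace.single k 1) (EuclideanSpace.single l 1) := by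
    intro k l
    rw [pderiv_eq_fderiv ((contDiff_pderiv hf).differentiable (by simp) x),
      pderiv_eq_fderiv_fun hf, fderiv_clm_apply hd (by fun_prop)]
    simp
  rw [key, key]
  exact (hf.contDiffAt.isSymmSndFDerivAt (by
    simp only [minSmoothness_of_isRCLikeNormedField]
    exact WithTop.coe_le_coe.2 (le_top : (2 : ℕ∞) ≤ ⊤))) _ _

theorem tsupport_pderiv_subset (hf : ContDiff ℝ ∞ f) : tsupport (pderiv i f) ⊆ tsupport f := by
  rw [pderiv_eq_fderiv_fun hf]
  refine (closure_minimal ?_ (isClosed_tsupport _)).trans (tsupport_fderiv_subset ℝ)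
  intro x hx
  refine subset_tsupport _ ?_
  intro h
  exact hx (by simp [h])

theorem IsTestFun.mono (h : IsTestFun U φ) (hUV : U ⊆ V) : IsTestFun V φ :=
  ⟨h.smooth, h.compact, h.supp.trans hUV⟩

theorem IsTestFun.continuous (h : IsTestFun U φ) : Continuous φ := h.smooth.continuous

theorem IsTestFun.differentiable (h : IsTestFun U φ) : Differentiable ℝ φ :=
  h.smooth.differentiable (by simp)

theorem IsTestFun.pderiv (h : IsTestFun U φ) : IsTestFun U (pderiv i φ) where
  smooth := contDiff_pderiv h.smooth
  compact := h.compact.of_isClosed_subset (isClosed_tsupport _) (tsupport_pderiv_subset h.smooth)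
  supp := (tsupport_pderiv_subset h.smooth).trans h.supp

theorem IsTestFun.mul_left (h : IsTestFun U φ) (hf : ContDiff ℝ ∞ f) :
    IsTestFun U (fun x => f x * φ x) where
  smooth := hf.mul h.smooth
  compact := h.compact.mul_left
  supp := (tsupport_mul_subset_right (f := f) (g := φ)).trans h.supp

theorem IsTestFun.mul_right (h : IsTestFun U φ) (hf : ContDiff ℝ ∞ f) :
    IsTestFun U (fun x => φ x * f x) := by
  simpa only [mul_comm] using h.mul_left hf

theorem IsTestFun.add (h : IsTestFun U φ) (h' : IsTestFun U ψ) :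
    IsTestFun U (fun x => φ x + ψ x) where
  smooth := h.smooth.add h'.smooth
  compact := h.compact.add h'.compact
  supp := (tsupport_add φ ψ).trans (union_subset h.supp h'.supp)

theorem IsTestFun.const_mul (h : IsTestFun U φ) (c : ℝ) : IsTestFun U (fun x => c * φ x) :=
  h.mul_left contDiff_const

theorem IsTestFun.sub (h : IsTestFun U φ) (h' : IsTestFun U ψ) :
    IsTestFun U (fun x => φ x - ψ x) := by
  simpa [sub_eq_add_neg] using h.add (h'.const_mul (-1))

theorem IsTestFun.comp_add (h : IsTestFun U φ) {a : E n}
    (hUV : ∀ x, x + a ∈ tsupport φ → x ∈ V) : IsTestFun V (fun x => φ (x + a)) where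
  smooth := h.smooth.comp (contDiff_id.add contDiff_const)
  compact := h.compact.comp_homeomorph (Homeomorph.addRight a)
  supp := by
    have := tsupport_comp_eq_preimage φ (Homeomorph.addRight a)
    intro x hx
    refine hUV x ?_
    have hx' : x ∈ tsupport (φ ∘ Homeomorph.addRight a) := hx
    rw [this] at hx'
    exact hx'

theorem IsTestFun.eq_zero (h : IsTestFun U φ) {x : E n} (hx : x ∉ U) : φ x = 0 :=
  image_eq_zero_of_notMem_tsupport fun h' => hx (h.supp h')

theorem IsTestFun.exists_bound (h : IsTestFun U φ) : ∃ C, 0 ≤ C ∧ ∀ x, |φ x| ≤ C := by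
  obtain ⟨C, hC⟩ := h.compact.exists_bound_of_continuous h.continuous
  exact ⟨max C 0, le_max_right _ _, fun x => (hC x).trans (le_max_left _ _)⟩

theorem IsTestFun.memLp (h : IsTestFun U φ) (p : ℝ≥0∞) (μ : Measure (E n))
    [IsFiniteMeasureOnCompacts μ] : MemLp φ p μ :=
  h.continuous.memLp_of_hasCompactSupport h.compact

theorem IsTestFun.setIntegral_eq (h : IsTestFun U φ) (hUV : U ⊆ V) (f : E n → ℝ) :
    ∫ x in V, f x * φ x = ∫ x in U, f x * φ x := by
  rw [setIntegral_eq_integral_of_forall_compl_eq_zero (s := V),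
    setIntegral_eq_integral_of_forall_compl_eq_zero (s := U)]
  · intro x hx; simp [h.eq_zero hx]
  · intro x hx; simp [h.eq_zero fun hx' => hx (hUV hx')]

theorem IsTestFun.setIntegral_eq_integral (h : IsTestFun U φ) (f : E n → ℝ) :
    ∫ x in U, f x * φ x = ∫ x, f x * φ x :=
  setIntegral_eq_integral_of_forall_compl_eq_zero fun x hx => by simp [h.eq_zero hx]

/-- Integration by parts of a line differentiable function against a test function. -/
theorem integral_mul_pderiv_eq_neg {a : E n → ℝ} (hφ : IsTestFun U φ)
    (ha : ∀ x ∈ U, LineDifferentiableAt ℝ a x (EuclideanSpace.single i (1 : ℝ)))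
    (h1 : IntegrableOn (fun x => pderiv i a x * φ x) U)
    (h2 : IntegrableOn (fun x => a x * pderiv i φ x) U)
    (h3 : IntegrableOn (fun x => a x * φ x) U) :
    ∫ x in U, a x * pderiv i φ x = - ∫ x in U, pderiv i a x * φ x := by
  rw [hφ.pderiv.setIntegral_eq_integral, hφ.setIntegral_eq_integral]
  have aux : ∀ f ψ : E n → ℝ, IsTestFun U ψ → IntegrableOn (fun x => f x * ψ x) U →
      Integrable (fun x => f x * ψ x) := by
    intro f ψ hψ h
    rwa [integrableOn_iff_integrable_of_support_subset] at h
    intro x hx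
    by_contra hxU
    exact hx (by simp [hψ.eq_zero hxU])
  exact integral_bilinear_hasLineDerivAt_right_eq_neg_left_of_integrable
    (B := ContinuousLinearMap.mul ℝ ℝ) (aux _ _ hφ h1) (aux _ _ hφ.pderiv h2) (aux _ _ hφ h3)
    (fun x hx => (ha x (hφ.supp hx)).hasLineDerivAt)
    (fun x _ => ((hφ.differentiable x).lineDifferentiableAt).hasLineDerivAt)

end TestFunctions

/-! ### Integrals of products and convergence in mean square -/

section MeanSquare
variable {α : Type*} [MeasurableSpace α] {μ : Measure α} {f g h : α → ℝ}

theorem sq_toReal_eLpNorm (hf : MemLp f 2 μ) : (eLpNorm f 2 μ).toReal ^ 2 = ∫ x, f x ^ 2 ∂μ := by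
  have h := hf.eLpNorm_eq_integral_rpow_norm two_ne_zero ENNReal.ofNat_ne_top
  rw [h, ENNReal.toReal_ofReal (by positivity)]
  have h0 : 0 ≤ ∫ x, f x ^ 2 ∂μ := integral_nonneg fun x => sq_nonneg _
  simp only [ENNReal.toReal_ofNat, Real.rpow_ofNat, Real.norm_eq_abs, sq_abs]
  rw [← Real.rpow_natCast, ← Real.rpow_mul h0]
  norm_num

theorem integrable_mul_of_memLp_two (hf : MemLp f 2 μ) (hg : MemLp g 2 μ) :
    Integrable (fun x => f x * g x) μ := hf.integrable_mul hg

theorem abs_integral_mul_le (hf : MemLp f 2 μ) (hg : MemLp g 2 μ) :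
    |∫ x, f x * g x ∂μ| ≤ (eLpNorm f 2 μ).toReal * (eLpNorm g 2 μ).toReal := by
  have h := abs_real_inner_le_norm (hg.toLp g) (hf.toLp f)
  rw [L2.inner_def, Lp.norm_toLp, Lp.norm_toLp, mul_comm] at h
  refine le_of_eq_of_le ?_ h
  congr 1
  refine integral_congr_ae ?_
  filter_upwards [hf.coeFn_toLp, hg.coeFn_toLp] with x hx hy
  simp [hx, hy]

/-- Convergence of a sequence of functions in `L²(μ)`. -/
def TendstoL2 (μ : Measure α) (F : ℕ → α → ℝ) (f : α → ℝ) : Prop :=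
  Tendsto (fun m => eLpNorm (fun x => F m x - f x) 2 μ) atTop (𝓝 0)

variable {F G : ℕ → α → ℝ}

theorem TendstoL2.mono_measure {ν : Measure α} (hF : TendstoL2 μ F f) (h : ν ≤ μ) :
    TendstoL2 ν F f :=
  tendsto_of_tendsto_of_tendsto_of_le_of_le tendsto_const_nhds hF (fun _ => bot_le)
    fun _ => eLpNorm_mono_measure _ h

theorem TendstoL2.congr_ae (hF : TendstoL2 μ F f) (hG : ∀ m, F m =ᵐ[μ] G m) (h : f =ᵐ[μ] g) :
    TendstoL2 μ G g := by
  refine hF.congr fun m => eLpNorm_congr_ae ?_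
  filter_upwards [hG m, h] with x h1 h2
  rw [h1, h2]

theorem TendstoL2.add (hF : TendstoL2 μ F f) (hG : TendstoL2 μ G g)
    (hFm : ∀ m, MemLp (F m) 2 μ) (hGm : ∀ m, MemLp (G m) 2 μ) (hf : MemLp f 2 μ)
    (hg : MemLp g 2 μ) : TendstoL2 μ (fun m x => F m x + G m x) (fun x => f x + g x) := by
  have h := Tendsto.add hF hG
  rw [add_zero] at h
  refine tendsto_of_tendsto_of_tendsto_of_le_of_le tendsto_const_nhds h (fun _ => bot_le)
    fun m => ?_
  refine le_of_eq_of_le ?_ (eLpNorm_add_le ((hFm m).sub hf).1 ((hGm m).sub hg).1 (by norm_num))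
  congr 1
  ext x
  simp only [Pi.add_apply]
  ring

theorem TendstoL2.mul_bounded {h : α → ℝ} {C : ℝ} (hF : TendstoL2 μ F f) (hh : ∀ᵐ x ∂μ, |h x| ≤ C) :
    TendstoL2 μ (fun m x => h x * F m x) (fun x => h x * f x) := by
  have h0 := ENNReal.Tendsto.const_mul (a := ENNReal.ofReal C) hF (Or.inr ENNReal.ofReal_ne_top)
  rw [mul_zero] at h0
  refine tendsto_of_tendsto_of_tendsto_of_le_of_le tendsto_const_nhds h0 (fun _ => bot_le)
    fun m => ?_
  refine eLpNorm_le_mul_eLpNorm_of_ae_le_mul ?_ _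
  filter_upwards [hh] with x hx
  rw [← mul_sub, norm_mul]
  gcongr
  exact hx

theorem TendstoL2.integral_mul (hF : TendstoL2 μ F f) (hFm : ∀ m, MemLp (F m) 2 μ)
    (hf : MemLp f 2 μ) (hh : MemLp h 2 μ) :
    Tendsto (fun m => ∫ x, F m x * h x ∂μ) atTop (𝓝 (∫ x, f x * h x ∂μ)) := by
  rw [tendsto_iff_dist_tendsto_zero]
  have h0 : Tendsto (fun m => (eLpNorm (fun x => F m x - f x) 2 μ).toReal *
      (eLpNorm h 2 μ).toReal) atTop (𝓝 0) := by
    have := ((ENNReal.tendsto_toReal ENNReal.zero_ne_top).comp hF).mul_const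
      (eLpNorm h 2 μ).toReal
    simpa using this
  refine squeeze_zero (fun _ => dist_nonneg) (fun m => ?_) h0
  rw [Real.dist_eq, ← integral_sub (integrable_mul_of_memLp_two (hFm m) hh)
    (integrable_mul_of_memLp_two hf hh)]
  simp only [← sub_mul]
  exact abs_integral_mul_le ((hFm m).sub hf) hh

theorem TendstoL2.toReal_eLpNorm (hF : TendstoL2 μ F f) (hFm : ∀ m, MemLp (F m) 2 μ)
    (hf : MemLp f 2 μ) :
    Tendsto (fun m => (eLpNorm (F m) 2 μ).toReal) atTop (𝓝 (eLpNorm f 2 μ).toReal) := by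
  have h : Tendsto (fun m => (hFm m).toLp (F m)) atTop (𝓝 (hf.toLp f)) := by
    rw [Lp.tendsto_Lp_iff_tendsto_eLpNorm'']
    exact hF
  simpa only [Lp.norm_toLp] using h.norm

theorem TendstoL2.exists_subseq_ae (hF : TendstoL2 μ F f) (hFm : ∀ m, MemLp (F m) 2 μ)
    (hf : MemLp f 2 μ) : ∃ ns : ℕ → ℕ, StrictMono ns ∧
      ∀ᵐ x ∂μ, Tendsto (fun m => F (ns m) x) atTop (𝓝 (f x)) :=
  (tendstoInMeasure_of_tendsto_eLpNorm two_ne_zero (fun m => (hFm m).1) hf.1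
    hF).exists_seq_tendsto_ae

theorem TendstoL2.comp_tendsto (hF : TendstoL2 μ F f) {ns : ℕ → ℕ} (h : Tendsto ns atTop atTop) :
    TendstoL2 μ (fun m => F (ns m)) f := by
  unfold TendstoL2 at hF ⊢
  exact hF.comp h

theorem MemLp.mul_bounded {p : ℝ≥0∞} {a : α → ℝ} {C : ℝ} (hf : MemLp f p μ)
    (ha : AEStronglyMeasurable a μ) (hC : ∀ᵐ x ∂μ, |a x| ≤ C) : MemLp (fun x => a x * f x) p μ :=
  hf.of_le_mul (c := C) (ha.mul hf.1) (by
    filter_upwards [hC] with x hx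
    rw [norm_mul]
    gcongr
    exact hx)

end MeanSquare

/-! ### Cutoff functions -/

/-- The derivative is continuous and vanishes outside a compact interval, where the transition
function is locally constant. -/
theorem exists_smoothTransition_deriv_bound :
    ∃ K : ℝ, 0 < K ∧ ∀ x, |deriv Real.smoothTransition x| ≤ K := by
  have hc : Continuous (deriv Real.smoothTransition) :=
    (Real.smoothTransition.contDiff (n := 1)).continuous_deriv le_rfl
  obtain ⟨K, hK⟩ := (isCompact_Icc (a := (-1 : ℝ)) (b := 2)).exists_bound_of_continuousOn
    hc.continuousOn
  refine ⟨max K 1, by positivity, fun x => ?_⟩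
  by_cases hx : x ∈ Icc (-1 : ℝ) 2
  · exact (hK x hx).trans (le_max_left _ _)
  · have h0 : deriv Real.smoothTransition x = 0 := by
      rcases lt_or_ge x (-1) with h | h
      · have : Real.smoothTransition =ᶠ[𝓝 x] fun _ => 0 := by
          filter_upwards [Iio_mem_nhds h] with y hy
          exact Real.smoothTransition.zero_of_nonpos (by have := mem_Iio.1 hy; linarith)
        rw [this.deriv_eq, deriv_const]
      · have h2 : 2 < x := by
          by_contra h3
          exact hx ⟨h, not_lt.1 h3⟩
        have : Real.smoothTransition =ᶠ[𝓝 x] fun _ => 1 := by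
          filter_upwards [Ioi_mem_nhds h2] with y hy
          exact Real.smoothTransition.one_of_one_le (by have := mem_Ioi.1 hy; linarith)
        rw [this.deriv_eq, deriv_const]
    rw [h0, abs_zero]
    positivity

/-- Smooth cutoff functions between two concentric balls. -/
theorem exists_cutoff : ∃ c : ℝ, 0 < c ∧ ∀ (n : ℕ) (r s : ℝ), 0 < r → r < s →
    ∃ ζ : E n → ℝ, IsTestFun (B n s) ζ ∧ (∀ x, 0 ≤ ζ x) ∧ (∀ x, ζ x ≤ 1) ∧
      (∀ x ∈ B n r, ζ x = 1) ∧ ∀ i x, |pderiv i ζ x| ≤ c / (s - r) := by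
  obtain ⟨K, hK0, hK⟩ := exists_smoothTransition_deriv_bound
  refine ⟨4 * K, by positivity, fun n r s hr hrs => ?_⟩
  -- The cutoff already vanishes at radius `t`, strictly inside radius `s`, so its support is a
  -- compact subset of the open ball.
  set t := (r + s) / 2 with ht
  have hd : 0 < t ^ 2 - r ^ 2 := by nlinarith
  -- A quadratic profile, since `‖x‖ ^ 2` is smooth at the origin while `‖x‖` is not. It is at least
  -- `1` for `‖x‖ ≤ r` and at most `0` for `‖x‖ ≥ t`.
  set q : E n → ℝ := fun x => (t ^ 2 - ‖x‖ ^ 2) / (t ^ 2 - r ^ 2) with hq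
  have hqs : ContDiff ℝ ∞ q := (contDiff_const.sub (contDiff_norm_sq ℝ)).div_const _
  have hsm : ContDiff ℝ ∞ fun x => Real.smoothTransition (q x) :=
    Real.smoothTransition.contDiff.comp hqs
  have hzero : ∀ x : E n, t ≤ ‖x‖ → Real.smoothTransition (q x) = 0 := fun x hx => by
    refine Real.smoothTransition.zero_of_nonpos (div_nonpos_of_nonpos_of_nonneg ?_ hd.le)
    nlinarith
  have hts : tsupport (fun x => Real.smoothTransition (q x)) ⊆ Metric.closedBall (0 : E n) t := by
    refine closure_minimal (fun x hx => ?_) Metric.isClosed_closedBall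
    rw [mem_closedBall_zero_iff]
    by_contra h
    exact hx (hzero x (not_le.1 h).le)
  refine ⟨fun x => Real.smoothTransition (q x), ⟨hsm, ?_, ?_⟩, fun x =>
    Real.smoothTransition.nonneg _, fun x => Real.smoothTransition.le_one _, fun x hx => ?_,
    fun i x => ?_⟩
  · exact (isCompact_closedBall (0 : E n) t).of_isClosed_subset (isClosed_tsupport _) hts
  · exact hts.trans (Metric.closedBall_subset_ball (by linarith))
  · refine Real.smoothTransition.one_of_one_le ?_
    rw [le_div_iff₀ hd]
    have : ‖x‖ < r := mem_ball_zero_iff.1 hx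
    nlinarith [norm_nonneg x]
  · have hle : 0 ≤ 4 * K / (s - r) := by
      have : 0 < s - r := by linarith
      positivity
    -- Where the cutoff vanishes it attains its minimum, so its derivative is zero there without any
    -- computation.
    by_cases hx : t ≤ ‖x‖
    · by_cases hxt : pderiv i (fun x => Real.smoothTransition (q x)) x = 0
      · rwa [hxt, abs_zero]
      · exfalso
        apply hxt
        have hmin : IsLocalMin (fun x => Real.smoothTransition (q x)) x := by
          refine Eventually.of_forall fun y => ?_
          show Real.smoothTransition (q x) ≤ Real.smoothTransition (q y)
          rw [hzero x hx]
          exact Real.smoothTransition.nonneg _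
        rw [pderiv_eq_fderiv (hsm.differentiable (by simp) x), hmin.fderiv_eq_zero]
        rfl
    · have hx' : ‖x‖ < t := not_le.1 hx
      have hqd : HasFDerivAt q ((t ^ 2 - r ^ 2)⁻¹ • -((2 : ℕ) • (innerSL ℝ x : E n →L[ℝ] ℝ))) x := by
        have h1 := ((hasStrictFDerivAt_norm_sq x).hasFDerivAt.const_sub (t ^ 2)).const_smul
          ((t ^ 2 - r ^ 2)⁻¹)
        refine h1.congr_of_eventuallyEq (Eventually.of_forall fun y => ?_)
        simp [hq, div_eq_inv_mul]
      have hst : HasDerivAt Real.smoothTransition (deriv Real.smoothTransition (q x)) (q x) :=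
        ((Real.smoothTransition.contDiff (n := 1)).differentiable (by simp) _).hasDerivAt
      have hcomp := hst.comp_hasFDerivAt x hqd
      rw [pderiv_eq_fderiv (hsm.differentiable (by simp) x)]
      have : fderiv ℝ (fun x => Real.smoothTransition (q x)) x = _ := hcomp.fderiv
      rw [this]
      have hxi : |inner ℝ x (EuclideanSpace.single i (1 : ℝ))| ≤ t := by
        refine (abs_real_inner_le_norm _ _).trans ?_
        simp only [PiLp.norm_single, norm_one, mul_one]
        exact hx'.le
      simp only [smul_apply, neg_apply, smul_eq_mul,
        innerSL_apply_apply, abs_mul, abs_neg, abs_inv, abs_of_pos hd, nsmul_eq_mul]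
      -- `t ^ 2 - r ^ 2 = (t - r) * (t + r)` with `t - r = (s - r) / 2` and `t + r ≥ t`.
      have h2 : (t ^ 2 - r ^ 2)⁻¹ * (2 * t) ≤ 4 / (s - r) := by
        have : 0 < s - r := by linarith
        rw [inv_mul_eq_div, div_le_div_iff₀ hd this]
        nlinarith
      calc |deriv Real.smoothTransition (q x)| * ((t ^ 2 - r ^ 2)⁻¹ *
            (|((2 : ℕ) : ℝ)| * |inner ℝ x (EuclideanSpace.single i (1 : ℝ))|))
          ≤ K * ((t ^ 2 - r ^ 2)⁻¹ * (2 * t)) := by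
            gcongr
            · exact hK _
            · simp
        _ ≤ K * (4 / (s - r)) := by gcongr
        _ = 4 * K / (s - r) := by ring

/-! ### Weak derivatives in mean square -/

/-- `f, g ∈ L²(U)` and `g` is the weak partial derivative `∂ᵢ f` on `U`. -/
structure HasWeakPartial {n : ℕ} (U : Set (E n)) (i : Fin n) (f g : E n → ℝ) : Prop where
  memLp : MemLp f 2 (volume.restrict U)
  memLp' : MemLp g 2 (volume.restrict U)
  eq : ∀ φ : E n → ℝ, IsTestFun U φ → ∫ x in U, f x * pderiv i φ x = - ∫ x in U, g x * φ x

/-- `u ∈ H¹(U)` with weak gradient `g`. -/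
structure HasWeakGrad {n : ℕ} (U : Set (E n)) (u : E n → ℝ) (g : Fin n → E n → ℝ) : Prop where
  memLp : MemLp u 2 (volume.restrict U)
  part : ∀ i, HasWeakPartial U i u (g i)

/-! ### Mollification -/

section Minkowski
variable {α β : Type*} [MeasurableSpace α] [MeasurableSpace β] {μ : Measure α} {ν : Measure β}
  [SFinite μ] [IsProbabilityMeasure ν]

theorem sq_eLpNorm_two {γ : Type*} [MeasurableSpace γ] (κ : Measure γ) (f : γ → ℝ) :
    eLpNorm f 2 κ ^ 2 = ∫⁻ x, ‖f x‖ₑ ^ 2 ∂κ := by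
  have := eLpNorm_nnreal_pow_eq_lintegral (μ := κ) (f := f) (p := 2) two_ne_zero
  simpa using this

/-- Minkowski's inequality for averages: the `L²` norm of an average is at most a common bound
for the `L²` norms. -/
theorem eLpNorm_integral_le {F : α → β → ℝ}
    (hF : AEStronglyMeasurable (Function.uncurry F) (μ.prod ν)) {C : ℝ≥0∞}
    (hC : ∀ᵐ t ∂ν, eLpNorm (fun x => F x t) 2 μ ≤ C) :
    eLpNorm (fun x => ∫ t, F x t ∂ν) 2 μ ≤ C := by
  rw [← ENNReal.pow_le_pow_left_iff (n := 2) two_ne_zero, sq_eLpNorm_two]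
  calc ∫⁻ x, ‖∫ t, F x t ∂ν‖ₑ ^ 2 ∂μ
      ≤ ∫⁻ x, ∫⁻ t, ‖F x t‖ₑ ^ 2 ∂ν ∂μ := by
        -- For fixed `x` this is Jensen: `ν` is a probability measure, so the `L¹` norm in `t` is at
        -- most the `L²` norm. Tonelli then exchanges the two integrals.
        refine lintegral_mono_ae ?_
        filter_upwards [hF.prodMk_left] with x hx
        rw [← sq_eLpNorm_two]
        gcongr
        refine (enorm_integral_le_lintegral_enorm _).trans ?_
        rw [← eLpNorm_one_eq_lintegral_enorm]
        exact eLpNorm_le_eLpNorm_of_exponent_le (by norm_num) hx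
    _ = ∫⁻ t, ∫⁻ x, ‖F x t‖ₑ ^ 2 ∂μ ∂ν :=
        lintegral_lintegral_swap (hF.enorm.pow_const 2)
    _ ≤ ∫⁻ _, C ^ 2 ∂ν := by
        refine lintegral_mono_ae ?_
        filter_upwards [hC] with t ht
        rw [← sq_eLpNorm_two]
        gcongr
    _ = C ^ 2 := by simp

end Minkowski

section Mollify
variable {n : ℕ}

/-- Translations are continuous in `L²`. -/
theorem tendsto_eLpNorm_translate_sub {f : E n → ℝ} (hf : MemLp f 2 volume) :
    Tendsto (fun t => eLpNorm (fun x => f (x - t) - f x) 2 volume) (𝓝 0) (𝓝 0) := by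
  have : Fact ((2 : ℝ≥0∞) ≠ ⊤) := ⟨ENNReal.ofNat_ne_top⟩
  -- The translation action on `Lp` is continuous for finite exponents; the limit is read off at `t
  -- = 0`.
  have hc : Continuous fun t : E n => DomAddAct.mk (-t) +ᵥ hf.toLp f :=
    (DomAddAct.continuous_mk.comp continuous_neg).vadd continuous_const
  have h0 := hc.tendsto 0
  simp only [DomAddAct.mk_vadd_toLp] at h0
  rw [Lp.tendsto_Lp_iff_tendsto_eLpNorm''] at h0
  refine h0.congr fun t => eLpNorm_congr_ae (Eventually.of_forall fun x => ?_)
  simp [neg_add_eq_sub]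

/-- A sequence of bump functions with shrinking supports. -/
noncomputable def shrinkingBump (n : ℕ) (m : ℕ) : ContDiffBump (0 : E n) where
  rIn := 1 / (m + 2)
  rOut := 1 / (m + 1)
  rIn_pos := by positivity
  rIn_lt_rOut := by
    apply one_div_lt_one_div_of_lt <;> [positivity; linarith]

/-- The mollifications of `f`. -/
noncomputable def mollify (f : E n → ℝ) (m : ℕ) : E n → ℝ :=
  convolution f ((shrinkingBump n m).normed volume) (ContinuousLinearMap.mul ℝ ℝ) volume

theorem locallyIntegrable_of_memLp {f : E n → ℝ} (hf : MemLp f 2 volume) :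
    LocallyIntegrable f volume := hf.locallyIntegrable (by norm_num)

theorem contDiff_mollify {f : E n → ℝ} (hf : LocallyIntegrable f volume) (m : ℕ) :
    ContDiff ℝ ∞ (mollify f m) :=
  (shrinkingBump n m).hasCompactSupport_normed.contDiff_convolution_right _ hf
    (shrinkingBump n m).contDiff_normed

/-- The error of mollification at `x` is the average of `f (x - t) - f x` over the probability
measure with density the bump function. By Minkowski for averages its `L²` norm is at most the
largest translation error for `t` in the shrinking support. -/
theorem tendstoL2_mollify {f : E n → ℝ} (hf : MemLp f 2 volume) :
    TendstoL2 volume (mollify f) f := by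
  have htr := tendsto_eLpNorm_translate_sub hf
  rw [ENNReal.tendsto_nhds_zero] at htr
  unfold TendstoL2
  rw [ENNReal.tendsto_nhds_zero]
  intro ε hε
  obtain ⟨r, hr, hball⟩ := Metric.eventually_nhds_iff_ball.1 (htr ε hε)
  obtain ⟨N, hN⟩ := exists_nat_one_div_lt hr
  filter_upwards [eventually_ge_atTop N] with m hm
  set ρ : E n → ℝ := (shrinkingBump n m).normed volume with hρ
  have hρc : Continuous ρ := (shrinkingBump n m).continuous_normed
  have hρ0 : ∀ x, 0 ≤ ρ x := (shrinkingBump n m).nonneg_normed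
  have hρs : HasCompactSupport ρ := (shrinkingBump n m).hasCompactSupport_normed
  have hρi : Integrable ρ := hρc.integrable_of_hasCompactSupport hρs
  set ν : Measure (E n) := volume.withDensity fun x => ENNReal.ofReal (ρ x) with hν
  have hνp : IsProbabilityMeasure ν := ⟨by
    rw [hν, withDensity_apply _ MeasurableSet.univ, Measure.restrict_univ,
      ← ofReal_integral_eq_lintegral_ofReal hρi (Eventually.of_forall hρ0),
      (shrinkingBump n m).integral_normed, ENNReal.ofReal_one]⟩
  have hνint : ∀ h : E n → ℝ, ∫ t, h t ∂ν = ∫ t, ρ t * h t := fun h => by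
    rw [hν, integral_withDensity_eq_integral_toReal_smul (by fun_prop)
      (Eventually.of_forall fun _ => ENNReal.ofReal_lt_top)]
    simp [ENNReal.toReal_ofReal (hρ0 _)]
  have heq : ∀ x, mollify f m x - f x = ∫ t, (f (x - t) - f x) ∂ν := by
    intro x
    have hi : Integrable fun t => f (x - t) * ρ t := by
      have := (hρs.convolutionExists_right (ContinuousLinearMap.mul ℝ ℝ)
        (locallyIntegrable_of_memLp hf) hρc x).integrable_swap
      simpa using this
    rw [hνint]
    simp only [mul_sub]
    rw [integral_sub (by simpa only [mul_comm] using hi) (hρi.mul_const _), integral_mul_const,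
      (shrinkingBump n m).integral_normed, one_mul, mollify, convolution_eq_swap]
    simp [hρ, mul_comm]
  simp only [heq]
  refine eLpNorm_integral_le (F := fun x t => f (x - t) - f x) ?_ ?_
  · have h1 : AEStronglyMeasurable (fun p : E n × E n => f (p.1 - p.2)) (volume.prod ν) := by
      have hac : volume.prod ν ≪ (volume : Measure (E n)).prod volume :=
        Measure.AbsolutelyContinuous.rfl.prod (withDensity_absolutelyContinuous _ _)
      exact (hf.1.comp_quasiMeasurePreserving
        (quasiMeasurePreserving_sub_of_right_invariant volume volume)).mono_ac hac
    exact h1.sub hf.1.comp_fst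
  · rw [hν, ae_withDensity_iff (by fun_prop)]
    refine Eventually.of_forall fun t ht => hball t ?_
    have : t ∈ Function.support ρ := fun h => ht (by simp [h])
    rw [hρ, (shrinkingBump n m).support_normed_eq] at this
    refine Metric.ball_subset_ball ?_ this
    refine le_trans ?_ hN.le
    exact one_div_le_one_div_of_le (by positivity) (by gcongr)

/-- The derivative of the convolution falls on the kernel. As a function of `t`, the kernel `ρ (x -
t)` is a test function whose derivative has the opposite sign, which cancels the sign in the weak
derivative. -/
theorem pderiv_mollify {i : Fin n} {f g : E n → ℝ} (h : HasWeakPartial univ i f g) (m : ℕ) :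
    pderiv i (mollify f m) = mollify g m := by
  have hf : MemLp f 2 volume := by simpa using h.memLp
  set ρ : E n → ℝ := (shrinkingBump n m).normed volume with hρ
  have hρd : ContDiff ℝ ∞ ρ := (shrinkingBump n m).contDiff_normed
  have hρs : HasCompactSupport ρ := (shrinkingBump n m).hasCompactSupport_normed
  ext x
  have hfl := locallyIntegrable_of_memLp hf
  rw [pderiv_eq_fderiv ((contDiff_mollify hfl m).differentiable (by simp) x)]
  have hd := hρs.hasFDerivAt_convolution_right (ContinuousLinearMap.mul ℝ ℝ) hfl
    (hρd.of_le (by simp)) x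
  have hd' : fderiv ℝ (mollify f m) x = _ := hd.fderiv
  rw [hd', convolution_precompR_apply _ hfl (hρs.fderiv ℝ)
    ((hρd.continuous_fderiv (by simp)))]
  set ψ : E n → ℝ := fun t => ρ (x - t) with hψ
  have hψt : IsTestFun univ ψ := by
    refine ⟨hρd.comp (contDiff_const.sub contDiff_id), ?_, subset_univ _⟩
    exact hρs.comp_homeomorph (Homeomorph.subLeft x)
  have hψd : ∀ t, pderiv i ψ t = - fderiv ℝ ρ (x - t) (EuclideanSpace.single i 1) := by
    intro t
    rw [pderiv_eq_fderiv (hψt.differentiable t)]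
    have h1 : HasFDerivAt ρ (fderiv ℝ ρ (x - t)) (x - t) :=
      (hρd.differentiable (by simp) _).hasFDerivAt
    have h2 : HasFDerivAt ψ _ t := h1.comp t ((hasFDerivAt_id t).const_sub x)
    rw [h2.fderiv]
    simp
  have heq := h.eq ψ hψt
  simp only [hψd, Measure.restrict_univ, mul_neg, integral_neg, neg_inj] at heq
  simpa [convolution, mollify, hψ, hρ] using heq

/-- Mollifying enlarges the support by at most the outer radius of the bump, and a compact set has a
positive margin inside an open one. -/
theorem isTestFun_mollify {U K : Set (E n)} {f : E n → ℝ} (hf : LocallyIntegrable f volume)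
    (hK : IsCompact K) (hU : IsOpen U) (hKU : K ⊆ U) (hfK : ∀ x ∉ K, f x = 0) :
    ∃ N : ℕ, ∀ m ≥ N, IsTestFun U (mollify f m) := by
  obtain ⟨r, hr, hrU⟩ := hK.exists_cthickening_subset_open hU hKU
  obtain ⟨N, hN⟩ := exists_nat_one_div_lt hr
  refine ⟨N, fun m hm => ?_⟩
  have hsupp : tsupport (mollify f m) ⊆ Metric.cthickening r K := by
    refine closure_minimal (fun x hx => ?_) Metric.isClosed_cthickening
    obtain ⟨y, hy, z, hz, rfl⟩ := support_convolution_subset _ hx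
    rw [(shrinkingBump n m).support_normed_eq, mem_ball_zero_iff] at hz
    have hyK : y ∈ K := by
      by_contra hyK
      exact hy (hfK y hyK)
    refine Metric.mem_cthickening_of_dist_le _ y _ _ hyK ?_
    rw [dist_eq_norm, add_sub_cancel_left]
    refine hz.le.trans (le_trans ?_ hN.le)
    exact one_div_le_one_div_of_le (by positivity) (by gcongr)
  exact ⟨contDiff_mollify hf m, (hK.cthickening).of_isClosed_subset (isClosed_tsupport _) hsupp,
    hsupp.trans hrU⟩

/-- A compactly supported `H¹` function is a limit in `H¹` of test functions. -/
theorem exists_testFun_approx {U K : Set (E n)} {f : E n → ℝ} {g : Fin n → E n → ℝ}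
    (h : HasWeakGrad univ f g) (hK : IsCompact K) (hU : IsOpen U) (hKU : K ⊆ U)
    (hfK : ∀ x ∉ K, f x = 0) :
    ∃ φ : ℕ → E n → ℝ, (∀ m, IsTestFun U (φ m)) ∧ TendstoL2 volume φ f ∧
      ∀ i, TendstoL2 volume (fun m => pderiv i (φ m)) (g i) := by
  have hf : MemLp f 2 volume := by simpa using h.memLp
  obtain ⟨N, hN⟩ := isTestFun_mollify (locallyIntegrable_of_memLp hf) hK hU hKU hfK
  refine ⟨fun m => mollify f (m + N), fun m => hN _ (by omega),
    (tendstoL2_mollify hf).comp_tendsto (tendsto_add_atTop_nat N), fun i => ?_⟩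
  simp only [pderiv_mollify (h.part i)]
  have hg : MemLp (g i) 2 volume := by simpa using (h.part i).memLp'
  exact (tendstoL2_mollify hg).comp_tendsto (tendsto_add_atTop_nat N)

end Mollify

/-! ### Functions with bounded classical partial derivatives -/

section BoundedDerivs
variable {n : ℕ} {U V : Set (E n)} {a : E n → ℝ} {M : ℝ} {i : Fin n}

theorem HasBoundedDerivs.mono_set (h : V ⊆ U) : ∀ {k : ℕ} {a : E n → ℝ},
    HasBoundedDerivs U M k a → HasBoundedDerivs V M k a
  | 0, _, ha => fun x hx => ha x (h hx)
  | _ + 1, _, ha => ⟨fun x hx => ha.1 x (h hx), fun i =>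
      ⟨fun x hx => (ha.2 i).1 x (h hx), (ha.2 i).2.mono_set h⟩⟩

theorem HasBoundedDerivs.bound : ∀ {k : ℕ}, HasBoundedDerivs U M k a → ∀ x ∈ U, |a x| ≤ M
  | 0, ha => ha
  | _ + 1, ha => ha.1

theorem HasBoundedDerivs.mono_order : ∀ {k l : ℕ} {a : E n → ℝ}, l ≤ k →
    HasBoundedDerivs U M k a → HasBoundedDerivs U M l a
  | _, 0, _, _, ha => ha.bound
  | _ + 1, _ + 1, _, hlk, ha => ⟨ha.1, fun i =>
      ⟨(ha.2 i).1, (ha.2 i).2.mono_order (Nat.le_of_succ_le_succ hlk)⟩⟩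

theorem hasDerivAt_line {x e : E n} {t : ℝ} (h : LineDifferentiableAt ℝ a (x + t • e) e) :
    HasDerivAt (fun s : ℝ => a (x + s • e)) (lineDeriv ℝ a (x + t • e) e) t := by
  have h1 : HasDerivAt (fun s : ℝ => a (x + t • e + s • e)) (lineDeriv ℝ a (x + t • e) e) (t - t) := by
    rw [sub_self]
    exact h.hasLineDerivAt
  refine (h1.comp_sub_const t t).congr_of_eventuallyEq (Eventually.of_forall fun s => ?_)
  simp only [add_assoc, ← add_smul]
  congr 3
  ring

/-- The mean value inequality along a coordinate segment, which convexity keeps inside `U`. -/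
theorem HasBoundedDerivs.abs_sub_le (h : HasBoundedDerivs U M 1 a) (hU : Convex ℝ U) {x : E n}
    {t : ℝ} (hx : x ∈ U) (hxt : x + t • EuclideanSpace.single i (1 : ℝ) ∈ U) :
    |a (x + t • EuclideanSpace.single i (1 : ℝ)) - a x| ≤ M * |t| := by
  set e : E n := EuclideanSpace.single i (1 : ℝ)
  have hseg : ∀ s ∈ uIcc 0 t, x + s • e ∈ U := by
    have hc : Convex ℝ ((fun s : ℝ => x + s • e) ⁻¹' U) := by
      have := hU.affine_preimage (AffineMap.lineMap x (x + e) : ℝ →ᵃ[ℝ] E n)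
      have he : (fun s : ℝ => x + s • e) = (AffineMap.lineMap x (x + e) : ℝ →ᵃ[ℝ] E n) := by
        ext s
        simp [AffineMap.lineMap_apply, add_comm]
      rwa [← he] at this
    have := hc.ordConnected.uIcc_subset (x := 0) (y := t) (by simpa using hx) hxt
    exact this
  have hd : ∀ s ∈ uIcc 0 t, HasDerivWithinAt (fun s : ℝ => a (x + s • e))
      (lineDeriv ℝ a (x + s • e) e) (uIcc 0 t) s := fun s hs =>
    (hasDerivAt_line ((h.2 i).1 _ (hseg s hs))).hasDerivWithinAt
  have := (convex_uIcc (0 : ℝ) t).norm_image_sub_le_of_norm_hasDerivWithin_le hd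
    (fun s hs => (h.2 i).2 _ (hseg s hs)) left_mem_uIcc right_mem_uIcc
  simpa using this

/-- Partial derivatives alone do not give continuity, but bounded ones do: pass from `x` to `y` by
changing one coordinate at a time, each change costing at most `M` times the change of that
coordinate. -/
theorem HasBoundedDerivs.continuousOn (h : HasBoundedDerivs U M 1 a) (hU : IsOpen U) :
    ContinuousOn a U := by
  intro x hx
  refine ContinuousAt.continuousWithinAt ?_
  obtain ⟨r, hr, hrU⟩ := Metric.isOpen_iff.1 hU x hx
  have hb : HasBoundedDerivs (Metric.ball x r) M 1 a := h.mono_set hrU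
  have hcoord : ∀ (y : E n) (j : Fin n), |y j - x j| ≤ ‖y - x‖ := fun y j => by
    have := PiLp.norm_apply_le (y - x) j
    simpa using this
  have key : ∀ y ∈ Metric.ball x r, ∀ s : Finset (Fin n),
      |a (WithLp.toLp 2 (s.piecewise y x)) - a x| ≤ ∑ j ∈ s, M * |y j - x j| := by
    intro y hy s
    -- Each intermediate point has coordinates taken from `x` or `y`, so it is no farther from `x`
    -- than `y` is, and the whole path stays in the ball.
    have hmem : ∀ s : Finset (Fin n), WithLp.toLp 2 (s.piecewise y x) ∈ Metric.ball x r := by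
      intro s
      refine lt_of_le_of_lt ?_ (Metric.mem_ball.1 hy)
      rw [dist_eq_norm, dist_eq_norm, EuclideanSpace.norm_eq, EuclideanSpace.norm_eq]
      refine Real.sqrt_le_sqrt (Finset.sum_le_sum fun j _ => ?_)
      by_cases hj : j ∈ s <;> simp [hj]
      positivity
    induction s using Finset.induction_on with
    | empty => simp
    | insert j s hj ih =>
      rw [Finset.sum_insert hj]
      have hstep : WithLp.toLp 2 ((insert j s).piecewise y x) =
          WithLp.toLp 2 (s.piecewise y x) + (y j - x j) • EuclideanSpace.single j (1 : ℝ) := by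
        ext l
        by_cases hl : l = j
        · subst hl
          simp [hj]
        · by_cases hls : l ∈ s <;> simp [hl, hls, Finset.piecewise]
      have h1 := hb.abs_sub_le (i := j) (convex_ball x r) (hmem s)
        (t := y j - x j) (by rw [← hstep]; exact hmem _)
      rw [← hstep] at h1
      exact (_root_.abs_sub_le _ _ _).trans (add_le_add h1 ih)
  rw [Metric.continuousAt_iff']
  have hlim : Tendsto (fun y : E n => ∑ j, M * |y j - x j|) (𝓝 x) (𝓝 0) := by
    have : Continuous fun y : E n => ∑ j, M * |y j - x j| := by fun_prop
    simpa using this.tendsto x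
  intro ε hε
  filter_upwards [hlim.eventually_lt_const hε, Metric.ball_mem_nhds x hr] with y hy1 hy2
  refine lt_of_le_of_lt ?_ hy1
  have := key y hy2 Finset.univ
  rw [Finset.piecewise_univ] at this
  exact this

theorem HasBoundedDerivs.aestronglyMeasurable (h : HasBoundedDerivs U M 1 a) (hU : IsOpen U) :
    AEStronglyMeasurable a (volume.restrict U) :=
  (h.continuousOn hU).aestronglyMeasurable hU.measurableSet

/-- At order one the partial derivative is not known to be continuous. It is, however, the pointwise
limit of difference quotients with steps `1 / (m + 1)` of the extension by zero, which is
measurable. -/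
theorem HasBoundedDerivs.aestronglyMeasurable_pderiv (h : HasBoundedDerivs U M 1 a)
    (hU : IsOpen U) : AEStronglyMeasurable (pderiv i a) (volume.restrict U) := by
  set e : E n := EuclideanSpace.single i (1 : ℝ)
  set a' : E n → ℝ := U.indicator a with ha'
  have hm : Measurable a' := by
    classical
    rw [ha', ← piecewise_eq_indicator]
    exact (h.continuousOn hU).measurable_piecewise continuousOn_const hU.measurableSet
  have hlim0 : Tendsto (fun m : ℕ => (1 / ((m : ℝ) + 1))) atTop (𝓝[≠] 0) :=
    tendsto_nhdsWithin_iff.2 ⟨tendsto_one_div_add_atTop_nhds_zero_nat,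
      Eventually.of_forall fun m => by simp; positivity⟩
  refine aestronglyMeasurable_of_tendsto_ae atTop
    (f := fun (m : ℕ) x => (1 / ((m : ℝ) + 1))⁻¹ • (a' (x + (1 / ((m : ℝ) + 1)) • e) - a' x))
    (fun m => ?_) ?_
  · exact (((hm.comp (measurable_id.add_const _)).sub hm).const_mul
      (1 / ((m : ℝ) + 1))⁻¹).aestronglyMeasurable
  · filter_upwards [self_mem_ae_restrict hU.measurableSet] with x hx
    have hd : HasDerivAt (fun t : ℝ => a (x + t • e)) (pderiv i a x) 0 :=
      ((h.2 i).1 x hx).hasLineDerivAt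
    have hs := (hasDerivAt_iff_tendsto_slope_zero.1 hd).comp hlim0
    refine hs.congr' ?_
    have hev : ∀ᶠ m : ℕ in atTop, x + (1 / ((m : ℝ) + 1)) • e ∈ U := by
      have hc : Tendsto (fun m : ℕ => x + (1 / ((m : ℝ) + 1)) • e) atTop (𝓝 (x + (0 : ℝ) • e)) :=
        tendsto_const_nhds.add (tendsto_one_div_add_atTop_nhds_zero_nat.smul_const e)
      rw [zero_smul, add_zero] at hc
      exact hc.eventually (hU.mem_nhds hx)
    filter_upwards [hev] with m hm'
    simp only [Function.comp, zero_add, zero_smul, add_zero]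
    rw [ha', indicator_of_mem hm', indicator_of_mem hx]

end BoundedDerivs

/-! ### Calculus of weak derivatives -/

section WeakCalculus
variable {n : ℕ} {U V : Set (E n)} {i : Fin n} {f f' g g' : E n → ℝ}

/-- Approximation of `H¹` functions by test functions is available only on strictly smaller balls.
This leaves room: any single test function already lives on one. -/
theorem IsTestFun.exists_ball {δ : ℝ} {φ : E n → ℝ} (hδ : 0 < δ) (h : IsTestFun (B n δ) φ) :
    ∃ r, 0 < r ∧ r < δ ∧ IsTestFun (B n r) φ := by
  obtain ⟨r, hr, hs⟩ := exists_pos_lt_subset_ball hδ (isClosed_tsupport φ) h.supp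
  exact ⟨r, hr.1, hr.2, h.smooth, h.compact, hs⟩

theorem HasWeakPartial.mono (h : HasWeakPartial U i f g) (hV : V ⊆ U) :
    HasWeakPartial V i f g where
  memLp := h.memLp.mono_measure (Measure.restrict_mono hV le_rfl)
  memLp' := h.memLp'.mono_measure (Measure.restrict_mono hV le_rfl)
  eq := fun φ hφ => by
    rw [← hφ.pderiv.setIntegral_eq hV, ← hφ.setIntegral_eq hV]
    exact h.eq φ (hφ.mono hV)

theorem HasWeakGrad.mono {u : E n → ℝ} {g : Fin n → E n → ℝ} (h : HasWeakGrad U u g)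
    (hV : V ⊆ U) : HasWeakGrad V u g :=
  ⟨h.memLp.mono_measure (Measure.restrict_mono hV le_rfl), fun i => (h.part i).mono hV⟩

theorem HasWeakPartial.congr (h : HasWeakPartial U i f g) (hf : f =ᵐ[volume.restrict U] f')
    (hg : g =ᵐ[volume.restrict U] g') : HasWeakPartial U i f' g' where
  memLp := h.memLp.ae_eq hf
  memLp' := h.memLp'.ae_eq hg
  eq := fun φ hφ => by
    have h1 := integral_congr_ae (hf.mul (EventuallyEq.refl _ (pderiv i φ)))
    have h2 := integral_congr_ae (hg.mul (EventuallyEq.refl _ φ))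
    simp only [Pi.mul_apply] at h1 h2
    rw [← h1, ← h2]
    exact h.eq φ hφ

theorem HasWeakPartial.add (h : HasWeakPartial U i f g) (h' : HasWeakPartial U i f' g') :
    HasWeakPartial U i (fun x => f x + f' x) (fun x => g x + g' x) where
  memLp := h.memLp.add h'.memLp
  memLp' := h.memLp'.add h'.memLp'
  eq := fun φ hφ => by
    simp only [add_mul]
    rw [integral_add, integral_add, h.eq φ hφ, h'.eq φ hφ]
    · ring
    all_goals apply integrable_mul_of_memLp_two
    · exact h.memLp'
    · exact hφ.memLp _ _
    · exact h'.memLp'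
    · exact hφ.memLp _ _
    · exact h.memLp
    · exact hφ.pderiv.memLp _ _
    · exact h'.memLp
    · exact hφ.pderiv.memLp _ _

theorem HasWeakPartial.const_mul (h : HasWeakPartial U i f g) (c : ℝ) :
    HasWeakPartial U i (fun x => c * f x) (fun x => c * g x) where
  memLp := h.memLp.const_mul c
  memLp' := h.memLp'.const_mul c
  eq := fun φ hφ => by
    simp only [mul_assoc]
    rw [integral_const_mul, integral_const_mul, h.eq φ hφ]
    ring

theorem HasWeakPartial.ae_eq (hU : IsOpen U) (h : HasWeakPartial U i f g)
    (h' : HasWeakPartial U i f g') : g =ᵐ[volume.restrict U] g' := by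
  have hm : MemLp (fun x => g x - g' x) 2 (volume.restrict U) := h.memLp'.sub h'.memLp'
  have hl : LocallyIntegrableOn (fun x => g x - g' x) U volume :=
    locallyIntegrableOn_of_locallyIntegrable_restrict (hm.locallyIntegrable (by norm_num))
  have := hU.ae_eq_zero_of_integral_contDiff_smul_eq_zero hl fun φ h1 h2 h3 => by
    have hφ : IsTestFun U φ := ⟨h1, h2, h3⟩
    have : ∫ x in U, (g x - g' x) * φ x = 0 := by
      simp only [sub_mul]
      rw [integral_sub (integrable_mul_of_memLp_two h.memLp' (hφ.memLp _ _))
        (integrable_mul_of_memLp_two h'.memLp' (hφ.memLp _ _))]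
      linarith [h.eq φ hφ, h'.eq φ hφ]
    rw [hφ.setIntegral_eq_integral] at this
    simpa only [smul_eq_mul, mul_comm] using this
  refine (ae_restrict_iff' hU.measurableSet).2 ?_
  filter_upwards [this] with x hx hxU
  linarith [hx hxU]

theorem memLp_univ_of_restrict {p : ℝ≥0∞} (hU : MeasurableSet U) (h : MemLp f p (volume.restrict U))
    (hf : ∀ x ∉ U, f x = 0) : MemLp f p volume := by
  have := (memLp_indicator_iff_restrict hU).2 h
  rwa [indicator_eq_self.2] at this
  intro x hx
  by_contra hxU
  exact hx (hf x hxU)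

theorem IsTestFun.hasWeakPartial {φ : E n → ℝ} (hφ : IsTestFun V φ) :
    HasWeakPartial U i φ (InteriorElliptic.pderiv i φ) where
  memLp := hφ.memLp _ _
  memLp' := hφ.pderiv.memLp _ _
  eq := fun _ hψ => integral_mul_pderiv_eq_neg hψ
    (fun x _ => (hφ.differentiable x).lineDifferentiableAt)
    (integrable_mul_of_memLp_two (hφ.pderiv.memLp _ _) (hψ.memLp _ _))
    (integrable_mul_of_memLp_two (hφ.memLp _ _) (hψ.pderiv.memLp _ _))
    (integrable_mul_of_memLp_two (hφ.memLp _ _) (hψ.memLp _ _))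

theorem IsTestFun.hasWeakGrad {φ : E n → ℝ} (hφ : IsTestFun V φ) :
    HasWeakGrad U φ (fun i => InteriorElliptic.pderiv i φ) :=
  ⟨hφ.memLp _ _, fun _ => hφ.hasWeakPartial⟩

theorem IsTestFun.memLp_mul {φ : E n → ℝ} {p : ℝ≥0∞} (hφ : IsTestFun V φ)
    (hf : MemLp f p (volume.restrict U)) : MemLp (fun x => φ x * f x) p (volume.restrict U) := by
  obtain ⟨C, -, hC⟩ := hφ.exists_bound
  exact MemLp.mul_bounded hf hφ.continuous.aestronglyMeasurable (Eventually.of_forall hC)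

/-- Localization of a weak derivative by a cutoff function. -/
theorem HasWeakPartial.cutoff {ζ : E n → ℝ} (hU : MeasurableSet U) (h : HasWeakPartial U i f g)
    (hζ : IsTestFun U ζ) :
    HasWeakPartial univ i (fun x => ζ x * f x) (fun x => ζ x * g x + pderiv i ζ x * f x) where
  memLp := by
    rw [Measure.restrict_univ]
    exact memLp_univ_of_restrict hU (hζ.memLp_mul h.memLp) fun x hx => by simp [hζ.eq_zero hx]
  memLp' := by
    rw [Measure.restrict_univ]
    exact memLp_univ_of_restrict hU ((hζ.memLp_mul h.memLp').add (hζ.pderiv.memLp_mul h.memLp))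
      fun x hx => by simp [hζ.eq_zero hx, hζ.pderiv.eq_zero hx]
  eq := fun φ hφ => by
    have hζφ : IsTestFun U fun x => ζ x * φ x := hζ.mul_right hφ.smooth
    have s1 : ∫ x in U, ζ x * f x * pderiv i φ x = ∫ x, ζ x * f x * pderiv i φ x :=
      setIntegral_eq_integral_of_forall_compl_eq_zero fun x hx => by simp [hζ.eq_zero hx]
    have s2 : ∫ x in U, (ζ x * g x + pderiv i ζ x * f x) * φ x =
        ∫ x, (ζ x * g x + pderiv i ζ x * f x) * φ x :=
      setIntegral_eq_integral_of_forall_compl_eq_zero fun x hx => by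
        simp [hζ.eq_zero hx, hζ.pderiv.eq_zero hx]
    rw [setIntegral_univ, setIntegral_univ, ← s1, ← s2]
    have h1 := h.eq _ hζφ
    have e1 : ∀ x, f x * pderiv i (fun x => ζ x * φ x) x =
        ζ x * f x * pderiv i φ x + f x * (pderiv i ζ x * φ x) := fun x => by
      rw [pderiv_mul (hζ.differentiable x) (hφ.differentiable x)]
      ring
    have e2 : ∀ x, (ζ x * g x + pderiv i ζ x * f x) * φ x =
        g x * (ζ x * φ x) + f x * (pderiv i ζ x * φ x) := fun x => by ring
    simp only [e1, e2] at h1 ⊢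
    have i1 : Integrable (fun x => f x * (pderiv i ζ x * φ x)) (volume.restrict U) :=
      integrable_mul_of_memLp_two h.memLp ((hζ.pderiv.mul_right hφ.smooth).memLp _ _)
    rw [integral_add (integrable_mul_of_memLp_two (hζ.memLp_mul h.memLp) (hφ.pderiv.memLp _ _))
      i1] at h1
    rw [integral_add (integrable_mul_of_memLp_two h.memLp' (hζφ.memLp _ _)) i1]
    linarith

theorem HasWeakGrad.cutoff {u ζ : E n → ℝ} {g : Fin n → E n → ℝ} (hU : MeasurableSet U)
    (h : HasWeakGrad U u g) (hζ : IsTestFun U ζ) :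
    HasWeakGrad univ (fun x => ζ x * u x) (fun i x => ζ x * g i x + pderiv i ζ x * u x) := by
  refine ⟨?_, fun i => (h.part i).cutoff hU hζ⟩
  rw [Measure.restrict_univ]
  exact memLp_univ_of_restrict hU (hζ.memLp_mul h.memLp) fun x hx => by simp [hζ.eq_zero hx]

theorem exists_testFun_eq_one {r δ : ℝ} (hr : 0 < r) (hrδ : r < δ) :
    ∃ ζ : E n → ℝ, IsTestFun (B n δ) ζ ∧ ∀ x ∈ B n r, ζ x = 1 := by
  obtain ⟨c, -, hc⟩ := exists_cutoff
  obtain ⟨ζ, h1, -, -, h2, -⟩ := hc n r δ hr hrδ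
  exact ⟨ζ, h1, h2⟩

theorem pderiv_eq_zero_of_eq_const {ζ : E n → ℝ} {c : ℝ} (hU : IsOpen U) (h : ∀ x ∈ U, ζ x = c)
    {x : E n} (hx : x ∈ U) : pderiv i ζ x = 0 := by
  have he : ζ =ᶠ[𝓝 x] fun _ => c := by
    filter_upwards [hU.mem_nhds hx] with y hy using h y hy
  rw [pderiv, he.lineDeriv_eq]
  simp [lineDeriv]

/-- `H¹` functions on a ball are approximated by test functions on smaller balls. -/
theorem HasWeakGrad.exists_approx {u : E n → ℝ} {g : Fin n → E n → ℝ} {r δ : ℝ} (hr : 0 < r)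
    (hrδ : r < δ) (h : HasWeakGrad (B n δ) u g) :
    ∃ φ : ℕ → E n → ℝ, (∀ m, IsTestFun (B n δ) (φ m)) ∧ TendstoL2 (volume.restrict (B n r)) φ u ∧
      ∀ i, TendstoL2 (volume.restrict (B n r)) (fun m => pderiv i (φ m)) (g i) := by
  obtain ⟨ζ, hζ, hζ1⟩ := exists_testFun_eq_one (n := n) hr hrδ
  obtain ⟨φ, h1, h2, h3⟩ := exists_testFun_approx (h.cutoff measurableSet_ball hζ)
    hζ.compact Metric.isOpen_ball hζ.supp
    (fun x hx => by simp [image_eq_zero_of_notMem_tsupport hx])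
  have hmem : ∀ᵐ x ∂(volume.restrict (B n r)), x ∈ B n r := self_mem_ae_restrict measurableSet_ball
  refine ⟨φ, h1, (h2.mono_measure Measure.restrict_le_self).congr_ae (fun _ => ae_eq_rfl) ?_,
    fun i => ((h3 i).mono_measure Measure.restrict_le_self).congr_ae (fun _ => ae_eq_rfl) ?_⟩
  · filter_upwards [hmem] with x hx
    simp [hζ1 x hx]
  · filter_upwards [hmem] with x hx
    simp [hζ1 x hx, pderiv_eq_zero_of_eq_const Metric.isOpen_ball hζ1 hx]

theorem ball_subset_ball' {r δ : ℝ} (h : r ≤ δ) : B n r ⊆ B n δ := Metric.ball_subset_ball h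

theorem HasBoundedDerivs.memLp_mul {a : E n → ℝ} {M : ℝ} {p : ℝ≥0∞} (ha : HasBoundedDerivs U M 1 a)
    (hU : IsOpen U) (hf : MemLp f p (volume.restrict U)) :
    MemLp (fun x => a x * f x) p (volume.restrict U) :=
  MemLp.mul_bounded hf (ha.aestronglyMeasurable hU) (by
    filter_upwards [self_mem_ae_restrict hU.measurableSet] with x hx using ha.bound x hx)

theorem HasBoundedDerivs.memLp_pderiv_mul {a : E n → ℝ} {M : ℝ} {p : ℝ≥0∞}
    (ha : HasBoundedDerivs U M 1 a) (hU : IsOpen U) (hf : MemLp f p (volume.restrict U)) :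
    MemLp (fun x => pderiv i a x * f x) p (volume.restrict U) :=
  MemLp.mul_bounded hf (ha.aestronglyMeasurable_pderiv hU) (by
    filter_upwards [self_mem_ae_restrict hU.measurableSet] with x hx using (ha.2 i).2 x hx)

/-- The product of `a` with a test function is not smooth, so it cannot be inserted into the
definition of the weak derivative of `u`. Instead `u` is approximated by test functions `φ m` near
the support of `ψ`, `a` is integrated by parts against the smooth product `φ m * ψ`, and `m → ∞`. -/
theorem HasWeakGrad.mul_boundedDerivs {a u : E n → ℝ} {g : Fin n → E n → ℝ} {M δ : ℝ} (hδ : 0 < δ)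
    (ha : HasBoundedDerivs (B n δ) M 1 a) (h : HasWeakGrad (B n δ) u g) :
    HasWeakGrad (B n δ) (fun x => a x * u x) (fun i x => a x * g i x + pderiv i a x * u x) := by
  have hO : IsOpen (B n δ) := Metric.isOpen_ball
  refine ⟨ha.memLp_mul hO h.memLp, fun i => ⟨ha.memLp_mul hO h.memLp,
    (ha.memLp_mul hO (h.part i).memLp').add (ha.memLp_pderiv_mul hO h.memLp), fun ψ hψ => ?_⟩⟩
  obtain ⟨r, hr, hrδ, hψr⟩ := hψ.exists_ball hδ
  have hsub := ball_subset_ball' (n := n) hrδ.le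
  have hr' := h.mono hsub
  have har := ha.mono_set hsub
  have hOr : IsOpen (B n r) := Metric.isOpen_ball
  rw [hψr.pderiv.setIntegral_eq hsub, hψr.setIntegral_eq hsub]
  obtain ⟨φ, h1, h2, h3⟩ := h.exists_approx hr hrδ
  have m1 := har.memLp_mul hOr (hψr.pderiv (i := i).memLp 2 (volume.restrict (B n r)))
  have m2 := har.memLp_mul hOr (hψr.memLp 2 (volume.restrict (B n r)))
  have m3 := har.memLp_pderiv_mul (i := i) hOr (hψr.memLp 2 (volume.restrict (B n r)))
  have t1 := h2.integral_mul (fun m => (h1 m).memLp _ _) hr'.memLp m1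
  have t2 := (h3 i).integral_mul (fun m => (h1 m).pderiv.memLp _ _) (hr'.part i).memLp' m2
  have t3 := h2.integral_mul (fun m => (h1 m).memLp _ _) hr'.memLp m3
  have hm : ∀ m, ∫ x in B n r, φ m x * (a x * pderiv i ψ x) =
      -(∫ x in B n r, pderiv i (φ m) x * (a x * ψ x)) -
        ∫ x in B n r, φ m x * (pderiv i a x * ψ x) := by
    intro m
    have hφψ : IsTestFun (B n r) fun x => φ m x * ψ x := hψr.mul_left (h1 m).smooth
    have hp := integral_mul_pderiv_eq_neg (i := i) hφψ (fun x hx => (har.2 i).1 x hx) (by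
        have := integrable_mul_of_memLp_two ((h1 m).memLp 2 (volume.restrict (B n r))) m3
        refine this.congr (Eventually.of_forall fun x => ?_)
        simp only; ring) (memLp_one_iff_integrable.1 (har.memLp_mul hOr (hφψ.pderiv.memLp 1 _)))
      (memLp_one_iff_integrable.1 (har.memLp_mul hOr (hφψ.memLp 1 _)))
    have e1 : ∀ x, a x * pderiv i (fun x => φ m x * ψ x) x =
        φ m x * (a x * pderiv i ψ x) + pderiv i (φ m) x * (a x * ψ x) := fun x => by
      rw [pderiv_mul ((h1 m).differentiable x) (hψ.differentiable x)]
      ring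
    have e2 : ∀ x, pderiv i a x * (φ m x * ψ x) = φ m x * (pderiv i a x * ψ x) := fun x => by ring
    simp only [e1, e2] at hp
    rw [integral_add (integrable_mul_of_memLp_two ((h1 m).memLp _ _) m1)
      (integrable_mul_of_memLp_two ((h1 m).pderiv.memLp _ _) m2)] at hp
    linarith
  have hlim := tendsto_nhds_unique (t1.congr hm) (t2.neg.sub t3)
  have e1 : ∀ x, a x * u x * pderiv i ψ x = u x * (a x * pderiv i ψ x) := fun x => by ring
  have e2 : ∀ x, (a x * g i x + pderiv i a x * u x) * ψ x =
      g i x * (a x * ψ x) + u x * (pderiv i a x * ψ x) := fun x => by ring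
  simp only [e1, e2]
  rw [hlim, integral_add (integrable_mul_of_memLp_two (hr'.part i).memLp' m2)
    (integrable_mul_of_memLp_two hr'.memLp m3)]
  ring

instance {r : ℝ} : IsFiniteMeasure (volume.restrict (B n r)) :=
  ⟨by rw [Measure.restrict_apply_univ]; exact measure_ball_lt_top⟩

/-- The chain rule for weak derivatives. -/
theorem HasWeakGrad.comp {u : E n → ℝ} {g : Fin n → E n → ℝ} {G : ℝ → ℝ} {L δ : ℝ} (hδ : 0 < δ)
    (hG : ContDiff ℝ 1 G) (hL : ∀ t, |deriv G t| ≤ L) (h : HasWeakGrad (B n δ) u g) :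
    HasWeakGrad (B n δ) (fun x => G (u x)) (fun i x => deriv G (u x) * g i x) := by
  have hL0 : 0 ≤ L := (abs_nonneg _).trans (hL 0)
  have hGd : Differentiable ℝ G := hG.differentiable (by simp)
  have hG' : Continuous (deriv G) := hG.continuous_deriv le_rfl
  have hlip : ∀ s t, |G s - G t| ≤ L * |s - t| := fun s t =>
    Convex.norm_image_sub_le_of_norm_deriv_le (fun x _ => hGd x) (fun x _ => hL x) convex_univ
      (mem_univ t) (mem_univ s)
  have memG : ∀ {r : ℝ} {v : E n → ℝ}, MemLp v 2 (volume.restrict (B n r)) →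
      MemLp (fun x => G (v x)) 2 (volume.restrict (B n r)) := fun {r v} hv => by
    have h1 : MemLp (fun x => G (v x) - G 0) 2 (volume.restrict (B n r)) :=
      hv.of_le_mul (c := L) ((hG.continuous.comp_aestronglyMeasurable hv.1).sub aestronglyMeasurable_const)
        (Eventually.of_forall fun x => by simpa using hlip (v x) 0)
    exact (h1.add (memLp_const (G 0))).ae_eq (Eventually.of_forall fun x => by simp)
  have memG' : ∀ {r : ℝ} {v w : E n → ℝ}, MemLp v 2 (volume.restrict (B n r)) →
      MemLp w 2 (volume.restrict (B n r)) →
      MemLp (fun x => deriv G (v x) * w x) 2 (volume.restrict (B n r)) := fun {r v w} hv hw =>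
    MemLp.mul_bounded hw (hG'.comp_aestronglyMeasurable hv.1) (Eventually.of_forall fun x => hL _)
  refine ⟨memG h.memLp, fun i => ⟨memG h.memLp, memG' h.memLp (h.part i).memLp', fun ψ hψ => ?_⟩⟩
  obtain ⟨r, hr, hrδ, hψr⟩ := hψ.exists_ball hδ
  have hsub := ball_subset_ball' (n := n) hrδ.le
  have hr' := h.mono hsub
  rw [hψr.pderiv.setIntegral_eq hsub, hψr.setIntegral_eq hsub]
  obtain ⟨φ', h1', h2', h3'⟩ := h.exists_approx hr hrδ
  obtain ⟨ns, hns, hae⟩ := h2'.exists_subseq_ae (fun m => (h1' m).memLp _ _) hr'.memLp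
  set φ : ℕ → E n → ℝ := fun m => φ' (ns m) with hφ
  have h1 : ∀ m, IsTestFun (B n δ) (φ m) := fun m => h1' _
  have h2 : TendstoL2 (volume.restrict (B n r)) φ u := h2'.comp_tendsto hns.tendsto_atTop
  have h3 : TendstoL2 (volume.restrict (B n r)) (fun m => pderiv i (φ m)) (g i) :=
    (h3' i).comp_tendsto hns.tendsto_atTop
  set μ := volume.restrict (B n r) with hμ
  have hψm : MemLp ψ 2 μ := hψ.memLp _ _
  have hG2 : TendstoL2 μ (fun m x => G (φ m x)) (fun x => G (u x)) := by
    have h0 := ENNReal.Tendsto.const_mul (a := ENNReal.ofReal L) h2 (Or.inr ENNReal.ofReal_ne_top)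
    rw [mul_zero] at h0
    refine tendsto_of_tendsto_of_tendsto_of_le_of_le tendsto_const_nhds h0 (fun _ => bot_le)
      fun m => eLpNorm_le_mul_eLpNorm_of_ae_le_mul (Eventually.of_forall fun x => hlip _ _) _
  have t1 := hG2.integral_mul (fun m => memG ((h1 m).memLp _ _)) (memG hr'.memLp)
    (hψ.pderiv (i := i).memLp 2 μ)
  -- `deriv G (φ m)` is bounded but converges only almost everywhere along the chosen subsequence,
  -- so the product is split. The part with `pderiv i (φ m) - g i` vanishes by Cauchy–Schwarz; the
  -- part with the fixed factor `g i * ψ` converges by domination (`t3`).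
  have t2 : Tendsto (fun m => ∫ x, (pderiv i (φ m) x - g i x) * (deriv G (φ m x) * ψ x) ∂μ) atTop
      (𝓝 0) := by
    have hz := ((ENNReal.tendsto_toReal ENNReal.zero_ne_top).comp h3).mul_const
      (L * (eLpNorm ψ 2 μ).toReal)
    simp only [ENNReal.toReal_zero, zero_mul] at hz
    refine squeeze_zero_norm (fun m => ?_) hz
    refine (abs_integral_mul_le (((h1 m).pderiv.memLp _ _).sub (hr'.part i).memLp')
      (memG' ((h1 m).memLp _ _) hψm)).trans ?_
    refine mul_le_mul_of_nonneg_left ?_ ENNReal.toReal_nonneg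
    have := eLpNorm_le_mul_eLpNorm_of_ae_le_mul (μ := μ) (p := 2)
      (f := fun x => deriv G (φ m x) * ψ x) (g := ψ) (c := L) (Eventually.of_forall fun x => by
        rw [norm_mul]
        gcongr
        exact hL _)
    have h4 := ENNReal.toReal_mono (ENNReal.mul_ne_top ENNReal.ofReal_ne_top hψm.2.ne) this
    rwa [ENNReal.toReal_mul, ENNReal.toReal_ofReal hL0] at h4
  have t3 : Tendsto (fun m => ∫ x, deriv G (φ m x) * (g i x * ψ x) ∂μ) atTop
      (𝓝 (∫ x, deriv G (u x) * (g i x * ψ x) ∂μ)) := by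
    have hint := integrable_mul_of_memLp_two (hr'.part i).memLp' hψm
    refine tendsto_integral_of_dominated_convergence (fun x => L * |g i x * ψ x|)
      (fun m => ((hG'.comp (h1 m).continuous).aestronglyMeasurable).mul hint.1)
      (hint.abs.const_mul L) (fun m => Eventually.of_forall fun x => ?_) ?_
    · rw [norm_mul]
      gcongr
      · exact hL _
      · exact le_rfl
    · filter_upwards [hae] with x hx
      exact ((hG'.tendsto _).comp hx).mul_const _
  have hm : ∀ m, ∫ x, G (φ m x) * pderiv i ψ x ∂μ =
      -(∫ x, (pderiv i (φ m) x - g i x) * (deriv G (φ m x) * ψ x) ∂μ +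
        ∫ x, deriv G (φ m x) * (g i x * ψ x) ∂μ) := by
    intro m
    have hpd : ∀ x, pderiv i (fun y => G (φ m y)) x = deriv G (φ m x) * pderiv i (φ m) x := by
      intro x
      have hd := (hGd (φ m x)).hasDerivAt.comp_hasFDerivAt x ((h1 m).differentiable x).hasFDerivAt
      rw [pderiv_eq_fderiv (f := fun y => G (φ m y)) ((hGd.comp (h1 m).differentiable) x),
        pderiv_eq_fderiv ((h1 m).differentiable x)]
      have h5 : fderiv ℝ (fun y => G (φ m y)) x = _ := hd.fderiv
      rw [h5]
      simp
    have i1 := integrable_mul_of_memLp_two (memG' ((h1 m).memLp 2 μ)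
      ((h1 m).pderiv (i := i).memLp 2 μ)) hψm
    have i2 := integrable_mul_of_memLp_two (memG' ((h1 m).memLp 2 μ) (hr'.part i).memLp') hψm
    have hp := integral_mul_pderiv_eq_neg (i := i) (a := fun y => G (φ m y)) hψr
      (fun x _ => ((hGd.comp (h1 m).differentiable) x).lineDifferentiableAt)
      (by simp only [hpd]; exact i1)
      (integrable_mul_of_memLp_two (memG ((h1 m).memLp _ _)) (hψ.pderiv.memLp _ _))
      (integrable_mul_of_memLp_two (memG ((h1 m).memLp _ _)) (hψ.memLp _ _))
    simp only [hpd] at hp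
    rw [hp, ← integral_add]
    · congr 2
      ext x
      ring
    · refine (i1.sub i2).congr (Eventually.of_forall fun x => ?_)
      simp only [Pi.sub_apply]
      ring
    · refine i2.congr (Eventually.of_forall fun x => ?_)
      simp only
      ring
  have hlim := tendsto_nhds_unique (t1.congr hm) (t2.add t3).neg
  rw [hlim, zero_add]
  simp only [mul_assoc]

end WeakCalculus

/-! ### The Caccioppoli inequality -/

section Caccioppoli
variable {n : ℕ} {U : Set (E n)}

theorem normLp_nonneg (p : ℝ≥0∞) (U : Set (E n)) (f : E n → ℝ) : 0 ≤ normLp p U f :=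
  ENNReal.toReal_nonneg

theorem normLp_sq {f : E n → ℝ} (hf : MemLp f 2 (volume.restrict U)) :
    normLp 2 U f ^ 2 = ∫ x in U, f x ^ 2 := sq_toReal_eLpNorm hf

theorem normL2Vec_sq (U : Set (E n)) (w : E n → Fin n → ℝ) :
    normL2Vec U w ^ 2 = ∑ i, normLp 2 U (fun x => w x i) ^ 2 :=
  Real.sq_sqrt (Finset.sum_nonneg fun _ _ => sq_nonneg _)

theorem normL2Vec_nonneg (U : Set (E n)) (w : E n → Fin n → ℝ) : 0 ≤ normL2Vec U w :=
  Real.sqrt_nonneg _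

theorem normLp_le_of_abs_le {f g : E n → ℝ} {p : ℝ≥0∞} (hg : MemLp g p (volume.restrict U))
    (h : ∀ᵐ x ∂(volume.restrict U), |f x| ≤ |g x|) : normLp p U f ≤ normLp p U g :=
  ENNReal.toReal_mono hg.2.ne (eLpNorm_mono_ae h)

/-- An `L²` vector field `F` acting on `H¹₀` functions: bounds for test functions extend to
compactly supported `H¹` functions. -/
theorem abs_sum_integral_le_of_testFun {F : Fin n → E n → ℝ} {a b : ℝ} {K : Set (E n)}
    (hU : IsOpen U) (hF : ∀ i, MemLp (F i) 2 (volume.restrict U))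
    (h : ∀ φ, IsTestFun U φ → |∑ i, ∫ x in U, pderiv i φ x * F i x| ≤
      a * normLp 2 U φ + b * normL2Vec U (fun x i => pderiv i φ x))
    {v : E n → ℝ} {w : Fin n → E n → ℝ} (hv : HasWeakGrad univ v w) (hK : IsCompact K)
    (hKU : K ⊆ U) (hvK : ∀ x ∉ K, v x = 0) :
    |∑ i, ∫ x in U, w i x * F i x| ≤ a * normLp 2 U v + b * normL2Vec U (fun x i => w i x) := by
  obtain ⟨φ, h1, h2, h3⟩ := exists_testFun_approx hv hK hU hKU hvK
  have hv' := hv.mono (subset_univ U)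
  have t2 : TendstoL2 (volume.restrict U) φ v := h2.mono_measure Measure.restrict_le_self
  have t3 : ∀ i, TendstoL2 (volume.restrict U) (fun m => pderiv i (φ m)) (w i) := fun i =>
    (h3 i).mono_measure Measure.restrict_le_self
  have n2 : Tendsto (fun m => normLp 2 U (φ m)) atTop (𝓝 (normLp 2 U v)) :=
    t2.toReal_eLpNorm (fun m => (h1 m).memLp _ _) hv'.memLp
  have n3 : Tendsto (fun m => normL2Vec U (fun x i => pderiv i (φ m) x)) atTop
      (𝓝 (normL2Vec U (fun x i => w i x))) :=
    (tendsto_finsetSum _ fun i _ => ((t3 i).toReal_eLpNorm (fun m => (h1 m).pderiv.memLp _ _)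
      (hv'.part i).memLp').pow 2).sqrt
  have n4 : Tendsto (fun m => ∑ i, ∫ x in U, pderiv i (φ m) x * F i x) atTop
      (𝓝 (∑ i, ∫ x in U, w i x * F i x)) :=
    tendsto_finsetSum _ fun i _ => (t3 i).integral_mul (fun m => (h1 m).pderiv.memLp _ _)
      (hv'.part i).memLp' (hF i)
  exact le_of_tendsto_of_tendsto' n4.abs ((n2.const_mul a).add (n3.const_mul b))
    fun m => h _ (h1 m)

/-- Measurable, bounded and elliptic coefficients on `U`. -/
structure IsRoughCoeff (U : Set (E n)) (M η : ℝ) (A : E n → Matrix (Fin n) (Fin n) ℝ) : Prop where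
  meas : ∀ i j, AEStronglyMeasurable (fun x => A x i j) (volume.restrict U)
  bdd : ∀ i j, ∀ x ∈ U, |A x i j| ≤ M
  elliptic : ∀ x ∈ U, ∀ ξ : Fin n → ℝ, η * ∑ i, ξ i ^ 2 ≤ ∑ i, (∑ j, A x i j * ξ j) * ξ i

/-- The flux `A g`. -/
def flux (A : E n → Matrix (Fin n) (Fin n) ℝ) (g : Fin n → E n → ℝ) (i : Fin n) (x : E n) : ℝ :=
  ∑ j, A x i j * g j x

theorem IsRoughCoeff.memLp_flux {M η : ℝ} {A : E n → Matrix (Fin n) (Fin n) ℝ}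
    (hA : IsRoughCoeff U M η A) (hU : MeasurableSet U) {g : Fin n → E n → ℝ}
    (hg : ∀ i, MemLp (g i) 2 (volume.restrict U)) (i : Fin n) :
    MemLp (flux A g i) 2 (volume.restrict U) := by
  have : flux A g i = fun x => ∑ j, A x i j * g j x := rfl
  rw [this]
  refine memLp_finsetSum _ fun j _ => MemLp.mul_bounded (C := M) (hg j) (hA.meas i j) ?_
  filter_upwards [self_mem_ae_restrict hU] with x hx using hA.bdd i j x hx

theorem abs_sum_flux_mul_le {M L : ℝ} {A : Matrix (Fin n) (Fin n) ℝ} (hM : 0 ≤ M)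
    (hA : ∀ i j, |A i j| ≤ M) {g d : Fin n → ℝ} (hd : ∀ i, |d i| ≤ L) :
    |∑ i, (∑ j, A i j * g j) * d i| ≤ n * L * M * ∑ j, |g j| := by
  calc |∑ i, (∑ j, A i j * g j) * d i| ≤ ∑ i, |(∑ j, A i j * g j) * d i| :=
        Finset.abs_sum_le_sum_abs _ _
    _ ≤ ∑ _i : Fin n, (∑ j, M * |g j|) * L := by
        refine Finset.sum_le_sum fun i _ => ?_
        rw [abs_mul]
        refine mul_le_mul ((Finset.abs_sum_le_sum_abs _ _).trans (Finset.sum_le_sum fun j _ => ?_))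
          (hd i) (abs_nonneg _) (Finset.sum_nonneg fun j _ => by positivity)
        rw [abs_mul]
        gcongr
        exact hA i j
    _ = n * L * M * ∑ j, |g j| := by
        rw [Finset.sum_const, ← Finset.mul_sum]
        simp
        ring

/-- The pointwise absorption estimate behind energy inequalities. `s` is a weight: in applications
it is a power of the solution. -/
theorem two_mul_abs_flux_le {M L η s t : ℝ} {A : Matrix (Fin n) (Fin n) ℝ} (hM : 0 ≤ M)
    (hη : 0 < η) (hs : 0 < s) (hA : ∀ i j, |A i j| ≤ M) {g d : Fin n → ℝ} (hd : ∀ i, |d i| ≤ L) :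
    |2 * t * ∑ i, (∑ j, A i j * g j) * d i| ≤
      η / 4 * (s * ∑ i, g i ^ 2) + 4 * n ^ 3 * M ^ 2 / η * L ^ 2 * (t ^ 2 / s) := by
  rw [abs_mul, abs_mul, abs_two]
  have h1 := abs_sum_flux_mul_le (g := g) hM hA hd
  calc 2 * |t| * |∑ i, (∑ j, A i j * g j) * d i|
      ≤ 2 * |t| * (n * L * M * ∑ j, |g j|) := by gcongr
    _ = ∑ j, 2 * |t| * (n * L * M) * |g j| := by rw [Finset.mul_sum, Finset.mul_sum]; congr; ext; ring
    _ ≤ ∑ j, (η / 4 * (s * g j ^ 2) + 4 / η * (n * L * M) ^ 2 * (t ^ 2 / s)) := by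
        refine Finset.sum_le_sum fun j _ => ?_
        -- The square whose expansion has `η / 4 * s` on `g j ^ 2` and exactly the cross term to be
        -- absorbed.
        have h2 : 0 ≤ (η / 4 * s) * (|g j| - 4 / η / s * |t| * (n * L * M)) ^ 2 := by positivity
        have h3 : (η / 4 * s) * (|g j| - 4 / η / s * |t| * (n * L * M)) ^ 2 =
            η / 4 * (s * |g j| ^ 2) - 2 * |t| * (n * L * M) * |g j| +
              4 / η * (n * L * M) ^ 2 * (|t| ^ 2 / s) := by
          field_simp
          ring
        rw [sq_abs, sq_abs] at h3
        linarith
    _ = η / 4 * (s * ∑ i, g i ^ 2) + 4 * n ^ 3 * M ^ 2 / η * L ^ 2 * (t ^ 2 / s) := by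
        rw [Finset.sum_add_distrib, Finset.mul_sum, Finset.mul_sum, Finset.sum_const]
        simp
        ring

-- The energy method with test function `ζ²u`. Continuity of the coefficients plays no role and `C`
-- depends only on `n`, `M`, `η`, so the inequality can be applied to difference quotients of a
-- solution, whose coefficients are translated. The functional is bounded on smooth test functions
-- only, and `abs_sum_integral_le_of_testFun` extends the bound to `ζ²u`.
set_option maxHeartbeats 1000000 in
theorem caccioppoli (n : ℕ) (M η : ℝ) (hη : 0 < η) : ∃ C : ℝ, 0 < C ∧
    ∀ (r δ : ℝ), 0 < r → r < δ → ∀ A : E n → Matrix (Fin n) (Fin n) ℝ,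
    IsRoughCoeff (B n δ) M η A → ∀ (u : E n → ℝ) (g : Fin n → E n → ℝ), HasWeakGrad (B n δ) u g →
    ∀ a b : ℝ, 0 ≤ a → 0 ≤ b →
    (∀ φ, IsTestFun (B n δ) φ → |∑ i, ∫ x in B n δ, pderiv i φ x * flux A g i x| ≤
      a * normLp 2 (B n δ) φ + b * normL2Vec (B n δ) (fun x i => pderiv i φ x)) →
    normL2Vec (B n r) (fun x i => g i x) ^ 2 ≤
      C * (((δ - r) ^ 2)⁻¹ * normLp 2 (B n δ) u ^ 2 + a * normLp 2 (B n δ) u + b ^ 2) := by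
  obtain ⟨c, hc, hcut⟩ := exists_cutoff
  set K : ℝ := 4 * n ^ 3 * M ^ 2 / η with hK
  have hK0 : 0 ≤ K := by positivity
  refine ⟨2 / η * ((K + η * n) * c ^ 2 + 1 + 2 / η), by positivity, ?_⟩
  intro r δ hr hrδ A hA u g hu a b ha hb h
  -- For `n = 0` the matrix has no entry from which `0 ≤ M` could be read off.
  rcases Nat.eq_zero_or_pos n with rfl | hn
  · have : normL2Vec (B 0 r) (fun x i => g i x) = 0 := by simp [normL2Vec]
    rw [this]
    have : 0 ≤ ((δ - r) ^ 2)⁻¹ * normLp 2 (B 0 δ) u ^ 2 + a * normLp 2 (B 0 δ) u + b ^ 2 := by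
      have := normLp_nonneg 2 (B 0 δ) u
      positivity
    rw [zero_pow two_ne_zero]
    exact mul_nonneg (by positivity) this
  have hM : 0 ≤ M := (abs_nonneg _).trans
    (hA.bdd ⟨0, hn⟩ ⟨0, hn⟩ 0 (Metric.mem_ball_self (hr.trans hrδ)))
  obtain ⟨ζ, hζ, hζ0, hζ1, hζr, hζd⟩ := hcut n r δ hr hrδ
  set L : ℝ := c / (δ - r) with hL
  set μ := volume.restrict (B n δ) with hμ
  have hUm : MeasurableSet (B n δ) := measurableSet_ball
  have hmem : ∀ᵐ x ∂μ, x ∈ B n δ := self_mem_ae_restrict hUm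
  have hζ2 : IsTestFun (B n δ) fun x => ζ x * ζ x := hζ.mul_left hζ.smooth
  have hζ2d : ∀ i x, pderiv i (fun x => ζ x * ζ x) x = 2 * ζ x * pderiv i ζ x := fun i x => by
    rw [pderiv_mul (hζ.differentiable x) (hζ.differentiable x)]
    ring
  have hgm : ∀ i, MemLp (g i) 2 μ := fun i => (hu.part i).memLp'
  have hFm := hA.memLp_flux hUm hgm
  set v : E n → ℝ := fun x => ζ x * ζ x * u x with hv
  set w : Fin n → E n → ℝ := fun i x => ζ x * ζ x * g i x + 2 * ζ x * pderiv i ζ x * u x with hw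
  have hvw : HasWeakGrad univ v w := by
    have := hu.cutoff hUm hζ2
    simp only [hζ2d] at this
    exact this
  have hvw' := hvw.mono (subset_univ (B n δ))
  have key := abs_sum_integral_le_of_testFun Metric.isOpen_ball hFm h hvw hζ2.compact hζ2.supp
    (fun x hx => by simp only [hv, image_eq_zero_of_notMem_tsupport hx, zero_mul])
  -- integrated quantities
  set X : ℝ := ∫ x, ζ x ^ 2 * ∑ i, g i x ^ 2 ∂μ with hX
  set Y : ℝ := normLp 2 (B n δ) u with hY
  have hY0 : 0 ≤ Y := normLp_nonneg _ _ _
  have hY2 : Y ^ 2 = ∫ x, u x ^ 2 ∂μ := normLp_sq hu.memLp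
  have iu : Integrable (fun x => u x ^ 2) μ := hu.memLp.integrable_sq
  have ig : Integrable (fun x => ∑ i, g i x ^ 2) μ :=
    integrable_finsetSum _ fun i _ => (hgm i).integrable_sq
  have hζsq : ∀ x, ζ x ^ 2 ≤ 1 := fun x => pow_le_one₀ (hζ0 x) (hζ1 x)
  have iX : Integrable (fun x => ζ x ^ 2 * ∑ i, g i x ^ 2) μ := by
    refine ig.mono' ((hζ.continuous.pow 2).aestronglyMeasurable.mul ig.1)
      (Eventually.of_forall fun x => ?_)
    have h0 : 0 ≤ ∑ i, g i x ^ 2 := Finset.sum_nonneg fun _ _ => sq_nonneg _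
    rw [Real.norm_of_nonneg (mul_nonneg (sq_nonneg _) h0)]
    exact mul_le_of_le_one_left h0 (hζsq x)
  have hX0 : 0 ≤ X := integral_nonneg fun x =>
    mul_nonneg (sq_nonneg _) (Finset.sum_nonneg fun _ _ => sq_nonneg _)
  -- the left side
  have hleft : normL2Vec (B n r) (fun x i => g i x) ^ 2 ≤ X := by
    have hsub := ball_subset_ball' (n := n) hrδ.le
    rw [normL2Vec_sq]
    have e1 : ∀ i, normLp 2 (B n r) (fun x => g i x) ^ 2 = ∫ x in B n r, g i x ^ 2 := fun i =>
      normLp_sq ((hu.mono hsub).part i).memLp'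
    simp only [e1]
    rw [← integral_finsetSum _ fun i _ => (((hu.mono hsub).part i).memLp').integrable_sq]
    calc ∫ x in B n r, ∑ i, g i x ^ 2 = ∫ x in B n r, ζ x ^ 2 * ∑ i, g i x ^ 2 := by
          refine setIntegral_congr_fun measurableSet_ball fun x hx => ?_
          simp only [hζr x hx]
          ring
      _ ≤ X := setIntegral_mono_set iX (Eventually.of_forall fun x =>
          mul_nonneg (sq_nonneg _) (Finset.sum_nonneg fun _ _ => sq_nonneg _))
          hsub.eventuallyLE
  -- the energy estimate
  have henergy : 3 * η / 4 * X ≤ ∑ i, ∫ x, w i x * flux A g i x ∂μ + K * L ^ 2 * Y ^ 2 := by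
    have iwF : ∀ i, Integrable (fun x => w i x * flux A g i x) μ := fun i =>
      integrable_mul_of_memLp_two (hvw'.part i).memLp' (hFm i)
    rw [← integral_finsetSum _ fun i _ => iwF i, hX, hY2, ← integral_const_mul,
      ← integral_const_mul, ← integral_add (integrable_finsetSum _ fun i _ => iwF i)
      (iu.const_mul _)]
    refine integral_mono_ae (iX.const_mul _)
      ((integrable_finsetSum _ fun i _ => iwF i).add (iu.const_mul _)) ?_
    filter_upwards [hmem] with x hx
    have hell := hA.elliptic x hx (fun i => g i x)
    have habs := two_mul_abs_flux_le (s := 1) (t := u x) (g := fun i => ζ x * g i x) hM hη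
      one_pos (hA.bdd · · x hx) (fun i => hζd i x)
    have hsplit : ∑ i, w i x * flux A g i x = ζ x ^ 2 * ∑ i, (∑ j, A x i j * g j x) * g i x +
        2 * u x * ∑ i, (∑ j, A x i j * (ζ x * g j x)) * pderiv i ζ x := by
      rw [Finset.mul_sum, Finset.mul_sum, ← Finset.sum_add_distrib]
      refine Finset.sum_congr rfl fun i _ => ?_
      have : ∑ j, A x i j * (ζ x * g j x) = ζ x * ∑ j, A x i j * g j x := by
        rw [Finset.mul_sum]
        exact Finset.sum_congr rfl fun j _ => by ring
      rw [this]
      simp only [hw, flux]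
      ring
    have hg2 : ∑ i, (ζ x * g i x) ^ 2 = ζ x ^ 2 * ∑ i, g i x ^ 2 := by
      rw [Finset.mul_sum]
      exact Finset.sum_congr rfl fun j _ => by ring
    rw [hg2, one_mul, div_one, ← hK] at habs
    have h2 := mul_le_mul_of_nonneg_left hell (sq_nonneg (ζ x))
    have h3 := neg_abs_le (2 * u x * ∑ i, (∑ j, A x i j * (ζ x * g j x)) * pderiv i ζ x)
    simp only [hsplit]
    linarith
  -- bounds for the test function
  have hv_le : normLp 2 (B n δ) v ≤ Y := normLp_le_of_abs_le hu.memLp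
    (Eventually.of_forall fun x => by
      rw [hv]
      simp only [abs_mul, abs_of_nonneg (hζ0 x)]
      refine mul_le_of_le_one_left (abs_nonneg _) (mul_le_one₀ (hζ1 x) (hζ0 x) (hζ1 x)))
  have hw_le : normL2Vec (B n δ) (fun x i => w i x) ^ 2 ≤ 2 * X + 8 * n * L ^ 2 * Y ^ 2 := by
    rw [normL2Vec_sq]
    have e1 : ∀ i, normLp 2 (B n δ) (fun x => w i x) ^ 2 = ∫ x, w i x ^ 2 ∂μ := fun i =>
      normLp_sq (hvw'.part i).memLp'
    simp only [e1]
    rw [← integral_finsetSum _ fun i _ => (hvw'.part i).memLp'.integrable_sq, hX, hY2,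
      ← integral_const_mul, ← integral_const_mul, ← integral_add (iX.const_mul _) (iu.const_mul _)]
    refine integral_mono (integrable_finsetSum _ fun i _ => (hvw'.part i).memLp'.integrable_sq)
      ((iX.const_mul _).add (iu.const_mul _)) fun x => ?_
    have : ∀ i, w i x ^ 2 ≤ 2 * (ζ x ^ 2 * g i x ^ 2) + 8 * L ^ 2 * u x ^ 2 := by
      intro i
      have hd2 : pderiv i ζ x ^ 2 ≤ L ^ 2 := sq_le_sq' (abs_le.1 (hζd i x)).1 (abs_le.1 (hζd i x)).2
      have h1 : w i x ^ 2 ≤ 2 * (ζ x * ζ x * g i x) ^ 2 + 2 * (2 * ζ x * pderiv i ζ x * u x) ^ 2 := by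
        simp only [hw]
        nlinarith [sq_nonneg (ζ x * ζ x * g i x - 2 * ζ x * pderiv i ζ x * u x)]
      have h2 : (ζ x * ζ x * g i x) ^ 2 ≤ ζ x ^ 2 * g i x ^ 2 := by
        have : (ζ x * ζ x * g i x) ^ 2 = ζ x ^ 2 * (ζ x ^ 2 * g i x ^ 2) := by ring
        rw [this]
        exact mul_le_of_le_one_left (by positivity) (hζsq x)
      have h3 : (2 * ζ x * pderiv i ζ x * u x) ^ 2 ≤ 4 * L ^ 2 * u x ^ 2 := by
        have : (2 * ζ x * pderiv i ζ x * u x) ^ 2 = 4 * (ζ x ^ 2 * pderiv i ζ x ^ 2) * u x ^ 2 := by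
          ring
        rw [this]
        gcongr
        exact (mul_le_of_le_one_left (sq_nonneg _) (hζsq x)).trans hd2
      linarith
    refine (Finset.sum_le_sum fun i _ => this i).trans (le_of_eq ?_)
    rw [Finset.sum_add_distrib, ← Finset.mul_sum, ← Finset.mul_sum, Finset.sum_const]
    simp
    ring
  set W := normL2Vec (B n δ) (fun x i => w i x) with hW
  -- Since `W ^ 2` is at most `2 * X` plus a multiple of `Y ^ 2`, the weight `η / 8` uses up another
  -- `η / 4` and leaves `η / 2 * X` on the left.
  have hyoung : b * W ≤ η / 8 * W ^ 2 + 2 / η * b ^ 2 := by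
    have h1 : 0 ≤ η / 8 * (W - 4 / η * b) ^ 2 := by positivity
    have h2 : η / 8 * (W - 4 / η * b) ^ 2 = η / 8 * W ^ 2 - b * W + 2 / η * b ^ 2 := by
      field_simp
      ring
    linarith
  have hsum := (le_abs_self _).trans key
  have hmain : η / 2 * X ≤ (K + η * n) * L ^ 2 * Y ^ 2 + a * Y + 2 / η * b ^ 2 := by
    have h1 : a * normLp 2 (B n δ) v ≤ a * Y := by gcongr
    have h2 : η / 8 * W ^ 2 ≤ η / 8 * (2 * X + 8 * n * L ^ 2 * Y ^ 2) := by gcongr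
    nlinarith
  have hLs : L ^ 2 = c ^ 2 * ((δ - r) ^ 2)⁻¹ := by rw [hL, div_pow, div_eq_mul_inv]
  rw [hLs] at hmain
  refine hleft.trans ?_
  set D := ((δ - r) ^ 2)⁻¹ with hD
  have hD0 : 0 ≤ D := by positivity
  have hfin : X ≤ 2 / η * ((K + η * n) * (c ^ 2 * D) * Y ^ 2 + a * Y + 2 / η * b ^ 2) := by
    rw [div_mul_eq_mul_div, le_div_iff₀ hη]
    linarith
  refine hfin.trans (le_of_le_of_eq (mul_le_mul_of_nonneg_left ?_ (by positivity))
    (mul_assoc _ _ _).symm)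
  have p1 : 0 ≤ (K + η * n) * c ^ 2 := by positivity
  have p2 : 0 ≤ D * Y ^ 2 := by positivity
  have p3 : 0 ≤ a * Y := by positivity
  have p4 : 0 ≤ b ^ 2 := by positivity
  have p5 : 0 ≤ 2 / η := by positivity
  nlinarith [mul_nonneg p1 p3, mul_nonneg p1 p4, mul_nonneg p5 p2, mul_nonneg p5 p3]

end Caccioppoli

/-! ### Difference quotients -/

section DifferenceQuotient
variable {n : ℕ} {i l : Fin n} {h ρ δ : ℝ} {f g φ ψ : E n → ℝ}

/-- The difference quotient of `f` in the direction of the `l`-th coordinate. -/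
noncomputable def diffQuot (l : Fin n) (h : ℝ) (f : E n → ℝ) (x : E n) : ℝ :=
  h⁻¹ * (f (x + h • EuclideanSpace.single l (1 : ℝ)) - f x)

theorem norm_smul_single (l : Fin n) (h : ℝ) :
    ‖h • (EuclideanSpace.single l (1 : ℝ) : E n)‖ = |h| := by
  rw [norm_smul, PiLp.norm_single]
  simp

theorem add_mem_ball {a x : E n} (hx : x ∈ B n ρ) (ha : ‖a‖ ≤ δ - ρ) : x + a ∈ B n δ := by
  have hx' : ‖x‖ < ρ := mem_ball_zero_iff.1 hx
  refine mem_ball_zero_iff.2 ((norm_add_le _ _).trans_lt ?_)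
  linarith

theorem IsTestFun.diffQuot {U V : Set (E n)} (hφ : IsTestFun U φ) (hUV : U ⊆ V)
    (h' : ∀ x ∈ U, x - h • EuclideanSpace.single l (1 : ℝ) ∈ V) :
    IsTestFun V (diffQuot l h φ) := by
  refine IsTestFun.const_mul (IsTestFun.sub (hφ.comp_add fun x hx => ?_) (hφ.mono hUV)) _
  have := h' _ (hφ.supp hx)
  simpa using this

theorem pderiv_diffQuot (hφ : ContDiff ℝ ∞ φ) (x : E n) :
    pderiv i (diffQuot l h φ) x = diffQuot l h (pderiv i φ) x := by
  have hd : Differentiable ℝ φ := hφ.differentiable (by simp)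
  have hd' : Differentiable ℝ fun x => φ (x + h • EuclideanSpace.single l (1 : ℝ)) :=
    hd.comp (differentiable_id.add_const _)
  unfold InteriorElliptic.diffQuot
  rw [pderiv_const_mul _ ((hd' x).fun_sub (hd x)), pderiv_sub (hd' x) (hd x), pderiv_comp_add]

theorem hasDerivAt_line_of_contDiff (hφ : ContDiff ℝ ∞ φ) (x : E n) (t : ℝ) :
    HasDerivAt (fun s : ℝ => φ (x + s • EuclideanSpace.single l (1 : ℝ)))
      (pderiv l φ (x + t • EuclideanSpace.single l (1 : ℝ))) t :=
  hasDerivAt_line ((hφ.differentiable (by simp) _).lineDifferentiableAt)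

theorem diffQuot_eq_integral (hφ : ContDiff ℝ ∞ φ) (hh : h ≠ 0) (x : E n) :
    diffQuot l h φ x =
      ∫ t in Ioc (0 : ℝ) 1, pderiv l φ (x + (t * h) • EuclideanSpace.single l (1 : ℝ)) := by
  have hc : Continuous (pderiv l φ) := (contDiff_pderiv hφ).continuous
  have hd : ∀ t : ℝ, HasDerivAt (fun t : ℝ => φ (x + (t * h) • EuclideanSpace.single l (1 : ℝ)))
      (pderiv l φ (x + (t * h) • EuclideanSpace.single l (1 : ℝ)) * h) t := fun t => by
    have := (hasDerivAt_line_of_contDiff (l := l) hφ x (t * h)).comp t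
      ((hasDerivAt_id t).mul_const h)
    rwa [one_mul] at this
  have := intervalIntegral.integral_eq_sub_of_hasDerivAt (a := 0) (b := 1) (fun t _ => hd t)
    (Continuous.intervalIntegrable (by fun_prop) _ _)
  rw [intervalIntegral.integral_mul_const, intervalIntegral.integral_of_le zero_le_one] at this
  simp only [one_mul, zero_mul, zero_smul, add_zero] at this
  rw [diffQuot, ← this]
  field_simp

theorem eLpNorm_comp_add (hf : AEStronglyMeasurable f volume) (a : E n) :
    eLpNorm (fun x => f (x + a)) 2 volume = eLpNorm f 2 volume :=
  eLpNorm_comp_measurePreserving hf (measurePreserving_add_right volume a)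

/-- The quotient is the average over `t ∈ (0, 1]` of translates of the partial derivative, so
Minkowski for averages and translation invariance give the constant one. -/
theorem eLpNorm_diffQuot_le_of_contDiff (hφ : ContDiff ℝ ∞ φ) (hh : h ≠ 0) :
    eLpNorm (diffQuot l h φ) 2 volume ≤ eLpNorm (pderiv l φ) 2 volume := by
  have : IsProbabilityMeasure (volume.restrict (Ioc (0 : ℝ) 1)) := ⟨by simp⟩
  have hc : Continuous (pderiv l φ) := (contDiff_pderiv hφ).continuous
  have he : diffQuot l h φ = fun x => ∫ t in Ioc (0 : ℝ) 1,
      pderiv l φ (x + (t * h) • EuclideanSpace.single l (1 : ℝ)) :=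
    funext fun x => diffQuot_eq_integral hφ hh x
  rw [he]
  refine eLpNorm_integral_le
    (F := fun x (t : ℝ) => pderiv l φ (x + (t * h) • EuclideanSpace.single l (1 : ℝ)))
    (Continuous.aestronglyMeasurable (by fun_prop)) (Eventually.of_forall fun t => ?_)
  exact (eLpNorm_comp_add hc.aestronglyMeasurable _).le

theorem MemLp.diffQuot (hf : MemLp f 2 volume) : MemLp (diffQuot l h f) 2 volume :=
  ((hf.comp_measurePreserving (measurePreserving_add_right volume _)).sub hf).const_mul _

theorem TendstoL2.diffQuot {F : ℕ → E n → ℝ} (hF : TendstoL2 volume F f)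
    (hFm : ∀ m, MemLp (F m) 2 volume) (hf : MemLp f 2 volume) :
    TendstoL2 volume (fun m => diffQuot l h (F m)) (diffQuot l h f) := by
  have h1 : TendstoL2 volume (fun m x => F m (x + h • EuclideanSpace.single l (1 : ℝ)))
      (fun x => f (x + h • EuclideanSpace.single l (1 : ℝ))) := by
    refine Tendsto.congr (fun m => ?_) hF
    exact (eLpNorm_comp_add ((hFm m).sub hf).1 _).symm
  have hneg : TendstoL2 volume (fun m x => (-1) * F m x) (fun x => (-1) * f x) :=
    hF.mul_bounded (h := fun _ => (-1 : ℝ)) (C := 1) (by simp)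
  have h2 := h1.add hneg (fun m => (hFm m).comp_measurePreserving (measurePreserving_add_right _ _))
    (fun m => (hFm m).const_mul _) (hf.comp_measurePreserving (measurePreserving_add_right _ _))
    (hf.const_mul _)
  have h3 := h2.mul_bounded (h := fun _ => h⁻¹) (C := |h⁻¹|) (by simp)
  refine h3.congr_ae (fun m => Eventually.of_forall fun x => ?_) (Eventually.of_forall fun x => ?_)
  · simp only [InteriorElliptic.diffQuot]; ring
  · simp only [InteriorElliptic.diffQuot]; ring

/-- Difference quotients of `H¹` functions are bounded in `L²` on smaller balls. -/
theorem HasWeakGrad.exists_diffQuot_bound {u : E n → ℝ} {g : Fin n → E n → ℝ} (hρ : 0 < ρ)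
    (hρδ : ρ < δ) (hu : HasWeakGrad (B n δ) u g) (l : Fin n) :
    ∃ K, 0 ≤ K ∧ ∀ h : ℝ, h ≠ 0 → |h| < (δ - ρ) / 2 → normLp 2 (B n ρ) (diffQuot l h u) ≤ K := by
  -- The cutoff is one at radius `(ρ + δ) / 2`, which accommodates both `x` and its translate for
  -- steps below `(δ - ρ) / 2`. There the quotients of `ζ * u` and `u` coincide.
  obtain ⟨ζ, hζ, hζ1⟩ := exists_testFun_eq_one (n := n) (r := (ρ + δ) / 2) (δ := δ)
    (by linarith) (by linarith)
  have hc := hu.cutoff measurableSet_ball hζ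
  obtain ⟨φ, h1, h2, h3⟩ := exists_testFun_approx hc hζ.compact Metric.isOpen_ball hζ.supp
    (fun x hx => by simp [image_eq_zero_of_notMem_tsupport hx])
  set v : E n → ℝ := fun x => ζ x * u x with hv
  set w : Fin n → E n → ℝ := fun i x => ζ x * g i x + pderiv i ζ x * u x with hw
  have hvm : MemLp v 2 volume := by simpa using hc.memLp
  have hwm : MemLp (w l) 2 volume := by simpa using (hc.part l).memLp'
  refine ⟨(eLpNorm (w l) 2 volume).toReal, ENNReal.toReal_nonneg, fun h hh hhδ => ?_⟩
  have hle : (eLpNorm (diffQuot l h v) 2 volume).toReal ≤ (eLpNorm (w l) 2 volume).toReal := by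
    refine le_of_tendsto_of_tendsto'
      ((h2.diffQuot (l := l) (h := h) (fun m => (h1 m).memLp _ _) hvm).toReal_eLpNorm
        (fun m => MemLp.diffQuot ((h1 m).memLp _ _)) (MemLp.diffQuot hvm))
      ((h3 l).toReal_eLpNorm (fun m => (h1 m).pderiv.memLp _ _) hwm) fun m => ?_
    exact ENNReal.toReal_mono ((h1 m).pderiv.memLp 2 volume).2.ne
      (eLpNorm_diffQuot_le_of_contDiff (h1 m).smooth hh)
  refine le_trans (le_of_eq_of_le ?_ (ENNReal.toReal_mono (MemLp.diffQuot hvm).2.ne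
    (eLpNorm_mono_measure _ (Measure.restrict_le_self (s := B n ρ))))) hle
  rw [normLp]
  congr 1
  refine eLpNorm_congr_ae ?_
  filter_upwards [self_mem_ae_restrict measurableSet_ball] with x hx
  have m1 : x ∈ B n ((ρ + δ) / 2) := ball_subset_ball' (by linarith) hx
  have m2 : x + h • EuclideanSpace.single l (1 : ℝ) ∈ B n ((ρ + δ) / 2) :=
    add_mem_ball hx (by rw [norm_smul_single]; linarith)
  simp only [diffQuot, hv, hζ1 _ m1, hζ1 _ m2, one_mul]

theorem memLp_comp_add {a : E n} (ha : ‖a‖ ≤ δ - ρ) (hf : MemLp f 2 (volume.restrict (B n δ))) :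
    MemLp (fun x => f (x + a)) 2 (volume.restrict (B n ρ)) := by
  have hp : MeasurePreserving (fun x : E n => x + a) (volume.restrict ((· + a) ⁻¹' B n δ))
      (volume.restrict (B n δ)) :=
    (measurePreserving_add_right volume a).restrict_preimage measurableSet_ball
  exact (hf.comp_measurePreserving hp).mono_measure
    (Measure.restrict_mono (fun x hx => add_mem_ball hx ha) le_rfl)

theorem memLp_diffQuot (hρδ : ρ < δ) (hh : |h| ≤ δ - ρ) (hf : MemLp f 2 (volume.restrict (B n δ))) :
    MemLp (diffQuot l h f) 2 (volume.restrict (B n ρ)) :=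
  ((memLp_comp_add (by rwa [norm_smul_single]) hf).sub
    (hf.mono_measure (Measure.restrict_mono (ball_subset_ball' hρδ.le) le_rfl))).const_mul _

theorem setIntegral_comp_add {a : E n} (ha : ‖a‖ ≤ δ - ρ) (hφ : IsTestFun (B n ρ) φ) :
    ∫ x in B n ρ, f (x + a) * φ x = ∫ x in B n δ, f x * φ (x + -a) := by
  have hφ' : IsTestFun (B n δ) fun x => φ (x + -a) := hφ.comp_add fun x hx => by
    have := add_mem_ball (hφ.supp hx) ha
    simpa using this
  rw [hφ.setIntegral_eq_integral fun x => f (x + a), hφ'.setIntegral_eq_integral f,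
    ← integral_add_right_eq_self (fun x => f x * φ (x + -a)) a]
  simp

/-- Moving a difference quotient onto the test function. -/
theorem setIntegral_diffQuot_mul (hρδ : ρ < δ) (hh : |h| ≤ δ - ρ)
    (hf : MemLp f 2 (volume.restrict (B n δ))) (hφ : IsTestFun (B n ρ) φ) :
    ∫ x in B n ρ, diffQuot l h f x * φ x = - ∫ x in B n δ, f x * diffQuot l (-h) φ x := by
  have hsub := ball_subset_ball' (n := n) hρδ.le
  have ha : ‖h • (EuclideanSpace.single l (1 : ℝ) : E n)‖ ≤ δ - ρ := by rwa [norm_smul_single]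
  have hφ' : IsTestFun (B n δ) fun x => φ (x + -(h • EuclideanSpace.single l (1 : ℝ))) :=
    hφ.comp_add fun x hx => by
      have := add_mem_ball (hφ.supp hx) ha
      simpa using this
  have e1 : ∀ x, diffQuot l h f x * φ x =
      h⁻¹ * (f (x + h • EuclideanSpace.single l (1 : ℝ)) * φ x - f x * φ x) := fun x => by
    rw [diffQuot]; ring
  have e2 : ∀ x, f x * diffQuot l (-h) φ x =
      -(h⁻¹ * (f x * φ (x + -(h • EuclideanSpace.single l (1 : ℝ))) - f x * φ x)) := fun x => by
    rw [diffQuot, neg_smul, inv_neg]; ring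
  simp only [e1, e2]
  rw [integral_neg, neg_neg, integral_const_mul, integral_const_mul, integral_sub, integral_sub,
    setIntegral_comp_add ha hφ, hφ.setIntegral_eq hsub]
  · exact integrable_mul_of_memLp_two hf (hφ'.memLp _ _)
  · exact integrable_mul_of_memLp_two hf (hφ.memLp _ _)
  · exact integrable_mul_of_memLp_two (memLp_comp_add ha hf) (hφ.memLp _ _)
  · exact integrable_mul_of_memLp_two (hf.mono_measure (Measure.restrict_mono hsub le_rfl))
      (hφ.memLp _ _)

theorem HasWeakPartial.diffQuot (hρδ : ρ < δ) (hh : |h| ≤ δ - ρ)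
    (hf : HasWeakPartial (B n δ) i f g) :
    HasWeakPartial (B n ρ) i (diffQuot l h f) (diffQuot l h g) where
  memLp := memLp_diffQuot hρδ hh hf.memLp
  memLp' := memLp_diffQuot hρδ hh hf.memLp'
  eq := fun φ hφ => by
    rw [setIntegral_diffQuot_mul hρδ hh hf.memLp hφ.pderiv,
      setIntegral_diffQuot_mul hρδ hh hf.memLp' hφ]
    have ht : IsTestFun (B n δ) (InteriorElliptic.diffQuot l (-h) φ) :=
      hφ.diffQuot (ball_subset_ball' hρδ.le) fun x hx => by
        rw [neg_smul, sub_neg_eq_add]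
        exact add_mem_ball hx (by rwa [norm_smul_single])
    have := hf.eq _ ht
    simp only [pderiv_diffQuot hφ.smooth] at this
    rw [this]

theorem HasWeakGrad.diffQuot {u : E n → ℝ} {g : Fin n → E n → ℝ} (hρδ : ρ < δ) (hh : |h| ≤ δ - ρ)
    (hu : HasWeakGrad (B n δ) u g) :
    HasWeakGrad (B n ρ) (diffQuot l h u) (fun i => diffQuot l h (g i)) :=
  ⟨memLp_diffQuot hρδ hh hu.memLp, fun i => (hu.part i).diffQuot hρδ hh⟩

/-- A linear functional dominated by the seminorm pulled back from a Hilbert space is represented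
by a vector. -/
theorem exists_inner_eq_of_abs_le {X H : Type*} [AddCommGroup X] [Module ℝ X]
    [NormedAddCommGroup H] [InnerProductSpace ℝ H] [CompleteSpace H] (ι : X →ₗ[ℝ] H)
    (T : X →ₗ[ℝ] ℝ) (K : ℝ) (hT : ∀ x, |T x| ≤ K * ‖ι x‖) : ∃ y : H, ∀ x, inner ℝ y (ι x) = T x := by
  -- `ι` may have a kernel, so `T` is transported to its range by a linear section. The hypothesis
  -- forces `T` to vanish on the kernel, which is what makes the section harmless at the end.
  -- Hahn–Banach and Riesz then supply the vector.
  obtain ⟨s, hs⟩ := ι.rangeRestrict.exists_rightInverse_of_surjective ι.range_rangeRestrict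
  have hs' : ∀ z, ι (s z) = z := fun z => congrArg Subtype.val (LinearMap.congr_fun hs z)
  set f : LinearMap.range ι →L[ℝ] ℝ := (T ∘ₗ s).mkContinuous K fun z => by
    have := hT (s z)
    rwa [hs' z] at this
  obtain ⟨F, hF, -⟩ := exists_extension_norm_eq _ f
  refine ⟨(InnerProductSpace.toDual ℝ H).symm F, fun x => ?_⟩
  rw [InnerProductSpace.toDual_symm_apply]
  have h1 := hF ⟨ι x, LinearMap.mem_range_self ι x⟩
  simp only at h1
  rw [h1]
  have h2 : T (s ⟨ι x, LinearMap.mem_range_self ι x⟩ - x) = 0 := by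
    have := hT (s ⟨ι x, LinearMap.mem_range_self ι x⟩ - x)
    rw [map_sub ι, hs', sub_self, norm_zero, mul_zero] at this
    exact abs_nonpos_iff.1 this
  rw [map_sub, sub_eq_zero] at h2
  exact h2

/-- The space of test functions on `U`. -/
def testFunSubmodule (U : Set (E n)) : Submodule ℝ (E n → ℝ) where
  carrier := {φ | IsTestFun U φ}
  add_mem' := fun h1 h2 => h1.add h2
  zero_mem' := ⟨contDiff_const, HasCompactSupport.zero, by simp [tsupport]⟩
  smul_mem' := fun c _ h => h.const_mul c

/-- A function whose distributional derivative is bounded on `L²` has a weak derivative. -/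
theorem exists_hasWeakPartial_of_bound {U : Set (E n)} {K : ℝ}
    (hf : MemLp f 2 (volume.restrict U))
    (hK : ∀ φ, IsTestFun U φ → |∫ x in U, f x * pderiv i φ x| ≤ K * normLp 2 U φ) :
    ∃ g, HasWeakPartial U i f g := by
  have int : ∀ φ, IsTestFun U φ → IntegrableOn (fun x => f x * pderiv i φ x) U := fun φ hφ =>
    integrable_mul_of_memLp_two hf (hφ.pderiv.memLp _ _)
  let ι : testFunSubmodule U →ₗ[ℝ] Lp ℝ 2 (volume.restrict U) :=
    { toFun := fun φ => (φ.2.memLp 2 (volume.restrict U)).toLp φ.1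
      map_add' := fun φ ψ => rfl
      map_smul' := fun c φ => rfl }
  let T : testFunSubmodule U →ₗ[ℝ] ℝ :=
    { toFun := fun φ => - ∫ x in U, f x * pderiv i φ.1 x
      map_add' := fun φ ψ => by
        have e : ∀ x, f x * pderiv i (φ.1 + ψ.1) x = f x * pderiv i φ.1 x + f x * pderiv i ψ.1 x :=
          fun x => by
            rw [← mul_add, ← pderiv_add (φ.2.differentiable x) (ψ.2.differentiable x)]
            rfl
        simp only [Submodule.coe_add, e]
        rw [integral_add (int _ φ.2) (int _ ψ.2), neg_add]
      map_smul' := fun c φ => by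
        have e : ∀ x, f x * pderiv i (c • φ.1) x = c * (f x * pderiv i φ.1 x) := fun x => by
          have := pderiv_const_mul (i := i) c (φ.2.differentiable x)
          rw [mul_left_comm, ← this]
          rfl
        simp only [SetLike.val_smul, e]
        rw [integral_const_mul]
        simp }
  obtain ⟨y, hy⟩ := exists_inner_eq_of_abs_le ι T K fun φ => by
    have h1 := hK _ φ.2
    have h2 : ‖ι φ‖ = normLp 2 U φ.1 := Lp.norm_toLp φ.1 (φ.2.memLp 2 (volume.restrict U))
    rw [h2]
    simpa [T] using h1
  refine ⟨y, hf, Lp.memLp y, fun φ hφ => ?_⟩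
  have h1 := hy ⟨φ, hφ⟩
  rw [L2.inner_def] at h1
  have h2 : ∫ x in U, y x * φ x = - ∫ x in U, f x * pderiv i φ x := by
    refine Eq.trans (integral_congr_ae ?_) h1
    filter_upwards [(hφ.memLp 2 (volume.restrict U)).coeFn_toLp] with x hx
    have : (ι ⟨φ, hφ⟩ : E n → ℝ) x = φ x := hx
    simp [this, mul_comm]
  linarith

/-- Bounded difference quotients yield a weak derivative. -/
theorem exists_hasWeakPartial_of_diffQuot {K h₀ : ℝ} (hρδ : ρ < δ) (hh₀ : 0 < h₀)
    (hf : MemLp f 2 (volume.restrict (B n δ)))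
    (hK : ∀ h, 0 < h → h < h₀ → normLp 2 (B n ρ) (diffQuot l h f) ≤ K) :
    ∃ g, HasWeakPartial (B n ρ) l f g := by
  have hsub := ball_subset_ball' (n := n) hρδ.le
  refine exists_hasWeakPartial_of_bound (K := K)
    (hf.mono_measure (Measure.restrict_mono hsub le_rfl)) fun φ hφ => ?_
  rw [← hφ.pderiv.setIntegral_eq hsub]
  -- The integral to be bounded is the limit of integrals against quotients of `φ` with steps `-s
  -- m`. Moving each quotient onto `f` and applying Cauchy–Schwarz bounds all of them by `K` times
  -- the norm of `φ`.
  set s : ℕ → ℝ := fun m => 1 / ((m : ℝ) + 1) with hs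
  have hs0 : ∀ m, 0 < s m := fun m => by positivity
  have hst : Tendsto s atTop (𝓝 0) := tendsto_one_div_add_atTop_nhds_zero_nat
  obtain ⟨C, hC0, hC⟩ := hφ.pderiv (i := l) |>.exists_bound
  have hlim : Tendsto (fun m => ∫ x in B n δ, f x * diffQuot l (-s m) φ x) atTop
      (𝓝 (∫ x in B n δ, f x * pderiv l φ x)) := by
    have hfi : Integrable f (volume.restrict (B n δ)) := hf.integrable (by norm_num)
    refine tendsto_integral_of_dominated_convergence (fun x => |f x| * C)
      (fun m => hf.1.mul ?_) (hfi.abs.mul_const C) (fun m => Eventually.of_forall fun x => ?_)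
      (Eventually.of_forall fun x => ?_)
    · have : Continuous (diffQuot l (-s m) φ) := by
        have := hφ.continuous
        unfold diffQuot
        fun_prop
      exact this.aestronglyMeasurable
    · rw [norm_mul]
      refine mul_le_mul_of_nonneg_left ?_ (abs_nonneg _)
      have := (convex_univ).norm_image_sub_le_of_norm_hasDerivWithin_le
        (fun t _ => (hasDerivAt_line_of_contDiff (l := l) hφ.smooth x t).hasDerivWithinAt)
        (fun t _ => hC _) (mem_univ 0) (mem_univ (-s m))
      simp only [zero_smul, add_zero, sub_zero] at this
      rw [diffQuot, norm_mul, norm_inv, norm_neg, inv_mul_le_iff₀ (by simpa using (hs0 m).ne')]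
      rw [norm_neg] at this
      linarith
    · refine Tendsto.const_mul _ ?_
      have hd := hasDerivAt_line_of_contDiff (l := l) hφ.smooth x 0
      rw [zero_smul, add_zero] at hd
      have hsn : Tendsto (fun m => -s m) atTop (𝓝[≠] 0) :=
        tendsto_nhdsWithin_iff.2 ⟨by simpa using hst.neg,
          Eventually.of_forall fun m => by simpa using (hs0 m).ne'⟩
      have := (hasDerivAt_iff_tendsto_slope_zero.1 hd).comp hsn
      simpa [Function.comp_def, diffQuot] using this
  refine le_of_tendsto hlim.abs ?_
  filter_upwards [hst.eventually_lt_const hh₀, hst.eventually_lt_const (sub_pos.2 hρδ)]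
    with m hm1 hm2
  have hm2' : |s m| ≤ δ - ρ := by rw [abs_of_pos (hs0 m)]; exact hm2.le
  have h1 := setIntegral_diffQuot_mul (l := l) hρδ hm2' hf hφ
  have h2 := abs_integral_mul_le (memLp_diffQuot (l := l) hρδ hm2' hf)
    (hφ.memLp 2 (volume.restrict (B n ρ)))
  rw [h1, abs_neg] at h2
  exact h2.trans (mul_le_mul_of_nonneg_right (hK _ (hs0 m) hm1) ENNReal.toReal_nonneg)

end DifferenceQuotient

/-! ### Second order regularity -/

section SecondOrder
variable {n : ℕ} {U V : Set (E n)} {k : ℕ} {M η : ℝ} {A : E n → Matrix (Fin n) (Fin n) ℝ}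

/-- `u ∈ H¹(U)`, with weak gradient `g`, solves `-div (A ∇u) = φ - div Φ` weakly in `U`. -/
structure SolvesDiv (U : Set (E n)) (A : E n → Matrix (Fin n) (Fin n) ℝ) (u : E n → ℝ)
    (g : Fin n → E n → ℝ) (φ : E n → ℝ) (Φ : Fin n → E n → ℝ) : Prop where
  grad : HasWeakGrad U u g
  memLp : MemLp φ 2 (volume.restrict U)
  memLp' : ∀ i, MemLp (Φ i) 2 (volume.restrict U)
  eq : ∀ v, IsTestFun U v → ∑ i, ∫ x in U, pderiv i v x * flux A g i x =
    (∫ x in U, φ x * v x) + ∑ i, ∫ x in U, Φ i x * pderiv i v x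

theorem IsCoeff.mono (hA : IsCoeff U k M η A) (hV : V ⊆ U) : IsCoeff V k M η A :=
  ⟨fun i j => (hA.bdd i j).mono_set hV, fun x hx => hA.elliptic x (hV hx)⟩

theorem IsCoeff.mono_order {l : ℕ} (hA : IsCoeff U k M η A) (h : l ≤ k) : IsCoeff U l M η A :=
  ⟨fun i j => (hA.bdd i j).mono_order h, hA.elliptic⟩

theorem IsCoeff.elliptic_sum (hA : IsCoeff U k M η A) {x : E n} (hx : x ∈ U) (ξ : Fin n → ℝ) :
    η * ∑ i, ξ i ^ 2 ≤ ∑ i, (∑ j, A x i j * ξ j) * ξ i := by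
  have := hA.elliptic x hx ξ
  simpa [dotProduct, Matrix.mulVec, sq] using this

theorem IsCoeff.isRoughCoeff (hA : IsCoeff U k M η A) (hk : 1 ≤ k) (hU : IsOpen U) :
    IsRoughCoeff U M η A where
  meas := fun i j => ((hA.bdd i j).mono_order hk).aestronglyMeasurable hU
  bdd := fun i j => (hA.bdd i j).bound
  elliptic := fun _ hx ξ => hA.elliptic_sum hx ξ

/-- These are the leading coefficients of the equation solved by a difference quotient; bounds and
ellipticity survive translation with the same constants. -/
theorem IsCoeff.translate {ρ δ : ℝ} {a : E n} (ha : ‖a‖ ≤ δ - ρ) (hk : 1 ≤ k)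
    (hA : IsCoeff (B n δ) k M η A) : IsRoughCoeff (B n ρ) M η (fun x => A (x + a)) where
  meas := fun i j => by
    have hc := ((hA.bdd i j).mono_order hk).continuousOn Metric.isOpen_ball
    have : ContinuousOn (fun x => A (x + a) i j) (B n ρ) :=
      hc.comp (f := fun x => x + a) (by fun_prop) fun x hx => add_mem_ball hx ha
    exact this.aestronglyMeasurable measurableSet_ball
  bdd := fun i j x hx => (hA.bdd i j).bound _ (add_mem_ball hx ha)
  elliptic := fun _ hx ξ => hA.elliptic_sum (add_mem_ball hx ha) ξ

theorem normLp_le_normL2Vec (w : E n → Fin n → ℝ) (i : Fin n) :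
    normLp 2 U (fun x => w x i) ≤ normL2Vec U w := by
  refine Real.le_sqrt_of_sq_le ?_
  exact Finset.single_le_sum (f := fun i => normLp 2 U (fun x => w x i) ^ 2)
    (fun _ _ => sq_nonneg _) (Finset.mem_univ i)

theorem abs_sum_integral_mul_le {Φ w : Fin n → E n → ℝ}
    (hΦ : ∀ i, MemLp (Φ i) 2 (volume.restrict U)) (hw : ∀ i, MemLp (w i) 2 (volume.restrict U)) :
    |∑ i, ∫ x in U, Φ i x * w i x| ≤ (∑ i, normLp 2 U (Φ i)) * normL2Vec U (fun x i => w i x) := by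
  rw [Finset.sum_mul]
  refine (Finset.abs_sum_le_sum_abs _ _).trans (Finset.sum_le_sum fun i _ => ?_)
  refine (abs_integral_mul_le (hΦ i) (hw i)).trans ?_
  exact mul_le_mul_of_nonneg_left (normLp_le_normL2Vec (fun x i => w i x) i) ENNReal.toReal_nonneg

theorem normLp_mono_set {p : ℝ≥0∞} {f : E n → ℝ} (hf : MemLp f p (volume.restrict U)) (hV : V ⊆ U) :
    normLp p V f ≤ normLp p U f :=
  ENNReal.toReal_mono hf.2.ne (eLpNorm_mono_measure _ (Measure.restrict_mono hV le_rfl))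

theorem normLp_le_mul {f g : E n → ℝ} {C : ℝ} (hC : 0 ≤ C) (hg : MemLp g 2 (volume.restrict U))
    (h : ∀ᵐ x ∂(volume.restrict U), |f x| ≤ C * |g x|) : normLp 2 U f ≤ C * normLp 2 U g := by
  have h1 := eLpNorm_le_mul_eLpNorm_of_ae_le_mul (p := 2) (f := f) (g := g) (c := C) h
  have h2 := ENNReal.toReal_mono (ENNReal.mul_ne_top ENNReal.ofReal_ne_top hg.2.ne) h1
  rwa [ENNReal.toReal_mul, ENNReal.toReal_ofReal hC] at h2

theorem normLp_sum_le {ι : Type*} (s : Finset ι) {f : ι → E n → ℝ}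
    (hf : ∀ i ∈ s, MemLp (f i) 2 (volume.restrict U)) :
    normLp 2 U (fun x => ∑ i ∈ s, f i x) ≤ ∑ i ∈ s, normLp 2 U (f i) := by
  have h1 := eLpNorm_sum_le (s := s) (f := f) (p := 2) (μ := volume.restrict U)
    (fun i hi => (hf i hi).1) (by norm_num)
  have h2 := ENNReal.toReal_mono (ENNReal.sum_ne_top.2 fun i hi => (hf i hi).2.ne) h1
  rw [ENNReal.toReal_sum fun i hi => (hf i hi).2.ne] at h2
  refine le_of_eq_of_le ?_ h2
  rw [normLp]
  congr 2
  ext x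
  simp

/-- The difference quotient of a solution solves an equation with translated coefficients, whose
right-hand side is bounded in the dual of `H¹₀` by a constant independent of the step. -/
theorem SolvesDiv.diffQuot_bound {ρ δ : ℝ} (hρ : 0 < ρ) (hρδ : ρ < δ)
    (hA : IsCoeff (B n δ) 1 M η A) {u : E n → ℝ} {g : Fin n → E n → ℝ} {φ : E n → ℝ}
    {Φ : Fin n → E n → ℝ} {dΦ : Fin n → Fin n → E n → ℝ} (hu : SolvesDiv (B n δ) A u g φ Φ)
    (hΦ : ∀ i, HasWeakGrad (B n δ) (Φ i) (dΦ i)) (l : Fin n) :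
    ∃ b, 0 ≤ b ∧ ∀ h : ℝ, 0 < h → h < (δ - ρ) / 2 → ∀ v, IsTestFun (B n ρ) v →
      |∑ i, ∫ x in B n ρ, pderiv i v x *
        flux (fun x => A (x + h • EuclideanSpace.single l (1 : ℝ))) (fun i => diffQuot l h (g i)) i x|
      ≤ b * normL2Vec (B n ρ) (fun x i => pderiv i v x) := by
  have hOδ : IsOpen (B n δ) := Metric.isOpen_ball
  have hsub := ball_subset_ball' (n := n) hρδ.le
  have hM : 0 ≤ M := (abs_nonneg _).trans
    ((hA.bdd l l).bound 0 (Metric.mem_ball_self (hρ.trans hρδ)))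
  choose KΦ hKΦ0 hKΦ using fun i => (hΦ i).exists_diffQuot_bound hρ hρδ l
  have hgm : ∀ i, MemLp (g i) 2 (volume.restrict (B n δ)) := fun i => (hu.grad.part i).memLp'
  have hgm' : ∀ i, MemLp (g i) 2 (volume.restrict (B n ρ)) := fun i =>
    (hgm i).mono_measure (Measure.restrict_mono hsub le_rfl)
  have hFm := (hA.isRoughCoeff le_rfl hOδ).memLp_flux measurableSet_ball hgm
  -- One summand for each source term: `φ` against a quotient of `v`, the quotients of `Φ`, and the
  -- commutator in which the quotient falls on `A`, whose entries have quotients bounded by `M`.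
  refine ⟨normLp 2 (B n δ) φ + ∑ i, KΦ i + n * (M * ∑ j, normLp 2 (B n ρ) (g j)), ?_, ?_⟩
  · have h1 := normLp_nonneg 2 (B n δ) φ
    have h2 : 0 ≤ ∑ i, KΦ i := Finset.sum_nonneg fun i _ => hKΦ0 i
    have h3 : 0 ≤ ∑ j, normLp 2 (B n ρ) (g j) := Finset.sum_nonneg fun j _ => normLp_nonneg _ _ _
    exact add_nonneg (add_nonneg h1 h2) (mul_nonneg (Nat.cast_nonneg _) (mul_nonneg hM h3))
  intro h hh hhδ v hv
  set e : E n := EuclideanSpace.single l (1 : ℝ) with he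
  have habs : |h| = h := abs_of_pos hh
  have hhle : |h| ≤ δ - ρ := by rw [habs]; linarith
  set N := normL2Vec (B n ρ) (fun x i => pderiv i v x) with hN
  -- the test function for the original equation
  have hvt : IsTestFun (B n δ) (diffQuot l (-h) v) := hv.diffQuot hsub fun x hx => by
    rw [neg_smul, sub_neg_eq_add]
    exact add_mem_ball hx (by rw [norm_smul_single]; linarith)
  have heq := hu.eq _ hvt
  simp only [pderiv_diffQuot hv.smooth] at heq
  set R : Fin n → E n → ℝ := fun i x => ∑ j, diffQuot l h (fun y => A y i j) x * g j x with hR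
  have hAq : ∀ i j, ∀ x ∈ B n ρ, |diffQuot l h (fun y => A y i j) x| ≤ M := fun i j x hx => by
    have h1 := (hA.bdd i j).abs_sub_le (i := l) (convex_ball 0 δ) (hsub hx)
      (add_mem_ball (a := h • e) hx (by rw [norm_smul_single]; linarith))
    rw [habs] at h1
    rw [diffQuot, abs_mul, abs_inv, habs, inv_mul_le_iff₀ hh, mul_comm h]
    exact h1
  have hAqm : ∀ i j, AEStronglyMeasurable (diffQuot l h (fun y => A y i j))
      (volume.restrict (B n ρ)) := fun i j => by
    have h1 := (hA.translate (ρ := ρ) (a := h • e) (by rw [norm_smul_single]; linarith)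
      le_rfl).meas i j
    have h2 := ((hA.bdd i j).aestronglyMeasurable hOδ).mono_measure
      (Measure.restrict_mono hsub le_rfl)
    exact (h1.sub h2).const_mul _
  have hmem : ∀ᵐ x ∂(volume.restrict (B n ρ)), x ∈ B n ρ := self_mem_ae_restrict measurableSet_ball
  have hRj : ∀ i j, MemLp (fun x => diffQuot l h (fun y => A y i j) x * g j x) 2
      (volume.restrict (B n ρ)) := fun i j => MemLp.mul_bounded (C := M) (hgm' j) (hAqm i j) (by
        filter_upwards [hmem] with x hx using hAq i j x hx)
  have hRm : ∀ i, MemLp (R i) 2 (volume.restrict (B n ρ)) := fun i =>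
    memLp_finsetSum _ fun j _ => hRj i j
  have hRle : ∀ i, normLp 2 (B n ρ) (R i) ≤ M * ∑ j, normLp 2 (B n ρ) (g j) := fun i => by
    rw [Finset.mul_sum]
    refine (normLp_sum_le _ fun j _ => hRj i j).trans (Finset.sum_le_sum fun j _ => ?_)
    refine normLp_le_mul hM (hgm' j) ?_
    filter_upwards [hmem] with x hx
    rw [abs_mul]
    exact mul_le_mul_of_nonneg_right (hAq i j x hx) (abs_nonneg _)
  -- rewriting the bilinear form
  have hflux : ∀ i x, flux (fun x => A (x + h • e)) (fun i => diffQuot l h (g i)) i x =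
      diffQuot l h (flux A g i) x - R i x := by
    intro i x
    simp only [flux, hR, diffQuot, ← Finset.sum_sub_distrib, Finset.mul_sum]
    refine Finset.sum_congr rfl fun j _ => ?_
    ring
  have hsplit : ∀ i, ∫ x in B n ρ, pderiv i v x *
      flux (fun x => A (x + h • e)) (fun i => diffQuot l h (g i)) i x =
      -(∫ x in B n δ, diffQuot l (-h) (pderiv i v) x * flux A g i x) -
        ∫ x in B n ρ, R i x * pderiv i v x := by
    intro i
    have e1 : ∀ x, pderiv i v x * (diffQuot l h (flux A g i) x - R i x) =
        diffQuot l h (flux A g i) x * pderiv i v x - R i x * pderiv i v x := fun x => by ring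
    simp only [hflux, e1]
    rw [integral_sub (integrable_mul_of_memLp_two (memLp_diffQuot hρδ hhle (hFm i))
      (hv.pderiv.memLp _ _)) (integrable_mul_of_memLp_two (hRm i) (hv.pderiv.memLp _ _)),
      setIntegral_diffQuot_mul hρδ hhle (hFm i) hv.pderiv]
    simp only [mul_comm]
  simp only [hsplit]
  rw [Finset.sum_sub_distrib, Finset.sum_neg_distrib, heq]
  have hΦq : ∀ i, ∫ x in B n δ, Φ i x * diffQuot l (-h) (pderiv i v) x =
      - ∫ x in B n ρ, diffQuot l h (Φ i) x * pderiv i v x := fun i => by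
    rw [setIntegral_diffQuot_mul hρδ hhle (hu.memLp' i) hv.pderiv, neg_neg]
  simp only [hΦq]
  rw [Finset.sum_neg_distrib]
  -- the three terms
  have b1 : |∫ x in B n δ, φ x * diffQuot l (-h) v x| ≤ normLp 2 (B n δ) φ * N := by
    refine (abs_integral_mul_le hu.memLp (hvt.memLp _ _)).trans ?_
    refine mul_le_mul_of_nonneg_left ?_ ENNReal.toReal_nonneg
    have h1 : (eLpNorm (diffQuot l (-h) v) 2 (volume.restrict (B n δ))).toReal ≤
        (eLpNorm (pderiv l v) 2 volume).toReal :=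
      ENNReal.toReal_mono (hv.pderiv.memLp 2 volume).2.ne
        ((eLpNorm_mono_measure _ Measure.restrict_le_self).trans
          (eLpNorm_diffQuot_le_of_contDiff hv.smooth (neg_ne_zero.2 hh.ne')))
    refine h1.trans (le_of_eq_of_le ?_ (normLp_le_normL2Vec (fun x i => pderiv i v x) l))
    rw [normLp, eLpNorm_restrict_eq_of_support_subset]
    intro x hx
    by_contra hxρ
    exact hx (hv.pderiv.eq_zero hxρ)
  have b2 : |∑ i, ∫ x in B n ρ, diffQuot l h (Φ i) x * pderiv i v x| ≤ (∑ i, KΦ i) * N := by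
    refine (abs_sum_integral_mul_le (fun i => memLp_diffQuot hρδ hhle (hu.memLp' i))
      (fun i => hv.pderiv.memLp _ _)).trans ?_
    refine mul_le_mul_of_nonneg_right (Finset.sum_le_sum fun i _ => ?_) (normL2Vec_nonneg _ _)
    exact hKΦ i h hh.ne' (by rw [habs]; exact hhδ)
  have b3 : |∑ i, ∫ x in B n ρ, R i x * pderiv i v x| ≤
      n * (M * ∑ j, normLp 2 (B n ρ) (g j)) * N := by
    refine (abs_sum_integral_mul_le hRm (fun i => hv.pderiv.memLp _ _)).trans ?_
    refine mul_le_mul_of_nonneg_right ?_ (normL2Vec_nonneg _ _)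
    refine (Finset.sum_le_sum fun i _ => hRle i).trans (le_of_eq ?_)
    rw [Finset.sum_const]
    simp
  rw [abs_le] at b1 b2 b3 ⊢
  constructor <;> linarith

/-- Interior `H²` regularity, without estimates. -/
theorem SolvesDiv.exists_second_deriv {ρ δ : ℝ} (hη : 0 < η) (hρ : 0 < ρ) (hρδ : ρ < δ)
    (hA : IsCoeff (B n δ) 1 M η A) {u : E n → ℝ} {g : Fin n → E n → ℝ} {φ : E n → ℝ}
    {Φ : Fin n → E n → ℝ} {dΦ : Fin n → Fin n → E n → ℝ} (hu : SolvesDiv (B n δ) A u g φ Φ)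
    (hΦ : ∀ i, HasWeakGrad (B n δ) (Φ i) (dΦ i)) (m l : Fin n) :
    ∃ g', HasWeakPartial (B n ρ) l (g m) g' := by
  obtain ⟨C, hC0, hC⟩ := caccioppoli n M η hη
  -- One half of the gap is spent on translating, the other on the Caccioppoli inequality.
  set σ := (ρ + δ) / 2 with hσ
  have hρσ : ρ < σ := by rw [hσ]; linarith
  have hσδ : σ < δ := by rw [hσ]; linarith
  have hσ0 : 0 < σ := hρ.trans hρσ
  obtain ⟨b, hb0, hb⟩ := hu.diffQuot_bound hσ0 hσδ hA hΦ l
  obtain ⟨K, hK0, hK⟩ := hu.grad.exists_diffQuot_bound hσ0 hσδ l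
  refine exists_hasWeakPartial_of_diffQuot (h₀ := (δ - σ) / 2)
    (K := √(C * (((σ - ρ) ^ 2)⁻¹ * K ^ 2 + b ^ 2))) hρδ (by linarith)
    (hu.grad.part m).memLp' fun h hh hhσ => ?_
  have habs : |h| = h := abs_of_pos hh
  have hhle : |h| ≤ δ - σ := by rw [habs]; linarith
  have h1 := hC ρ σ hρ hρσ _ (hA.translate (ρ := σ) (a := h • EuclideanSpace.single l (1 : ℝ))
    (by rwa [norm_smul_single]) le_rfl) _ _ (hu.grad.diffQuot (l := l) hσδ hhle) 0 b le_rfl hb0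
    (fun v hv => by simpa using hb h hh hhσ v hv)
  refine (normLp_le_normL2Vec (fun x i => diffQuot l h (g i) x) m).trans (Real.le_sqrt_of_sq_le ?_)
  refine h1.trans ?_
  rw [zero_mul, add_zero]
  have := hK h hh.ne' (by rwa [habs])
  have h0 := normLp_nonneg 2 (B n σ) (diffQuot l h u)
  gcongr

end SecondOrder

/-! ### Bounds for all weak derivatives up to a given order -/

section SobolevBound
variable {n : ℕ} {U V : Set (E n)} {f g : E n → ℝ} {K K' M δ : ℝ} {m l : ℕ}

/-- `f` has weak derivatives up to order `m` on `U`, with `L²` norms bounded by `K`. -/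
def HasSobolevBound (U : Set (E n)) : ℕ → (E n → ℝ) → ℝ → Prop
  | 0, f, K => MemLp f 2 (volume.restrict U) ∧ normLp 2 U f ≤ K
  | m + 1, f, K => (MemLp f 2 (volume.restrict U) ∧ normLp 2 U f ≤ K) ∧
      ∀ i, ∃ g, HasWeakPartial U i f g ∧ HasSobolevBound U m g K

theorem HasSobolevBound.zero : ∀ {m : ℕ}, HasSobolevBound U m f K → HasSobolevBound U 0 f K
  | 0, h => h
  | _ + 1, h => h.1

theorem HasSobolevBound.memLp (h : HasSobolevBound U m f K) : MemLp f 2 (volume.restrict U) :=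
  h.zero.1

theorem HasSobolevBound.norm_le (h : HasSobolevBound U m f K) : normLp 2 U f ≤ K := h.zero.2

theorem HasSobolevBound.nonneg (h : HasSobolevBound U m f K) : 0 ≤ K :=
  (normLp_nonneg _ _ _).trans h.norm_le

theorem HasSobolevBound.mono_const (hK : K ≤ K') : ∀ {m : ℕ} {f : E n → ℝ},
    HasSobolevBound U m f K → HasSobolevBound U m f K'
  | 0, _, h => ⟨h.1, h.2.trans hK⟩
  | _ + 1, _, h => ⟨⟨h.1.1, h.1.2.trans hK⟩, fun i =>
      let ⟨g, h1, h2⟩ := h.2 i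
      ⟨g, h1, h2.mono_const hK⟩⟩

theorem HasSobolevBound.mono_order : ∀ {m l : ℕ} {f : E n → ℝ}, l ≤ m →
    HasSobolevBound U m f K → HasSobolevBound U l f K
  | _, 0, _, _, h => h.zero
  | _ + 1, _ + 1, _, hlm, h => ⟨h.1, fun i =>
      let ⟨g, h1, h2⟩ := h.2 i
      ⟨g, h1, h2.mono_order (Nat.le_of_succ_le_succ hlm)⟩⟩

theorem HasSobolevBound.mono_set (hV : V ⊆ U) : ∀ {m : ℕ} {f : E n → ℝ},
    HasSobolevBound U m f K → HasSobolevBound V m f K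
  | 0, _, h => ⟨h.1.mono_measure (Measure.restrict_mono hV le_rfl),
      (normLp_mono_set h.1 hV).trans h.2⟩
  | _ + 1, _, h => ⟨⟨h.1.1.mono_measure (Measure.restrict_mono hV le_rfl),
      (normLp_mono_set h.1.1 hV).trans h.1.2⟩, fun i =>
      let ⟨g, h1, h2⟩ := h.2 i
      ⟨g, h1.mono hV, h2.mono_set hV⟩⟩

theorem normLp_congr_ae (h : f =ᵐ[volume.restrict U] g) (p : ℝ≥0∞) :
    normLp p U f = normLp p U g := by
  rw [normLp, normLp, eLpNorm_congr_ae h]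

theorem HasSobolevBound.congr_ae (h : HasSobolevBound U m f K) (hfg : f =ᵐ[volume.restrict U] g) :
    HasSobolevBound U m g K := by
  cases m with
  | zero => exact ⟨h.1.ae_eq hfg, (normLp_congr_ae hfg 2).symm.le.trans h.2⟩
  | succ m => exact ⟨⟨h.1.1.ae_eq hfg, (normLp_congr_ae hfg 2).symm.le.trans h.1.2⟩, fun i =>
      let ⟨g', h1, h2⟩ := h.2 i
      ⟨g', h1.congr hfg ae_eq_rfl, h2⟩⟩

theorem HasSobolevBound.hasWeakGrad (h : HasSobolevBound U (m + 1) f K) :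
    ∃ g : Fin n → E n → ℝ, HasWeakGrad U f g ∧ ∀ i, HasSobolevBound U m (g i) K := by
  choose g h1 h2 using h.2
  exact ⟨g, ⟨h.memLp, h1⟩, h2⟩

theorem HasSobolevBound.of_hasWeakPartial {i : Fin n} (hU : IsOpen U)
    (h : HasSobolevBound U (m + 1) f K) (hg : HasWeakPartial U i f g) :
    HasSobolevBound U m g K := by
  obtain ⟨g', h1, h2⟩ := h.2 i
  exact h2.congr_ae (h1.ae_eq hU hg)

theorem normLp_add_le (hf : MemLp f 2 (volume.restrict U)) (hg : MemLp g 2 (volume.restrict U)) :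
    normLp 2 U (fun x => f x + g x) ≤ normLp 2 U f + normLp 2 U g := by
  have h1 := eLpNorm_add_le hf.1 hg.1 (p := 2) (by norm_num)
  have h2 := ENNReal.toReal_mono (ENNReal.add_ne_top.2 ⟨hf.2.ne, hg.2.ne⟩) h1
  rwa [ENNReal.toReal_add hf.2.ne hg.2.ne] at h2

theorem HasSobolevBound.add : ∀ {m : ℕ} {f g : E n → ℝ}, HasSobolevBound U m f K →
    HasSobolevBound U m g K' → HasSobolevBound U m (fun x => f x + g x) (K + K')
  | 0, _, _, hf, hg => ⟨hf.1.add hg.1, (normLp_add_le hf.1 hg.1).trans (add_le_add hf.2 hg.2)⟩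
  | _ + 1, _, _, hf, hg => ⟨⟨hf.1.1.add hg.1.1,
      (normLp_add_le hf.1.1 hg.1.1).trans (add_le_add hf.1.2 hg.1.2)⟩, fun i =>
      let ⟨_, h1, h2⟩ := hf.2 i
      let ⟨_, h3, h4⟩ := hg.2 i
      ⟨_, h1.add h3, h2.add h4⟩⟩

theorem HasSobolevBound.neg : ∀ {m : ℕ} {f : E n → ℝ}, HasSobolevBound U m f K →
    HasSobolevBound U m (fun x => (-1) * f x) K
  | 0, f, hf => ⟨hf.1.const_mul _, by
      have := normLp_le_mul (f := fun x => (-1) * f x) zero_le_one hf.1 (by simp)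
      exact this.trans (by simpa using hf.2)⟩
  | _ + 1, f, hf => ⟨⟨hf.1.1.const_mul _, by
      have := normLp_le_mul (f := fun x => (-1) * f x) zero_le_one hf.1.1 (by simp)
      exact this.trans (by simpa using hf.1.2)⟩, fun i =>
      let ⟨_, h1, h2⟩ := hf.2 i
      ⟨_, h1.const_mul _, h2.neg⟩⟩

theorem normLp_zero (p : ℝ≥0∞) : normLp p U (fun _ : E n => (0 : ℝ)) = 0 := by
  simp [normLp]

theorem hasWeakPartial_zero (i : Fin n) : HasWeakPartial U i (fun _ => 0) (fun _ => 0) :=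
  ⟨MemLp.zero', MemLp.zero', fun _ _ => by simp⟩

theorem hasSobolevBound_zero (hK : 0 ≤ K) : ∀ m : ℕ, HasSobolevBound U m (fun _ => 0) K
  | 0 => ⟨MemLp.zero', by rwa [normLp_zero]⟩
  | m + 1 => ⟨⟨MemLp.zero', by rwa [normLp_zero]⟩, fun i =>
      ⟨_, hasWeakPartial_zero i, hasSobolevBound_zero hK m⟩⟩

theorem HasSobolevBound.sum {ι : Type*} {F : ι → E n → ℝ} (s : Finset ι)
    (h : ∀ i ∈ s, HasSobolevBound U m (F i) K) :
    HasSobolevBound U m (fun x => ∑ i ∈ s, F i x) (s.card * K) := by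
  classical
  induction s using Finset.induction_on with
  | empty => simpa using hasSobolevBound_zero (K := 0) le_rfl m
  | insert j s hj ih =>
    have h1 := (h j (Finset.mem_insert_self _ _)).add
      (ih fun i hi => h i (Finset.mem_insert_of_mem hi))
    simp only [Finset.sum_insert hj, Finset.card_insert_of_notMem hj]
    refine h1.mono_const (le_of_eq ?_)
    push_cast
    ring

/-- Each use of the Leibniz rule doubles the number of terms, whence `2 ^ m`. Measurability of `a`
is a separate hypothesis because a bound of order zero carries none; in the recursion it comes from
the order one lemma before an order is given up. -/
theorem HasSobolevBound.mul_boundedDerivs (hδ : 0 < δ) (hM : 0 ≤ M) : ∀ {m : ℕ} {a f : E n → ℝ},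
    HasBoundedDerivs (B n δ) M m a → AEStronglyMeasurable a (volume.restrict (B n δ)) →
    HasSobolevBound (B n δ) m f K → HasSobolevBound (B n δ) m (fun x => a x * f x) (2 ^ m * M * K)
  | m, a, f, ha, ham, hf => by
    have hK := hf.nonneg
    have hmem : ∀ᵐ x ∂(volume.restrict (B n δ)), x ∈ B n δ := self_mem_ae_restrict measurableSet_ball
    have hb : ∀ᵐ x ∂(volume.restrict (B n δ)), |a x| ≤ M := by
      filter_upwards [hmem] with x hx using ha.bound x hx
    have h0 : MemLp (fun x => a x * f x) 2 (volume.restrict (B n δ)) ∧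
        normLp 2 (B n δ) (fun x => a x * f x) ≤ 2 ^ m * M * K := by
      refine ⟨MemLp.mul_bounded hf.memLp ham hb, ?_⟩
      refine (normLp_le_mul hM hf.memLp ?_).trans (?_ : M * normLp 2 (B n δ) f ≤ _)
      · filter_upwards [hb] with x hx
        rw [abs_mul]
        exact mul_le_mul_of_nonneg_right hx (abs_nonneg _)
      · calc M * normLp 2 (B n δ) f ≤ M * K := mul_le_mul_of_nonneg_left hf.norm_le hM
          _ = 1 * (M * K) := (one_mul _).symm
          _ ≤ 2 ^ m * (M * K) := mul_le_mul_of_nonneg_right (one_le_pow₀ one_le_two) (by positivity)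
          _ = 2 ^ m * M * K := by ring
    cases m with
    | zero => exact h0
    | succ m =>
      refine ⟨h0, fun i => ?_⟩
      obtain ⟨g, hg, hgb⟩ := hf.hasWeakGrad
      have ha1 : HasBoundedDerivs (B n δ) M 1 a := ha.mono_order (by omega)
      refine ⟨_, (hg.mul_boundedDerivs hδ ha1).part i, ?_⟩
      have h1 := HasSobolevBound.mul_boundedDerivs hδ hM (ha.mono_order (Nat.le_succ m)) ham (hgb i)
      have h2 := HasSobolevBound.mul_boundedDerivs hδ hM (ha.2 i).2
        (ha1.aestronglyMeasurable_pderiv Metric.isOpen_ball) (hf.mono_order (Nat.le_succ m))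
      refine (h1.add h2).mono_const (le_of_eq ?_)
      ring

end SobolevBound

/-! ### Higher regularity -/

section HigherRegularity
variable {n : ℕ} {U V : Set (E n)} {M η : ℝ} {A : E n → Matrix (Fin n) (Fin n) ℝ}
  {u φ : E n → ℝ} {g Φ : Fin n → E n → ℝ}

theorem HasWeakPartial.sum {ι : Type*} {i : Fin n} {F G : ι → E n → ℝ} (s : Finset ι)
    (h : ∀ j ∈ s, HasWeakPartial U i (F j) (G j)) :
    HasWeakPartial U i (fun x => ∑ j ∈ s, F j x) (fun x => ∑ j ∈ s, G j x) := by
  classical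
  induction s using Finset.induction_on with
  | empty => simpa using hasWeakPartial_zero i
  | insert j s hj ih =>
    simp only [Finset.sum_insert hj]
    exact (h j (Finset.mem_insert_self _ _)).add
      (ih fun i hi => h i (Finset.mem_insert_of_mem hi))

/-- Weak second derivatives commute. -/
theorem HasWeakGrad.partial_comm {l q : Fin n} {w : E n → ℝ} (hu : HasWeakGrad U u g)
    (hw : HasWeakPartial U l (g q) w) : HasWeakPartial U q (g l) w where
  memLp := (hu.part l).memLp'
  memLp' := hw.memLp'
  eq := fun v hv => by
    have h1 := (hu.part l).eq _ (hv.pderiv (i := q))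
    have h2 := (hu.part q).eq _ (hv.pderiv (i := l))
    have h3 := hw.eq v hv
    rw [pderiv_comm hv.smooth] at h1
    linarith

/-- The derivative of a solution solves the differentiated equation. -/
theorem SolvesDiv.deriv {ρ δ : ℝ} (hρ : 0 < ρ) (hρδ : ρ < δ) (hA : IsCoeff (B n δ) 1 M η A)
    (hu : SolvesDiv (B n δ) A u g φ Φ) {dΦ : Fin n → E n → ℝ} (l : Fin n)
    (hΦ : ∀ m, HasWeakPartial (B n δ) l (Φ m) (dΦ m)) {g2 : Fin n → Fin n → E n → ℝ}
    (hg2 : ∀ q, HasWeakGrad (B n ρ) (g q) (g2 q)) :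
    SolvesDiv (B n ρ) A (g l) (fun q => g2 q l) (fun _ => 0)
      (fun m x => dΦ m x + (-1) * ((if m = l then φ x else 0) +
        ∑ q, pderiv l (fun y => A y m q) x * g q x)) := by
  have hsub := ball_subset_ball' (n := n) hρδ.le
  have hO : IsOpen (B n ρ) := Metric.isOpen_ball
  have hAρ := hA.mono hsub
  have huρ := hu.grad.mono hsub
  have hle : volume.restrict (B n ρ) ≤ volume.restrict (B n δ) := Measure.restrict_mono hsub le_rfl
  have mφ : ∀ m, MemLp (fun x => if m = l then φ x else 0) 2 (volume.restrict (B n ρ)) := fun m => by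
    by_cases hml : m = l
    · simpa [hml] using hu.memLp.mono_measure hle
    · simp [hml]
  have mR : ∀ m, MemLp (fun x => ∑ q, pderiv l (fun y => A y m q) x * g q x) 2
      (volume.restrict (B n ρ)) := fun m => memLp_finsetSum _ fun q _ =>
    (hAρ.bdd m q).memLp_pderiv_mul hO (huρ.part q).memLp'
  have mdΦ : ∀ m, MemLp (dΦ m) 2 (volume.restrict (B n ρ)) := fun m =>
    (hΦ m).memLp'.mono_measure hle
  have hw : HasWeakGrad (B n ρ) (g l) (fun q => g2 q l) :=
    ⟨(huρ.part l).memLp', fun q => huρ.partial_comm ((hg2 q).part l)⟩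
  refine ⟨hw, MemLp.zero', fun m => (mdΦ m).add (((mφ m).add (mR m)).const_mul _), fun v hv => ?_⟩
  -- The differentiated equation is the original one tested with `∂ₗv`, followed by integration by
  -- parts in direction `l`. The term with `φ` is not integrated by parts: it enters the `l`-th
  -- component of the new vector field, and the new scalar datum is zero.
  have heq := hu.eq (pderiv l v) (hv.mono hsub).pderiv
  -- restrict the original equation to the smaller ball
  have e1 : ∀ m, ∫ x in B n δ, pderiv m (pderiv l v) x * flux A g m x =
      - ∫ x in B n ρ, (flux A (fun q => g2 q l) m x +
        ∑ q, pderiv l (fun y => A y m q) x * g q x) * pderiv m v x := by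
    intro m
    have hF : HasWeakPartial (B n ρ) l (flux A g m) (fun x => flux A (fun q => g2 q l) m x +
        ∑ q, pderiv l (fun y => A y m q) x * g q x) := by
      have := HasWeakPartial.sum (i := l) (Finset.univ : Finset (Fin n)) fun q _ =>
        (((hg2 q).mul_boundedDerivs hρ (hAρ.bdd m q)).part l)
      have hfl : flux A g m = fun x => ∑ q, A x m q * g q x := rfl
      rw [hfl]
      simpa only [flux, Finset.sum_add_distrib] using this
    rw [← hF.eq _ hv.pderiv, pderiv_comm hv.smooth, ← hv.pderiv.pderiv.setIntegral_eq hsub]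
    simp only [mul_comm]
  have e2 : ∀ m, ∫ x in B n δ, Φ m x * pderiv m (pderiv l v) x =
      - ∫ x in B n ρ, dΦ m x * pderiv m v x := by
    intro m
    rw [pderiv_comm hv.smooth, (hΦ m).eq _ (hv.mono hsub).pderiv, hv.pderiv.setIntegral_eq hsub]
  simp only [e1, e2, hv.pderiv.setIntegral_eq hsub] at heq
  have hFm := (hAρ.isRoughCoeff le_rfl hO).memLp_flux measurableSet_ball
    (g := fun q => g2 q l) (fun q => (hw.part q).memLp')
  have e3 : ∀ m, ∫ x in B n ρ, (flux A (fun q => g2 q l) m x +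
        ∑ q, pderiv l (fun y => A y m q) x * g q x) * pderiv m v x =
      (∫ x in B n ρ, pderiv m v x * flux A (fun q => g2 q l) m x) +
        ∫ x in B n ρ, (∑ q, pderiv l (fun y => A y m q) x * g q x) * pderiv m v x := by
    intro m
    rw [← integral_add (integrable_mul_of_memLp_two (hv.pderiv.memLp _ _) (hFm m))
      (integrable_mul_of_memLp_two (mR m) (hv.pderiv.memLp _ _))]
    congr 1
    ext x
    ring
  have e4 : ∀ m, ∫ x in B n ρ, (dΦ m x + (-1) * ((if m = l then φ x else 0) +
        ∑ q, pderiv l (fun y => A y m q) x * g q x)) * pderiv m v x =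
      (∫ x in B n ρ, dΦ m x * pderiv m v x) -
        ((∫ x in B n ρ, (if m = l then φ x else 0) * pderiv m v x) +
        ∫ x in B n ρ, (∑ q, pderiv l (fun y => A y m q) x * g q x) * pderiv m v x) := by
    intro m
    have i1 := integrable_mul_of_memLp_two (mdΦ m) (hv.pderiv (i := m).memLp 2 _)
    have i2 := integrable_mul_of_memLp_two (mφ m) (hv.pderiv (i := m).memLp 2 _)
    have i3 := integrable_mul_of_memLp_two (mR m) (hv.pderiv (i := m).memLp 2 _)
    have i23 := i2.add i3
    simp only [Pi.add_def] at i23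
    rw [← integral_add i2 i3, ← integral_sub i1 i23]
    congr 1
    ext x
    ring
  have e5 : ∑ m, ∫ x in B n ρ, (if m = l then φ x else 0) * pderiv m v x =
      ∫ x in B n ρ, φ x * pderiv l v x := by
    rw [Finset.sum_eq_single l]
    · simp
    · intro m _ hm
      simp [hm]
    · simp
  simp only [e3] at heq
  simp only [e4, zero_mul, integral_zero, zero_add]
  rw [Finset.sum_sub_distrib, Finset.sum_add_distrib, e5]
  rw [Finset.sum_neg_distrib, Finset.sum_neg_distrib, Finset.sum_add_distrib] at heq
  linarith

theorem SolvesDiv.abs_form_le (hu : SolvesDiv U A u g φ Φ) (v : E n → ℝ) (hv : IsTestFun U v) :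
    |∑ i, ∫ x in U, pderiv i v x * flux A g i x| ≤ normLp 2 U φ * normLp 2 U v +
      (∑ i, normLp 2 U (Φ i)) * normL2Vec U (fun x i => pderiv i v x) := by
  rw [hu.eq v hv]
  exact (abs_add_le _ _).trans (add_le_add (abs_integral_mul_le hu.memLp (hv.memLp _ _))
    (abs_sum_integral_mul_le hu.memLp' fun i => hv.pderiv.memLp _ _))

/-- Scale invariant bounds for the data of the equation up to the order needed for regularity of
order `j`, where `q` is the inverse of the distance to the boundary. -/
structure DataBound (U : Set (E n)) (j : ℕ) (q S : ℝ) (u φ : E n → ℝ) (Φ : Fin n → E n → ℝ) :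
    Prop where
  sol : normLp 2 U u ≤ S
  scal : normLp 2 U φ ≤ q ^ 2 * S
  scal' : ∀ i, i + 2 ≤ j → HasSobolevBound U i φ (q ^ (i + 2) * S)
  vec : ∀ i, i + 1 ≤ j → ∀ m, HasSobolevBound U i (Φ m) (q ^ (i + 1) * S)

theorem DataBound.nonneg {j : ℕ} {q S : ℝ} (h : DataBound U j q S u φ Φ) : 0 ≤ S :=
  (normLp_nonneg _ _ _).trans h.sol

theorem DataBound.mono {j j' : ℕ} {q q' S : ℝ} (hq : 0 ≤ q) (hqq : q ≤ q') (hj : j' ≤ j)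
    (h : DataBound U j q S u φ Φ) : DataBound U j' q' S u φ Φ where
  sol := h.sol
  scal := h.scal.trans (mul_le_mul_of_nonneg_right (pow_le_pow_left₀ hq hqq _) h.nonneg)
  scal' := fun i hi => (h.scal' i (hi.trans hj)).mono_const
    (mul_le_mul_of_nonneg_right (pow_le_pow_left₀ hq hqq _) h.nonneg)
  vec := fun i hi m => (h.vec i (hi.trans hj) m).mono_const
    (mul_le_mul_of_nonneg_right (pow_le_pow_left₀ hq hqq _) h.nonneg)

/-- Interior regularity of order `j` with scale invariant bounds. -/
def InteriorRegularity (n : ℕ) (R₀ M η : ℝ) (j : ℕ) : Prop :=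
  ∃ C : ℝ, 1 ≤ C ∧ ∀ r δ : ℝ, 0 < r → r < δ → δ ≤ R₀ →
    ∀ A : E n → Matrix (Fin n) (Fin n) ℝ, IsCoeff (B n δ) j M η A →
    ∀ (u : E n → ℝ) (g : Fin n → E n → ℝ) (φ : E n → ℝ) (Φ : Fin n → E n → ℝ) (S : ℝ),
    SolvesDiv (B n δ) A u g φ Φ → DataBound (B n δ) j (δ - r)⁻¹ S u φ Φ →
    ∀ i ≤ j, HasSobolevBound (B n r) i u (C * ((δ - r)⁻¹ ^ i * S))

/-- The Caccioppoli inequality with `a = q²S` and `b = nqS`, where every term on the right is a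
multiple of `q²S²`. The summand `|R₀|` in the constant is there because an order one bound must
dominate the norm of `u` itself by a multiple of `qS`. -/
theorem interiorRegularity_one (n : ℕ) (R₀ M η : ℝ) (hη : 0 < η) :
    InteriorRegularity n R₀ M η 1 := by
  obtain ⟨C, hC0, hC⟩ := caccioppoli n M η hη
  refine ⟨1 + |R₀| + √(C * (2 + n ^ 2)), ?_, ?_⟩
  · have := abs_nonneg R₀
    have := Real.sqrt_nonneg (C * (2 + n ^ 2))
    linarith
  intro r δ hr hrδ hδR A hA u g φ Φ S hu hS i hi
  have hsub := ball_subset_ball' (n := n) hrδ.le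
  have hS0 := hS.nonneg
  have hε : 0 < δ - r := sub_pos.2 hrδ
  set q := (δ - r)⁻¹ with hq
  have hq0 : 0 < q := inv_pos.2 hε
  have hD : 0 ≤ √(C * (2 + n ^ 2)) := Real.sqrt_nonneg _
  have huρ := hu.grad.mono hsub
  have hur : normLp 2 (B n r) u ≤ S := (normLp_mono_set hu.grad.memLp hsub).trans hS.sol
  -- The gap `δ - r` is at most `R₀`, so a missing factor `q` can always be bought for `|R₀|`.
  have hqR : 1 ≤ |R₀| * q := by
    rw [hq, ← div_eq_mul_inv, one_le_div hε]
    exact (by linarith : δ - r ≤ R₀).trans (le_abs_self _)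
  have hbase : HasSobolevBound (B n r) 0 u ((1 + |R₀| + √(C * (2 + n ^ 2))) * (q ^ 0 * S)) := by
    refine ⟨huρ.memLp, hur.trans ?_⟩
    rw [pow_zero, one_mul]
    exact le_mul_of_one_le_left hS0 (by linarith [abs_nonneg R₀])
  have hu1 : normLp 2 (B n r) u ≤ (1 + |R₀| + √(C * (2 + n ^ 2))) * (q ^ 1 * S) := by
    refine hur.trans ?_
    have h1 : S ≤ |R₀| * q * S := le_mul_of_one_le_left hS0 hqR
    have h2 : 0 ≤ q * S := by positivity
    have h3 := mul_nonneg hD h2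
    rw [pow_one]
    nlinarith
  have hgrad : ∀ m, normLp 2 (B n r) (g m) ≤ (1 + |R₀| + √(C * (2 + n ^ 2))) * (q ^ 1 * S) := by
    intro m
    have hΦ : ∑ i, normLp 2 (B n δ) (Φ i) ≤ n * (q * S) := by
      refine (Finset.sum_le_sum fun i _ => (hS.vec 0 le_rfl i).norm_le).trans (le_of_eq ?_)
      rw [Finset.sum_const]
      simp
    have h1 := hC r δ hr hrδ A (hA.isRoughCoeff le_rfl Metric.isOpen_ball) u g hu.grad
      (q ^ 2 * S) (n * (q * S)) (by positivity) (by positivity) fun v hv =>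
        (hu.abs_form_le v hv).trans (add_le_add
          (mul_le_mul_of_nonneg_right hS.scal (normLp_nonneg _ _ _))
          (mul_le_mul_of_nonneg_right hΦ (normL2Vec_nonneg _ _)))
    have h2 : normL2Vec (B n r) (fun x i => g i x) ^ 2 ≤ (√(C * (2 + n ^ 2)) * (q * S)) ^ 2 := by
      refine h1.trans ?_
      rw [mul_pow (√(C * (2 + (n : ℝ) ^ 2))), Real.sq_sqrt (by positivity), mul_assoc C]
      refine mul_le_mul_of_nonneg_left ?_ hC0.le
      have h3 : ((δ - r) ^ 2)⁻¹ = q ^ 2 := by rw [hq, inv_pow]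
      rw [h3]
      have h4 : normLp 2 (B n δ) u ≤ S := hS.sol
      have h5 := normLp_nonneg 2 (B n δ) u
      have h6 : normLp 2 (B n δ) u ^ 2 ≤ S ^ 2 := pow_le_pow_left₀ h5 h4 2
      have h7 : q ^ 2 * normLp 2 (B n δ) u ^ 2 ≤ q ^ 2 * S ^ 2 := by gcongr
      have h8 : q ^ 2 * S * normLp 2 (B n δ) u ≤ q ^ 2 * S * S := by gcongr
      nlinarith
    have h3 := (normLp_le_normL2Vec (U := B n r) (fun x i => g i x) m).trans
      ((le_abs_self _).trans (abs_le_of_sq_le_sq h2 (by positivity)))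
    refine h3.trans ?_
    rw [pow_one]
    refine mul_le_mul_of_nonneg_right ?_ (by positivity)
    linarith [abs_nonneg R₀]
  interval_cases i
  · exact hbase
  · exact ⟨⟨huρ.memLp, hu1⟩, fun m => ⟨g m, huρ.part m, (huρ.part m).memLp', hgrad m⟩⟩

/-- The gap is halved. On the outer half the inductive hypothesis bounds `u` up to order `j`, and
second derivatives exist; on the inner half the inductive hypothesis is applied to each `∂ₗu`, with
`S` replaced by a multiple of `pS`. Among the new data, only `∂ₗA ∇u` has one factor `p` too few,
since its derivative fell on `A` and not on the solution; `1 ≤ |R₀|p` supplies it. -/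
theorem InteriorRegularity.succ {n : ℕ} {R₀ M η : ℝ} (hη : 0 < η) {j : ℕ} (hj : 1 ≤ j)
    (hreg : InteriorRegularity n R₀ M η j) : InteriorRegularity n R₀ M η (j + 1) := by
  obtain ⟨C, hC1, hC⟩ := hreg
  have hC0 : 0 ≤ C := zero_le_one.trans hC1
  -- The factor in the data size `C2 * (p * S)` for `∂ₗu`: `C` bounds `∂ₗu` itself, `2` counts the
  -- contributions of `∂ₗΦ` and `φ`, and the last summand bounds the `n` products from `∂ₗA ∇u`,
  -- with `2 ^ j` from the Leibniz rule.
  set C2 : ℝ := C + (2 + n * (2 ^ j * |M| * (C * |R₀|))) with hC2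
  have hC2' : 0 ≤ C2 := by positivity
  -- In order: the bounds of order at most `j`; the norm of `u` measured against `q ^ (j + 1)`; the
  -- derivatives of `∂ₗu`, where `p = 2 * q` gives the power of two.
  refine ⟨C + |R₀| ^ (j + 1) + C * C2 * 2 ^ (j + 1), ?_, ?_⟩
  · have h1 : 0 ≤ |R₀| ^ (j + 1) := by positivity
    have h2 : 0 ≤ C * C2 * 2 ^ (j + 1) := by positivity
    linarith
  intro r δ hr hrδ hδR A hA u g φ Φ S hu hS i hi
  have hS0 := hS.nonneg
  have hε : 0 < δ - r := sub_pos.2 hrδ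
  set q := (δ - r)⁻¹ with hq
  have hq0 : 0 < q := inv_pos.2 hε
  have hconst : C ≤ C + |R₀| ^ (j + 1) + C * C2 * 2 ^ (j + 1) := by
    have h1 : 0 ≤ |R₀| ^ (j + 1) := by positivity
    have h2 : 0 ≤ C * C2 * 2 ^ (j + 1) := by positivity
    linarith
  rcases Nat.lt_or_ge i (j + 1) with hij | hij
  · refine (hC r δ hr hrδ hδR A (hA.mono_order (Nat.le_succ j)) u g φ Φ S hu
      (hS.mono hq0.le le_rfl (Nat.le_succ j)) i (by omega)).mono_const ?_
    exact mul_le_mul_of_nonneg_right hconst (by positivity)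
  obtain rfl : i = j + 1 := le_antisymm hi hij
  set ρ := (r + δ) / 2 with hρ
  have hrρ : r < ρ := by rw [hρ]; linarith
  have hρδ : ρ < δ := by rw [hρ]; linarith
  have hρ0 : 0 < ρ := hr.trans hrρ
  set p := (δ - ρ)⁻¹ with hp
  have hpq : p = 2 * q := by
    rw [hp, hq, hρ, show δ - (r + δ) / 2 = (δ - r) / 2 by ring, inv_div, div_eq_mul_inv]
  have hp' : (ρ - r)⁻¹ = p := by
    rw [hp, hρ]
    congr 1
    ring
  have hp0 : 0 < p := by rw [hpq]; positivity
  have hqp : q ≤ p := by rw [hpq]; linarith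
  have hpR : 1 ≤ |R₀| * p := by
    have h1 : 1 ≤ |R₀| * q := by
      rw [hq, ← div_eq_mul_inv, one_le_div hε]
      exact (by linarith : δ - r ≤ R₀).trans (le_abs_self _)
    exact h1.trans (mul_le_mul_of_nonneg_left hqp (abs_nonneg _))
  have hsub := ball_subset_ball' (n := n) hρδ.le
  have hsubr := ball_subset_ball' (n := n) hrδ.le
  have hOδ : IsOpen (B n δ) := Metric.isOpen_ball
  have hOρ : IsOpen (B n ρ) := Metric.isOpen_ball
  have huρ := hu.grad.mono hsub
  have hA1 : IsCoeff (B n δ) 1 M η A := hA.mono_order (by omega)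
  have hSp := hS.mono hq0.le hqp le_rfl
  -- bounds for the solution on the intermediate ball
  have hub : ∀ i ≤ j, HasSobolevBound (B n ρ) i u (C * (p ^ i * S)) :=
    hC ρ δ hρ0 hρδ hδR A (hA.mono_order (Nat.le_succ j)) u g φ Φ S hu
      (hSp.mono hp0.le le_rfl (Nat.le_succ j))
  -- second derivatives
  choose dΦ hdΦ hdΦ1 using fun m => (hS.vec 1 (by omega) m).hasWeakGrad
  choose g2 hg2 using fun m l =>
    hu.exists_second_deriv hη hρ0 hρδ hA1 hdΦ m l
  have hg2' : ∀ m, HasWeakGrad (B n ρ) (g m) (g2 m) := fun m =>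
    ⟨(huρ.part m).memLp', hg2 m⟩
  have key : ∀ l, HasSobolevBound (B n r) j (g l) (C * (p ^ j * (C2 * (p * S)))) := by
    intro l
    have hM : 0 ≤ M := (abs_nonneg _).trans
      ((hA.bdd l l).bound 0 (Metric.mem_ball_self (hr.trans hrδ)))
    have hsolve := hu.deriv hρ0 hρδ hA1 l (fun m => (hdΦ m).part l) hg2'
    have hgb : ∀ i, i + 1 ≤ j → ∀ m, HasSobolevBound (B n ρ) i (g m) (C * (p ^ (i + 1) * S)) :=
      fun i hi m => (hub (i + 1) hi).of_hasWeakPartial hOρ (huρ.part m)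
    have hdata : DataBound (B n ρ) j (ρ - r)⁻¹ (C2 * (p * S)) (g l) (fun _ => 0)
        (fun m x => dΦ m l x + (-1) * ((if m = l then φ x else 0) +
          ∑ q, pderiv l (fun y => A y m q) x * g q x)) := by
      rw [hp']
      refine ⟨?_, ?_, fun i _ => hasSobolevBound_zero (by positivity) i, fun i hi m => ?_⟩
      · refine (hgb 0 hj l).norm_le.trans ?_
        rw [zero_add, pow_one]
        refine mul_le_mul_of_nonneg_right ?_ (by positivity)
        rw [hC2]
        exact le_add_of_nonneg_right (by positivity)
      · rw [normLp_zero]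
        positivity
      · have h1 : HasSobolevBound (B n ρ) i (dΦ m l) (p ^ (i + 2) * S) :=
          ((hSp.vec (i + 1) (by omega) m).of_hasWeakPartial hOδ ((hdΦ m).part l)).mono_set hsub
        have h2 : HasSobolevBound (B n ρ) i (fun x => if m = l then φ x else 0)
            (p ^ (i + 2) * S) := by
          by_cases hml : m = l
          · simpa [hml] using (hSp.scal' i (by omega)).mono_set hsub
          · simpa [hml] using hasSobolevBound_zero (by positivity) i
        have h3 : HasSobolevBound (B n ρ) i
            (fun x => ∑ q, pderiv l (fun y => A y m q) x * g q x)
            (n * (2 ^ i * M * (C * (p ^ (i + 1) * S)))) := by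
          have := HasSobolevBound.sum (U := B n ρ) (m := i)
            (F := fun q x => pderiv l (fun y => A y m q) x * g q x) Finset.univ fun q _ =>
            HasSobolevBound.mul_boundedDerivs hρ0 hM
              (((((hA.bdd m q).2 l).2).mono_order (by omega)).mono_set hsub)
              (((hA1.bdd m q).aestronglyMeasurable_pderiv (i := l) hOδ).mono_measure
                (Measure.restrict_mono hsub le_rfl)) (hgb i hi q)
          simpa using this
        refine (h1.add (h2.add h3).neg).mono_const ?_
        have h4 : (2 : ℝ) ^ i ≤ 2 ^ j := pow_le_pow_right₀ one_le_two (by omega)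
        have h5 : p ^ (i + 1) * S ≤ |R₀| * p * (p ^ (i + 1) * S) :=
          le_mul_of_one_le_left (by positivity) hpR
        have h6 : n * (2 ^ i * M * (C * (p ^ (i + 1) * S))) ≤
            n * (2 ^ j * M * (C * (|R₀| * p * (p ^ (i + 1) * S)))) := by gcongr
        have h7 : p ^ (i + 1) * (C2 * (p * S)) = C * (p ^ (i + 2) * S) + (2 * (p ^ (i + 2) * S) +
            n * (2 ^ j * M * (C * (|R₀| * p * (p ^ (i + 1) * S))))) := by
          rw [hC2, abs_of_nonneg hM]
          ring
        have h8 : 0 ≤ C * (p ^ (i + 2) * S) := by positivity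
        rw [h7]
        linarith
    have := hC r ρ hr hrρ (hρδ.le.trans hδR) A ((hA.mono hsub).mono_order (Nat.le_succ j)) _ _ _ _ _
      hsolve hdata j le_rfl
    rwa [hp'] at this
  have hfinal : ∀ x, x ≤ C * (p ^ j * (C2 * (p * S))) →
      x ≤ (C + |R₀| ^ (j + 1) + C * C2 * 2 ^ (j + 1)) * (q ^ (j + 1) * S) := by
    intro x hx
    refine hx.trans ?_
    have h1 : C * (p ^ j * (C2 * (p * S))) = C * C2 * 2 ^ (j + 1) * (q ^ (j + 1) * S) := by
      rw [hpq]
      ring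
    rw [h1]
    refine mul_le_mul_of_nonneg_right ?_ (by positivity)
    have h2 : 0 ≤ |R₀| ^ (j + 1) := by positivity
    linarith
  refine ⟨⟨(hu.grad.mono hsubr).memLp, ?_⟩, fun l => ⟨g l, (hu.grad.mono hsubr).part l,
    (key l).mono_const (hfinal _ le_rfl)⟩⟩
  refine ((normLp_mono_set hu.grad.memLp hsubr).trans hS.sol).trans ?_
  have h1 : 1 ≤ |R₀| * q := by
    rw [hq, ← div_eq_mul_inv, one_le_div hε]
    exact (by linarith : δ - r ≤ R₀).trans (le_abs_self _)
  have h2 : S ≤ (|R₀| * q) ^ (j + 1) * S := le_mul_of_one_le_left hS0 (one_le_pow₀ h1)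
  refine h2.trans ?_
  rw [mul_pow, mul_assoc]
  refine mul_le_mul_of_nonneg_right ?_ (by positivity)
  have h3 : 0 ≤ C * C2 * 2 ^ (j + 1) := by positivity
  linarith

theorem interiorRegularity (n : ℕ) (R₀ M η : ℝ) (hη : 0 < η) {j : ℕ} (hj : 1 ≤ j) :
    InteriorRegularity n R₀ M η j := by
  induction j, hj using Nat.le_induction with
  | base => exact interiorRegularity_one n R₀ M η hη
  | succ j hj ih => exact ih.succ hη hj

end HigherRegularity

/-! ### Multi-index derivatives -/

section MultiIndex
variable {n : ℕ} {U V : Set (E n)} {f g φ : E n → ℝ} {α : Fin n → ℕ} {i : Fin n} {m : ℕ} {K : ℝ}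

theorem IsTestFun.iterate_pderiv (h : IsTestFun U φ) (i : Fin n) (k : ℕ) :
    IsTestFun U ((InteriorElliptic.pderiv i)^[k] φ) := by
  induction k with
  | zero => exact h
  | succ k ih =>
    rw [Function.iterate_succ_apply']
    exact ih.pderiv

theorem pderiv_iterate_pderiv (h : IsTestFun U φ) (i j : Fin n) (k : ℕ) :
    pderiv i ((pderiv j)^[k] φ) = (pderiv j)^[k] (pderiv i φ) := by
  induction k with
  | zero => rfl
  | succ k ih =>
    rw [Function.iterate_succ_apply', Function.iterate_succ_apply',
      pderiv_comm (h.iterate_pderiv j k).smooth, ih]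

/-- Iterated partial derivatives along a list of directions. -/
noncomputable def listDeriv (l : List (Fin n)) (α : Fin n → ℕ) (f : E n → ℝ) : E n → ℝ :=
  l.foldr (fun i g => (pderiv i)^[α i] g) f

theorem IsTestFun.listDeriv (h : IsTestFun U φ) (l : List (Fin n)) (α : Fin n → ℕ) :
    IsTestFun U (listDeriv l α φ) := by
  induction l with
  | nil => exact h
  | cons a l ih => exact ih.iterate_pderiv a (α a)

theorem pderiv_listDeriv (h : IsTestFun U φ) (l : List (Fin n)) (α : Fin n → ℕ) (i : Fin n) :
    pderiv i (listDeriv l α φ) = listDeriv l α (pderiv i φ) := by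
  induction l with
  | nil => rfl
  | cons a l ih =>
    have e : ∀ ψ, listDeriv (a :: l) α ψ = (pderiv a)^[α a] (listDeriv l α ψ) := fun _ => rfl
    rw [e, e, pderiv_iterate_pderiv (h.listDeriv l α), ih]

/-- The extra derivative commutes inwards past all the others. Without repetitions in the list, the
direction `i` is met at most once, so exactly one extra derivative appears. -/
theorem listDeriv_add_single (h : IsTestFun U φ) (α : Fin n → ℕ) (i : Fin n) :
    ∀ l : List (Fin n), l.Nodup → listDeriv l (α + Pi.single i 1) φ =
      if i ∈ l then listDeriv l α (pderiv i φ) else listDeriv l α φ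
  | [], _ => by simp [listDeriv]
  | a :: l, hl => by
    have e : ∀ β ψ, listDeriv (a :: l) β ψ = (pderiv a)^[β a] (listDeriv l β ψ) := fun _ _ => rfl
    have ih := listDeriv_add_single h α i l (List.nodup_cons.1 hl).2
    rw [e, e, e, ih]
    by_cases hia : i = a
    · subst hia
      rw [if_neg (List.nodup_cons.1 hl).1, if_pos List.mem_cons_self]
      simp only [Pi.add_apply, Pi.single_eq_same, Function.iterate_succ_apply]
      rw [pderiv_listDeriv h]
    · have : (α + Pi.single i 1 : Fin n → ℕ) a = α a := by simp [Ne.symm hia]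
      rw [this]
      by_cases hil : i ∈ l
      · rw [if_pos hil, if_pos (List.mem_cons_of_mem a hil)]
      · rw [if_neg hil, if_neg (by simp [hia, hil])]

theorem IsTestFun.multiDeriv (h : IsTestFun U φ) (α : Fin n → ℕ) : IsTestFun U (multiDeriv α φ) :=
  h.listDeriv _ α

theorem pderiv_multiDeriv (h : IsTestFun U φ) (α : Fin n → ℕ) (i : Fin n) :
    pderiv i (multiDeriv α φ) = multiDeriv α (pderiv i φ) :=
  pderiv_listDeriv h _ α i

theorem multiDeriv_add_single (h : IsTestFun U φ) (α : Fin n → ℕ) (i : Fin n) :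
    multiDeriv (α + Pi.single i 1) φ = multiDeriv α (pderiv i φ) := by
  have := listDeriv_add_single h α i _ (List.nodup_finRange n)
  rwa [if_pos (List.mem_finRange i)] at this

theorem multiDeriv_zero (f : E n → ℝ) : multiDeriv 0 f = f := by
  unfold multiDeriv
  induction List.finRange n with
  | nil => rfl
  | cons a l ih => simp

theorem locallyIntegrableOn_of_memLp (hf : MemLp f 2 (volume.restrict U)) :
    LocallyIntegrableOn f U :=
  locallyIntegrableOn_of_locallyIntegrable_restrict (hf.locallyIntegrable (by norm_num))

theorem sum_add_single (α : Fin n → ℕ) (i : Fin n) :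
    ∑ j, (α + Pi.single i 1 : Fin n → ℕ) j = (∑ j, α j) + 1 := by
  simp [Finset.sum_add_distrib]

theorem hasWeakDeriv_zero (hf : MemLp f 2 (volume.restrict U)) : HasWeakDeriv U 0 f f where
  locInt := locallyIntegrableOn_of_memLp hf
  locInt' := locallyIntegrableOn_of_memLp hf
  eq := fun φ _ => by simp [multiDeriv_zero]

theorem HasWeakPartial.hasWeakDeriv_add_single (hf : HasWeakPartial U i f g) {w : E n → ℝ}
    (hw : HasWeakDeriv U α g w) : HasWeakDeriv U (α + Pi.single i 1) f w where
  locInt := locallyIntegrableOn_of_memLp hf.memLp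
  locInt' := hw.locInt'
  eq := fun φ hφ => by
    rw [multiDeriv_add_single hφ, ← pderiv_multiDeriv hφ, hf.eq _ (hφ.multiDeriv α), hw.eq φ hφ,
      sum_add_single]
    ring

/-- Both weak derivatives are defined by testing `f`. Using `∂ᵢφ` in the identity for `α` gives the
same left side as `φ` in the identity for `α + eᵢ`, and the common sign is cancelled. -/
theorem HasWeakDeriv.hasWeakPartial {w : E n → ℝ} (hg : HasWeakDeriv U α f g)
    (hw : HasWeakDeriv U (α + Pi.single i 1) f w) (hgm : MemLp g 2 (volume.restrict U))
    (hwm : MemLp w 2 (volume.restrict U)) : HasWeakPartial U i g w where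
  memLp := hgm
  memLp' := hwm
  eq := fun φ hφ => by
    have h1 := hg.eq _ (hφ.pderiv (i := i))
    have h2 := hw.eq φ hφ
    rw [multiDeriv_add_single hφ, sum_add_single] at h2
    rw [h2, pow_succ] at h1
    have h3 : ((-1 : ℝ) ^ (∑ j, α j)) ≠ 0 := pow_ne_zero _ (by norm_num)
    have h4 : (-1 : ℝ) ^ (∑ j, α j) * -(∫ x in U, w x * φ x) =
        (-1) ^ (∑ j, α j) * ∫ x in U, g x * pderiv i φ x := by linarith
    exact (mul_left_cancel₀ h3 h4).symm

theorem HasWeakDeriv.ae_eq (hU : IsOpen U) {g' : E n → ℝ} (h : HasWeakDeriv U α f g)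
    (h' : HasWeakDeriv U α f g') : g =ᵐ[volume.restrict U] g' := by
  have hint : ∀ {w φ : E n → ℝ}, LocallyIntegrableOn w U → IsTestFun U φ →
      IntegrableOn (fun x => w x * φ x) U := fun {w φ} hw hφ => by
    have h1 : IntegrableOn (fun x => w x * φ x) (tsupport φ) :=
      (hw.integrableOn_compact_subset hφ.supp hφ.compact).mul_continuousOn
        hφ.continuous.continuousOn hφ.compact
    have h2 : Integrable (fun x => w x * φ x) := by
      rwa [integrableOn_iff_integrable_of_support_subset] at h1
      intro x hx
      exact subset_tsupport _ fun h0 => hx (by simp [h0])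
    exact h2.integrableOn
  have := hU.ae_eq_zero_of_integral_contDiff_smul_eq_zero (h.locInt'.sub h'.locInt')
    fun φ h1 h2 h3 => by
      have hφ : IsTestFun U φ := ⟨h1, h2, h3⟩
      have : ∫ x in U, (g x - g' x) * φ x = 0 := by
        simp only [sub_mul]
        rw [integral_sub (hint h.locInt' hφ) (hint h'.locInt' hφ)]
        have h3 : ((-1 : ℝ) ^ (∑ j, α j)) ≠ 0 := pow_ne_zero _ (by norm_num)
        rw [sub_eq_zero]
        exact mul_left_cancel₀ h3 ((h.eq φ hφ).symm.trans (h'.eq φ hφ))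
      rw [hφ.setIntegral_eq_integral] at this
      simpa only [smul_eq_mul, mul_comm, Pi.sub_apply] using this
  refine (ae_restrict_iff' hU.measurableSet).2 ?_
  filter_upwards [this] with x hx hxU
  simpa [sub_eq_zero] using hx hxU

theorem HasWeakDeriv.weakDeriv (h : HasWeakDeriv U α f g) :
    HasWeakDeriv U α f (weakDeriv U α f) := by
  have hex : ∃ g, HasWeakDeriv U α f g := ⟨g, h⟩
  rw [InteriorElliptic.weakDeriv, dif_pos hex]
  exact hex.choose_spec

theorem HasWeakDeriv.weakDeriv_ae (hU : IsOpen U) (h : HasWeakDeriv U α f g) :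
    InteriorElliptic.weakDeriv U α f =ᵐ[volume.restrict U] g :=
  h.weakDeriv.ae_eq hU h

theorem exists_eq_add_single (hα : ∑ i, α i ≠ 0) :
    ∃ (β : Fin n → ℕ) (i : Fin n), α = β + Pi.single i 1 := by
  obtain ⟨i, -, hi⟩ := Finset.exists_ne_zero_of_sum_ne_zero hα
  refine ⟨α - Pi.single i 1, i, (tsub_add_cancel_of_le fun j => ?_).symm⟩
  by_cases hj : j = i
  · subst hj
    simpa using Nat.one_le_iff_ne_zero.2 hi
  · simp [hj]

theorem HasSobolevBound.exists_hasWeakDeriv : ∀ {m : ℕ} {f : E n → ℝ} {α : Fin n → ℕ},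
    HasSobolevBound U m f K → ∑ i, α i ≤ m →
    ∃ g, HasWeakDeriv U α f g ∧ MemLp g 2 (volume.restrict U) ∧ normLp 2 U g ≤ K := by
  intro m
  induction m with
  | zero =>
    intro f α h hα
    have : α = 0 := funext fun i =>
      (Finset.sum_eq_zero_iff.1 (Nat.le_zero.1 hα)) i (Finset.mem_univ i)
    subst this
    exact ⟨f, hasWeakDeriv_zero h.1, h.1, h.2⟩
  | succ m ih =>
    intro f α h hα
    by_cases h0 : ∑ i, α i = 0
    · have : α = 0 := funext fun i => (Finset.sum_eq_zero_iff.1 h0) i (Finset.mem_univ i)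
      subst this
      exact ⟨f, hasWeakDeriv_zero h.memLp, h.memLp, h.norm_le⟩
    · obtain ⟨β, i, rfl⟩ := exists_eq_add_single h0
      rw [sum_add_single] at hα
      obtain ⟨g, hg, hgb⟩ := h.2 i
      obtain ⟨w, hw, hwm, hwn⟩ := ih hgb (Nat.le_of_succ_le_succ hα)
      exact ⟨w, hg.hasWeakDeriv_add_single hw, hwm, hwn⟩

theorem HasSobolevBound.memH (h : HasSobolevBound U m f K) : MemH m U f :=
  ⟨h.memLp, fun _ hα =>
    let ⟨g, h1, h2, _⟩ := h.exists_hasWeakDeriv hα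
    ⟨g, h1, h2⟩⟩

theorem HasSobolevBound.normLp_weakDeriv_le (hU : IsOpen U) (h : HasSobolevBound U m f K)
    (hα : ∑ i, α i ≤ m) : normLp 2 U (weakDeriv U α f) ≤ K := by
  obtain ⟨g, h1, -, h2⟩ := h.exists_hasWeakDeriv hα
  exact (normLp_congr_ae (h1.weakDeriv_ae hU) 2).le.trans h2

theorem HasSobolevBound.normH_le (hU : IsOpen U) (h : HasSobolevBound U m f K) :
    normH m U f ≤ √(∑ j ∈ Finset.range (m + 1),
      ((Finset.piAntidiag (Finset.univ : Finset (Fin n)) j).card : ℝ)) * K := by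
  rw [← Real.sqrt_sq h.nonneg, ← Real.sqrt_mul (by positivity), normH, Finset.sum_mul]
  refine Real.sqrt_le_sqrt (Finset.sum_le_sum fun j hj => ?_)
  rw [← nsmul_eq_mul]
  refine Finset.sum_le_card_nsmul _ _ _ fun α hα => ?_
  have hsum : ∑ i, α i ≤ m := by
    rw [(Finset.mem_piAntidiag.1 hα).1]
    exact Nat.le_of_lt_succ (Finset.mem_range.1 hj)
  exact pow_le_pow_left₀ (normLp_nonneg _ _ _) (h.normLp_weakDeriv_le hU hsum) 2

theorem MemH.mono {l : ℕ} (h : MemH m U f) (hl : l ≤ m) : MemH l U f :=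
  ⟨h.1, fun α hα => h.2 α (hα.trans hl)⟩

theorem normLp_weakDeriv_le_normH (hα : ∑ i, α i ≤ m) :
    normLp 2 U (weakDeriv U α f) ≤ normH m U f := by
  refine Real.le_sqrt_of_sq_le ?_
  have h1 : normLp 2 U (weakDeriv U α f) ^ 2 ≤
      ∑ β ∈ Finset.piAntidiag (Finset.univ : Finset (Fin n)) (∑ i, α i),
        normLp 2 U (weakDeriv U β f) ^ 2 :=
    Finset.single_le_sum (f := fun β => normLp 2 U (weakDeriv U β f) ^ 2)
      (fun _ _ => sq_nonneg _) (Finset.mem_piAntidiag.2 ⟨rfl, fun i _ => Finset.mem_univ i⟩)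
  exact h1.trans (Finset.single_le_sum
    (f := fun j => ∑ β ∈ Finset.piAntidiag (Finset.univ : Finset (Fin n)) j,
      normLp 2 U (weakDeriv U β f) ^ 2)
    (fun _ _ => Finset.sum_nonneg fun _ _ => sq_nonneg _)
    (Finset.mem_range.2 (Nat.lt_succ_of_le hα)))

/-- `MemH` speaks of derivatives of `f` only, the recursive bound of derivatives of derivatives. The
induction therefore runs over all `D^α f` at once, with `d` derivatives still to be taken and `|α| +
d ≤ m`. -/
theorem MemH.hasSobolevBound (hU : IsOpen U) (h : MemH m U f) :
    HasSobolevBound U m f (normH m U f) := by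
  have key : ∀ (d : ℕ) (α : Fin n → ℕ) (g : E n → ℝ), HasWeakDeriv U α f g → ∑ i, α i + d ≤ m →
      HasSobolevBound U d g (normH m U f) := by
    intro d
    induction d with
    | zero =>
      intro α g hg hα
      obtain ⟨g', h1, h2⟩ := h.2 α hα
      refine ⟨h2.ae_eq (h1.ae_eq hU hg), ?_⟩
      rw [← normLp_congr_ae (hg.weakDeriv_ae hU) 2]
      exact normLp_weakDeriv_le_normH hα
    | succ d ih =>
      intro α g hg hα
      have h0 : ∀ (β : Fin n → ℕ) (w : E n → ℝ), HasWeakDeriv U β f w → ∑ i, β i ≤ m →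
          MemLp w 2 (volume.restrict U) ∧ normLp 2 U w ≤ normH m U f := by
        intro β w hw hβ
        obtain ⟨g', h1, h2⟩ := h.2 β hβ
        refine ⟨h2.ae_eq (h1.ae_eq hU hw), ?_⟩
        rw [← normLp_congr_ae (hw.weakDeriv_ae hU) 2]
        exact normLp_weakDeriv_le_normH hβ
      refine ⟨h0 α g hg (by omega), fun i => ?_⟩
      have hα' : ∑ j, (α + Pi.single i 1 : Fin n → ℕ) j ≤ m := by rw [sum_add_single]; omega
      obtain ⟨w, hw, -⟩ := h.2 _ hα'
      exact ⟨w, hg.hasWeakPartial hw (h0 α g hg (by omega)).1 (h0 _ w hw hα').1,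
        ih _ w hw (by rw [sum_add_single]; omega)⟩
  exact key m 0 f (hasWeakDeriv_zero h.1) (by simp)

end MultiIndex

/-! ### `H¹` and `H¹₀` in terms of weak gradients -/

section Bridge
variable {n : ℕ} {U V : Set (E n)} {u v : E n → ℝ} {g w : Fin n → E n → ℝ}

theorem HasWeakPartial.hasWeakDeriv {i : Fin n} {f f' : E n → ℝ} (h : HasWeakPartial U i f f') :
    HasWeakDeriv U (Pi.single i 1) f f' := by
  simpa using h.hasWeakDeriv_add_single (hasWeakDeriv_zero h.memLp')

theorem HasWeakGrad.weakGrad_ae (hU : IsOpen U) (h : HasWeakGrad U v w) (i : Fin n) :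
    (fun x => weakGrad U v x i) =ᵐ[volume.restrict U] w i :=
  (h.part i).hasWeakDeriv.weakDeriv_ae hU

theorem HasWeakGrad.normL2Vec_weakGrad (hU : IsOpen U) (h : HasWeakGrad U v w) :
    normL2Vec U (weakGrad U v) = normL2Vec U (fun x i => w i x) := by
  rw [normL2Vec, normL2Vec]
  congr 1
  exact Finset.sum_congr rfl fun i _ => by rw [normLp_congr_ae (h.weakGrad_ae hU i) 2]

theorem MemH.hasWeakGrad (hU : IsOpen U) (h : MemH 1 U u) :
    HasWeakGrad U u (fun i x => weakGrad U u x i) := by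
  refine ⟨h.1, fun i => ?_⟩
  obtain ⟨g', h1, h2⟩ := h.2 (Pi.single i 1) (by simp)
  have hp : HasWeakPartial U i u g' :=
    HasWeakDeriv.hasWeakPartial (hasWeakDeriv_zero h.1) (by simpa using h1) h.1 h2
  exact hp.congr ae_eq_rfl (h1.weakDeriv_ae hU).symm

theorem HasWeakGrad.hasSobolevBound_one (h : HasWeakGrad U v w) :
    HasSobolevBound U 1 v (normLp 2 U v + ∑ i, normLp 2 U (w i)) := by
  have h0 : ∀ i, 0 ≤ normLp 2 U (w i) := fun i => normLp_nonneg _ _ _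
  refine ⟨⟨h.memLp, le_add_of_nonneg_right (Finset.sum_nonneg fun i _ => h0 i)⟩, fun i =>
    ⟨w i, h.part i, (h.part i).memLp', ?_⟩⟩
  exact (Finset.single_le_sum (fun i _ => h0 i) (Finset.mem_univ i)).trans
    (le_add_of_nonneg_left (normLp_nonneg _ _ _))

/-- Compactly supported `H¹` functions belong to `H¹₀`. -/
theorem memH10_of_compact {K : Set (E n)} (hU : IsOpen U) (h : HasWeakGrad univ v w)
    (hK : IsCompact K) (hKU : K ⊆ U) (hvK : ∀ x ∉ K, v x = 0) : MemH10 U v := by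
  obtain ⟨φ, h1, h2, h3⟩ := exists_testFun_approx h hK hU hKU hvK
  have h' := h.mono (subset_univ U)
  refine ⟨h'.hasSobolevBound_one.memH, φ, h1, ?_⟩
  have hd : ∀ m, HasWeakGrad U (fun x => φ m x - v x) (fun i x => pderiv i (φ m) x - w i x) := by
    intro m
    refine ⟨((h1 m).memLp _ _).sub h'.memLp, fun i => ?_⟩
    have := ((h1 m).hasWeakPartial (U := U) (i := i)).add ((h'.part i).const_mul (-1))
    simpa only [neg_one_mul, ← sub_eq_add_neg] using this
  have hb := fun m => (hd m).hasSobolevBound_one.normH_le hU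
  have t0 : Tendsto (fun m => normLp 2 U (fun x => φ m x - v x) +
      ∑ i, normLp 2 U (fun x => pderiv i (φ m) x - w i x)) atTop (𝓝 0) := by
    have e1 : Tendsto (fun m => normLp 2 U (fun x => φ m x - v x)) atTop (𝓝 0) :=
      (ENNReal.tendsto_toReal ENNReal.zero_ne_top).comp
        (h2.mono_measure (Measure.restrict_le_self (s := U)))
    have e2 : ∀ i, Tendsto (fun m => normLp 2 U (fun x => pderiv i (φ m) x - w i x)) atTop (𝓝 0) :=
      fun i => (ENNReal.tendsto_toReal ENNReal.zero_ne_top).comp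
        ((h3 i).mono_measure (Measure.restrict_le_self (s := U)))
    simpa using e1.add (tendsto_finsetSum Finset.univ fun i _ => e2 i)
  have t1 := t0.const_mul (√(∑ j ∈ Finset.range (1 + 1),
      ((Finset.piAntidiag (Finset.univ : Finset (Fin n)) j).card : ℝ)))
  rw [mul_zero] at t1
  exact squeeze_zero (fun m => Real.sqrt_nonneg _) hb t1

theorem IsTestFun.memH10 {φ : E n → ℝ} (hU : IsOpen U) (hφ : IsTestFun U φ) : MemH10 U φ :=
  memH10_of_compact hU hφ.hasWeakGrad hφ.compact hφ.supp
    fun _ hx => image_eq_zero_of_notMem_tsupport hx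

/-- The weak formulation, tested with a compactly supported `H¹` function. -/
theorem IsWeakSol.sum_integral_eq {A : E n → Matrix (Fin n) (Fin n) ℝ} {F : (E n → ℝ) → ℝ} {k : ℕ}
    {M η : ℝ} {K : Set (E n)} (hU : IsOpen U) (hA : IsCoeff U k M η A) (hk : 1 ≤ k)
    (hu : IsWeakSol U A F u) (hg : HasWeakGrad U u g) (hVU : V ⊆ U)
    (h : HasWeakGrad univ v w) (hK : IsCompact K) (hKV : K ⊆ V) (hvK : ∀ x ∉ K, v x = 0)
    (hwK : ∀ i, ∀ x ∉ K, w i x = 0) :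
    ∑ i, ∫ x in V, w i x * flux A g i x = F (V.indicator v) := by
  -- `F` acts on functions rather than classes, so extension by zero is shown to be literally `v`.
  have hind : V.indicator v = v := indicator_eq_self.2 fun x hx => by
    by_contra hxV
    exact hx (hvK x fun hxK => hxV (hKV hxK))
  have h' := h.mono (subset_univ U)
  have hFm := (hA.isRoughCoeff hk hU).memLp_flux hU.measurableSet fun i => (hg.part i).memLp'
  rw [hind, ← hu.eq v (memH10_of_compact hU h hK (hKV.trans hVU) hvK)]
  have e1 : ∀ i, ∫ x in V, w i x * flux A g i x = ∫ x in U, w i x * flux A g i x := fun i => by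
    rw [setIntegral_eq_integral_of_forall_compl_eq_zero (s := V),
      setIntegral_eq_integral_of_forall_compl_eq_zero (s := U)]
    · intro x hx; simp [hwK i x fun hxK => hx (hVU (hKV hxK))]
    · intro x hx; simp [hwK i x fun hxK => hx (hKV hxK)]
  simp only [e1]
  rw [← integral_finsetSum _ fun i _ => integrable_mul_of_memLp_two (h'.part i).memLp' (hFm i)]
  refine integral_congr_ae ?_
  have a1 : ∀ᵐ x ∂(volume.restrict U), ∀ i, weakGrad U u x i = g i x :=
    ae_all_iff.2 fun i => hg.weakGrad_ae hU i
  have a2 : ∀ᵐ x ∂(volume.restrict U), ∀ i, weakGrad U v x i = w i x :=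
    ae_all_iff.2 fun i => h'.weakGrad_ae hU i
  filter_upwards [a1, a2] with x h1 h2
  simp only [dotProduct, Matrix.mulVec, flux, h1, h2, mul_comm (w _ x)]

end Bridge

/-! ### The energy and regularity estimates -/

section Estimates
variable {n : ℕ}

theorem IsWeakSol.test_eq {A : E n → Matrix (Fin n) (Fin n) ℝ} {F : (E n → ℝ) → ℝ} {u : E n → ℝ}
    {g : Fin n → E n → ℝ} {k : ℕ} {M η δ R₀ : ℝ} (hA : IsCoeff (B n R₀) k M η A) (hk : 1 ≤ k)
    (hu : IsWeakSol (B n R₀) A F u) (hg : HasWeakGrad (B n R₀) u g) (hδ : δ ≤ R₀) {v : E n → ℝ}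
    (hv : IsTestFun (B n δ) v) :
    ∑ i, ∫ x in B n δ, pderiv i v x * flux A g i x = F ((B n δ).indicator v) :=
  hu.sum_integral_eq Metric.isOpen_ball hA hk hg (ball_subset_ball' hδ)
    hv.hasWeakGrad hv.compact hv.supp (fun _ hx => image_eq_zero_of_notMem_tsupport hx)
    fun _ _ hx => image_eq_zero_of_notMem_tsupport fun h =>
      hx (tsupport_pderiv_subset hv.smooth h)

theorem energy_estimate (n : ℕ) (R₀ M η : ℝ) (hη : 0 < η) : ∃ C : ℝ, 0 < C ∧
    ∀ k : ℕ, 1 ≤ k →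
    ∀ (A : E n → Matrix (Fin n) (Fin n) ℝ) (F : (E n → ℝ) → ℝ) (u : E n → ℝ),
      IsCoeff (B n R₀) k M η A → IsWeakSol (B n R₀) A F u →
    ∀ r δ : ℝ, 0 < r → r < δ → δ ≤ R₀ → ∀ a b : ℝ, 0 ≤ a → 0 ≤ b →
      (∀ v, MemH10 (B n δ) v → |F ((B n δ).indicator v)| ≤
        a * normLp 2 (B n δ) v + b * normL2Vec (B n δ) (weakGrad (B n δ) v)) →
      normL2Vec (B n r) (weakGrad (B n r) u) ^ 2 ≤
        C * (((δ - r) ^ 2)⁻¹ * normLp 2 (B n δ) u ^ 2 + a * normLp 2 (B n δ) u + b ^ 2) := by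
  obtain ⟨C, hC0, hC⟩ := caccioppoli n M η hη
  refine ⟨C, hC0, fun k hk A F u hA hu r δ hr hrδ hδ a b ha hb h => ?_⟩
  have hg := hu.mem.hasWeakGrad Metric.isOpen_ball
  have hsub := ball_subset_ball' (n := n) hδ
  have hOδ : IsOpen (B n δ) := Metric.isOpen_ball
  rw [((hg.mono hsub).mono (ball_subset_ball' hrδ.le)).normL2Vec_weakGrad Metric.isOpen_ball]
  refine hC r δ hr hrδ A ((hA.mono hsub).isRoughCoeff hk hOδ) u _ (hg.mono hsub) a b ha hb
    fun v hv => ?_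
  rw [hu.test_eq hA hk hg hδ hv]
  have := h v (hv.memH10 hOδ)
  rwa [(hv.hasWeakGrad (U := B n δ)).normL2Vec_weakGrad hOδ] at this

theorem IsWeakSol.solvesDiv {A : E n → Matrix (Fin n) (Fin n) ℝ} {F : (E n → ℝ) → ℝ} {u : E n → ℝ}
    {g : Fin n → E n → ℝ} {k : ℕ} {M η δ R₀ : ℝ} (hA : IsCoeff (B n R₀) k M η A) (hk : 1 ≤ k)
    (hu : IsWeakSol (B n R₀) A F u) (hg : HasWeakGrad (B n R₀) u g) (hδ : δ ≤ R₀) {φ : E n → ℝ}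
    {Φ : E n → Fin n → ℝ} (hφ : MemLp φ 2 (volume.restrict (B n δ)))
    (hΦ : ∀ i, MemLp (fun x => Φ x i) 2 (volume.restrict (B n δ)))
    (h : ∀ v, MemH10 (B n δ) v → F ((B n δ).indicator v) =
      ∫ x in B n δ, (φ x * v x + Φ x ⬝ᵥ weakGrad (B n δ) v x)) :
    SolvesDiv (B n δ) A u g φ (fun i x => Φ x i) where
  grad := hg.mono (ball_subset_ball' hδ)
  memLp := hφ
  memLp' := hΦ
  eq := fun v hv => by
    have hOδ : IsOpen (B n δ) := Metric.isOpen_ball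
    rw [hu.test_eq hA hk hg hδ hv, h v (hv.memH10 hOδ)]
    have i2 : ∀ i, Integrable (fun x => Φ x i * pderiv i v x) (volume.restrict (B n δ)) := fun i =>
      integrable_mul_of_memLp_two (hΦ i) (hv.pderiv.memLp _ _)
    rw [← integral_finsetSum _ fun i _ => i2 i,
      ← integral_add (integrable_mul_of_memLp_two hφ (hv.memLp _ _))
        (integrable_finsetSum _ fun i _ => i2 i)]
    refine integral_congr_ae ?_
    have a2 : ∀ᵐ x ∂(volume.restrict (B n δ)), ∀ i, weakGrad (B n δ) v x i = pderiv i v x :=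
      ae_all_iff.2 fun i => hv.hasWeakGrad.weakGrad_ae hOδ i
    filter_upwards [a2] with x h2
    simp only [dotProduct, h2]

/-- The bracket on the right-hand side of the regularity estimate of order `j`. -/
noncomputable def dataNorm (δ ε : ℝ) (j : ℕ) (u φ : E n → ℝ) (Φ : E n → Fin n → ℝ) : ℝ :=
  normLp 2 (B n δ) u + ε ^ 2 * normLp 2 (B n δ) φ + ε * normL2Vec (B n δ) Φ +
    ∑ i ∈ Finset.Icc 1 (j - 1), ε ^ (i + 1) * (normH (i - 1) (B n δ) φ + normHVec i (B n δ) Φ)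

theorem normH_nonneg (m : ℕ) (U : Set (E n)) (f : E n → ℝ) : 0 ≤ normH m U f := Real.sqrt_nonneg _

theorem normHVec_nonneg (m : ℕ) (U : Set (E n)) (Φ : E n → Fin n → ℝ) : 0 ≤ normHVec m U Φ :=
  Real.sqrt_nonneg _

theorem normH_le_normHVec (m : ℕ) (U : Set (E n)) (Φ : E n → Fin n → ℝ) (i : Fin n) :
    normH m U (fun x => Φ x i) ≤ normHVec m U Φ := by
  refine Real.le_sqrt_of_sq_le ?_
  exact Finset.single_le_sum (f := fun i => normH m U (fun x => Φ x i) ^ 2)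
    (fun _ _ => sq_nonneg _) (Finset.mem_univ i)

/-- The bracket is built so that each of its nonnegative summands, divided by its power of `ε`, is
one of the data bounds with `q = ε⁻¹`. -/
theorem dataBound_dataNorm {δ ε : ℝ} (hε : 0 < ε) {j : ℕ} {u φ : E n → ℝ} {Φ : E n → Fin n → ℝ}
    (hφ : MemH (j - 2) (B n δ) φ) (hΦ : ∀ i, MemH (j - 1) (B n δ) (fun x => Φ x i)) :
    DataBound (B n δ) j ε⁻¹ (dataNorm δ ε j u φ Φ) u φ (fun i x => Φ x i) := by
  have hO : IsOpen (B n δ) := Metric.isOpen_ball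
  have h1 := normLp_nonneg 2 (B n δ) u
  have h2 : 0 ≤ ε ^ 2 * normLp 2 (B n δ) φ := mul_nonneg (by positivity) (normLp_nonneg _ _ _)
  have h3 : 0 ≤ ε * normL2Vec (B n δ) Φ := mul_nonneg hε.le (normL2Vec_nonneg _ _)
  have h4' : ∀ i ∈ Finset.Icc 1 (j - 1), 0 ≤ ε ^ (i + 1) *
      (normH (i - 1) (B n δ) φ + normHVec i (B n δ) Φ) := fun i _ =>
    mul_nonneg (by positivity) (add_nonneg (normH_nonneg _ _ _) (normHVec_nonneg _ _ _))
  have h4 := Finset.sum_nonneg h4'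
  have h5 : ∀ i ∈ Finset.Icc 1 (j - 1), ε ^ (i + 1) *
      (normH (i - 1) (B n δ) φ + normHVec i (B n δ) Φ) ≤ dataNorm δ ε j u φ Φ := fun i hi => by
    have := Finset.single_le_sum h4' hi
    unfold dataNorm
    linarith
  have hinv : ∀ (m : ℕ) (x : ℝ), ε ^ m * x ≤ dataNorm δ ε j u φ Φ →
      x ≤ ε⁻¹ ^ m * dataNorm δ ε j u φ Φ := fun m x hx => by
    rwa [inv_pow, ← div_eq_inv_mul, le_div_iff₀' (by positivity)]
  refine ⟨?_, hinv 2 _ ?_, fun i hi => ?_, fun i hi m => ?_⟩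
  · unfold dataNorm; linarith
  · unfold dataNorm; linarith
  · refine ((hφ.mono (by omega : i ≤ j - 2)).hasSobolevBound hO).mono_const (hinv _ _ ?_)
    -- The order `i` norm of `φ` occurs in the summand with index `i + 1`, whose weight is `ε ^ (i +
    -- 2)`.
    refine le_trans ?_ (h5 (i + 1) (Finset.mem_Icc.2 ⟨by omega, by omega⟩))
    rw [Nat.add_sub_cancel]
    exact mul_le_mul_of_nonneg_left (le_add_of_nonneg_right (normHVec_nonneg _ _ _)) (by positivity)
  · rcases Nat.eq_zero_or_pos i with rfl | hi0
    · refine ⟨(hΦ m).1, hinv _ _ ?_⟩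
      have : ε * normLp 2 (B n δ) (fun x => Φ x m) ≤ ε * normL2Vec (B n δ) Φ :=
        mul_le_mul_of_nonneg_left (normLp_le_normL2Vec Φ m) hε.le
      rw [zero_add, pow_one]
      unfold dataNorm
      linarith
    · refine (((hΦ m).mono (by omega : i ≤ j - 1)).hasSobolevBound hO).mono_const (hinv _ _ ?_)
      refine le_trans ?_ (h5 i (Finset.mem_Icc.2 ⟨hi0, by omega⟩))
      refine mul_le_mul_of_nonneg_left ?_ (by positivity)
      exact (normH_le_normHVec i _ Φ m).trans (le_add_of_nonneg_left (normH_nonneg _ _ _))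

theorem regularity_estimate (n : ℕ) (R₀ M η : ℝ) (hη : 0 < η) (k : ℕ) (hk : 1 ≤ k) :
    ∃ C : ℝ, 0 < C ∧
    ∀ (A : E n → Matrix (Fin n) (Fin n) ℝ) (F : (E n → ℝ) → ℝ) (u : E n → ℝ),
      IsCoeff (B n R₀) k M η A → IsWeakSol (B n R₀) A F u →
    ∀ r δ : ℝ, 0 < r → r < δ → δ ≤ R₀ → ∀ (φ : E n → ℝ) (Φ : E n → Fin n → ℝ),
      MemH (k - 2) (B n δ) φ → (∀ i, MemH (k - 1) (B n δ) (fun x => Φ x i)) →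
      (∀ v, MemH10 (B n δ) v → F ((B n δ).indicator v) =
        ∫ x in B n δ, (φ x * v x + Φ x ⬝ᵥ weakGrad (B n δ) v x)) →
      MemH k (B n r) u ∧ ∀ j ∈ Finset.Icc 1 k,
        ∑ α ∈ Finset.piAntidiag (Finset.univ : Finset (Fin n)) j,
          normLp 2 (B n r) (weakDeriv (B n r) α u) ≤
        C * ((δ - r) ^ j)⁻¹ * dataNorm δ (δ - r) j u φ Φ := by
  have hex : ∀ j : ℕ, ∃ C : ℝ, 1 ≤ C ∧ (1 ≤ j → ∀ r δ : ℝ, 0 < r → r < δ → δ ≤ R₀ →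
    ∀ A : E n → Matrix (Fin n) (Fin n) ℝ, IsCoeff (B n δ) j M η A →
    ∀ (u : E n → ℝ) (g : Fin n → E n → ℝ) (φ : E n → ℝ) (Φ : Fin n → E n → ℝ) (S : ℝ),
    SolvesDiv (B n δ) A u g φ Φ → DataBound (B n δ) j (δ - r)⁻¹ S u φ Φ →
    ∀ i ≤ j, HasSobolevBound (B n r) i u (C * ((δ - r)⁻¹ ^ i * S))) := fun j => by
    by_cases hj : 1 ≤ j
    · obtain ⟨C, h1, h2⟩ := interiorRegularity n R₀ M η hη hj
      exact ⟨C, h1, fun _ => h2⟩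
    -- A default constant for `j = 0`, so that a constant can be chosen for every `j`.
    · exact ⟨1, le_rfl, fun h => absurd h hj⟩
  choose C hC1 hC using hex
  set N : ℕ → ℝ := fun j => ((Finset.piAntidiag (Finset.univ : Finset (Fin n)) j).card : ℝ) with hN
  have hNC : ∀ j, 0 ≤ N j * C j := fun j =>
    mul_nonneg (Nat.cast_nonneg _) (zero_le_one.trans (hC1 j))
  -- The constant must not depend on `j`, so those of all orders up to `k` are added; `N j` counts
  -- the multi-indices of length `j`.
  refine ⟨1 + ∑ j ∈ Finset.Icc 1 k, N j * C j,
    add_pos_of_pos_of_nonneg one_pos (Finset.sum_nonneg fun j _ => hNC j), ?_⟩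
  intro A F u hA hu r δ hr hrδ hδ φ Φ hφ hΦ h
  have hε : 0 < δ - r := sub_pos.2 hrδ
  have hg := hu.mem.hasWeakGrad Metric.isOpen_ball
  have hsub := ball_subset_ball' (n := n) hδ
  have hsol := hu.solvesDiv hA hk hg hδ hφ.1 (fun i => (hΦ i).1) h
  have key : ∀ j ∈ Finset.Icc 1 k, HasSobolevBound (B n r) j u
      (C j * ((δ - r)⁻¹ ^ j * dataNorm δ (δ - r) j u φ Φ)) := fun j hj => by
    obtain ⟨hj1, hjk⟩ := Finset.mem_Icc.1 hj
    exact hC j hj1 r δ hr hrδ hδ A ((hA.mono hsub).mono_order hjk) u _ φ _ _ hsol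
      (dataBound_dataNorm hε (hφ.mono (by omega)) fun i => (hΦ i).mono (by omega)) j le_rfl
  refine ⟨(key k (Finset.mem_Icc.2 ⟨hk, le_rfl⟩)).memH, fun j hj => ?_⟩
  have hkey := key j hj
  have hD : 0 ≤ (δ - r)⁻¹ ^ j * dataNorm δ (δ - r) j u φ Φ :=
    nonneg_of_mul_nonneg_right hkey.nonneg (zero_lt_one.trans_le (hC1 j))
  calc ∑ α ∈ Finset.piAntidiag (Finset.univ : Finset (Fin n)) j,
          normLp 2 (B n r) (weakDeriv (B n r) α u)
      ≤ (Finset.piAntidiag (Finset.univ : Finset (Fin n)) j).card •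
          (C j * ((δ - r)⁻¹ ^ j * dataNorm δ (δ - r) j u φ Φ)) := by
        refine Finset.sum_le_card_nsmul _ _ _ fun α hα => ?_
        exact hkey.normLp_weakDeriv_le Metric.isOpen_ball (Finset.mem_piAntidiag.1 hα).1.le
    _ = N j * C j * ((δ - r)⁻¹ ^ j * dataNorm δ (δ - r) j u φ Φ) := by
        rw [nsmul_eq_mul, mul_assoc]
    _ ≤ (1 + ∑ j ∈ Finset.Icc 1 k, N j * C j) *
          ((δ - r)⁻¹ ^ j * dataNorm δ (δ - r) j u φ Φ) := by
        refine mul_le_mul_of_nonneg_right ?_ hD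
        have := Finset.single_le_sum (f := fun j => N j * C j) (fun j _ => hNC j) hj
        linarith
    _ = (1 + ∑ j ∈ Finset.Icc 1 k, N j * C j) * ((δ - r) ^ j)⁻¹ *
          dataNorm δ (δ - r) j u φ Φ := by
        rw [inv_pow, mul_assoc]

end Estimates

/-! ### The Sobolev inequality -/

section Sobolev
variable {n : ℕ}

theorem norm_fderiv_le_sum_abs_pderiv {f : E n → ℝ} {x : E n} (hf : DifferentiableAt ℝ f x) :
    ‖fderiv ℝ f x‖ ≤ ∑ i, |pderiv i f x| := by
  refine ContinuousLinearMap.opNorm_le_bound _ (Finset.sum_nonneg fun _ _ => abs_nonneg _)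
    fun v => ?_
  have hv : v = ∑ i, v i • EuclideanSpace.single i (1 : ℝ) := by
    ext j
    simp [Finset.sum_apply, Pi.single_apply]
  conv_lhs => rw [hv]
  rw [map_sum, Finset.sum_mul]
  refine (norm_sum_le _ _).trans (Finset.sum_le_sum fun i _ => ?_)
  rw [map_smul, norm_smul, mul_comm, pderiv_eq_fderiv hf, Real.norm_eq_abs, Real.norm_eq_abs]
  refine mul_le_mul_of_nonneg_left ?_ (abs_nonneg _)
  exact (Real.norm_eq_abs _).symm.le.trans (PiLp.norm_apply_le v i)

theorem IsTestFun.eLpNorm_le_sobolev (hn : 3 ≤ n) {U : Set (E n)} {φ : E n → ℝ}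
    (h : IsTestFun U φ) : eLpNorm φ (ENNReal.ofReal (2 * n / (n - 2))) volume ≤
      (SNormLESNormFDerivOfEqConst ℝ (volume : Measure (E n)) 2 : ℝ≥0∞) *
        ∑ i, eLpNorm (InteriorElliptic.pderiv i φ) 2 volume := by
  have hn' : (3 : ℝ) ≤ n := by exact_mod_cast hn
  have hq : (0 : ℝ) ≤ 2 * n / (n - 2) := div_nonneg (by positivity) (by linarith)
  have key := eLpNorm_le_eLpNorm_fderiv_of_eq (E := E n) (F := ℝ) volume (u := φ)
    (h.smooth.of_le (by exact_mod_cast le_top)) h.compact (p := 2)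
    (p' := (2 * n / (n - 2) : ℝ).toNNReal) (by norm_num) (by simp; omega) (by
      rw [Real.coe_toNNReal _ hq]
      have : (n : ℝ) - 2 ≠ 0 := by linarith
      simp
      field_simp)
  refine key.trans (mul_le_mul_right ?_ _)
  refine (eLpNorm_mono_real (g := fun x => ∑ i, |InteriorElliptic.pderiv i φ x|)
    fun x => norm_fderiv_le_sum_abs_pderiv (h.differentiable x)).trans ?_
  refine le_of_eq_of_le (by congr 1; ext x; simp) ((eLpNorm_sum_le
    (f := fun i x => |InteriorElliptic.pderiv i φ x|) (s := Finset.univ)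
    (fun i _ => (h.pderiv.continuous.abs).aestronglyMeasurable) (by norm_num)).trans ?_)
  exact Finset.sum_le_sum fun i _ => (eLpNorm_norm (InteriorElliptic.pderiv i φ)).le

/-- Integrability of `v` beyond `L²` is not known beforehand. Fatou's lemma along an almost
everywhere convergent subsequence of test functions transfers the bound, while their gradients
converge in `L²`. -/
theorem HasWeakGrad.eLpNorm_le_sobolev (hn : 3 ≤ n) {v : E n → ℝ} {w : Fin n → E n → ℝ}
    {K : Set (E n)} (h : HasWeakGrad univ v w) (hK : IsCompact K) (hvK : ∀ x ∉ K, v x = 0) :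
    eLpNorm v (ENNReal.ofReal (2 * n / (n - 2))) volume ≤
      (SNormLESNormFDerivOfEqConst ℝ (volume : Measure (E n)) 2 : ℝ≥0∞) *
        ∑ i, eLpNorm (w i) 2 volume := by
  obtain ⟨φ, h1, h2, h3⟩ := exists_testFun_approx h hK isOpen_univ (subset_univ K) hvK
  have hv : MemLp v 2 volume := by simpa using h.memLp
  have hw : ∀ i, MemLp (w i) 2 volume := fun i => by simpa using (h.part i).memLp'
  have hφ : ∀ m, MemLp (φ m) 2 volume := fun m => (h1 m).memLp _ _
  obtain ⟨ns, hns, hae⟩ := h2.exists_subseq_ae hφ hv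
  refine (Lp.eLpNorm_lim_le_liminf_eLpNorm (fun m => (hφ (ns m)).1) v hae).trans ?_
  set c : ℝ≥0∞ := (SNormLESNormFDerivOfEqConst ℝ (volume : Measure (E n)) 2 : ℝ≥0∞)
  have hb : ∀ m, eLpNorm (φ (ns m)) (ENNReal.ofReal (2 * n / (n - 2))) volume ≤
      c * ∑ i, (eLpNorm (fun x => pderiv i (φ (ns m)) x - w i x) 2 volume +
        eLpNorm (w i) 2 volume) := fun m => by
    refine ((h1 (ns m)).eLpNorm_le_sobolev hn).trans
      (mul_le_mul_right (Finset.sum_le_sum fun i _ => ?_) _)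
    have := eLpNorm_add_le (p := 2) ((((h1 (ns m)).pderiv (i := i)).memLp 2 volume).sub (hw i)).1
      (hw i).1 (by norm_num)
    rw [sub_add_cancel] at this
    exact this
  have hd : ∀ i, Tendsto (fun m => eLpNorm (fun x => pderiv i (φ (ns m)) x - w i x) 2 volume)
      atTop (𝓝 0) := fun i => (h3 i).comp_tendsto hns.tendsto_atTop
  have ht : Tendsto (fun m => c * ∑ i, (eLpNorm (fun x => pderiv i (φ (ns m)) x - w i x) 2 volume +
      eLpNorm (w i) 2 volume)) atTop (𝓝 (c * ∑ i, (0 + eLpNorm (w i) 2 volume))) :=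
    ENNReal.Tendsto.const_mul (tendsto_finsetSum _ fun i _ =>
      (hd i).add tendsto_const_nhds) (Or.inr ENNReal.coe_ne_top)
  simp only [zero_add] at ht
  exact (liminf_le_liminf (Eventually.of_forall hb)).trans ht.liminf_eq.le

end Sobolev

/-! ### Regularised powers -/

section Powers
variable {κ p t : ℝ}

/-- A smooth version of `t |t|^(p-2)`. -/
noncomputable def regPow (κ p t : ℝ) : ℝ := t * (t ^ 2 + κ ^ 2) ^ ((p - 2) / 2)

/-- A smooth version of `|t|^(p/2)`. -/
noncomputable def regHalfPow (κ p t : ℝ) : ℝ := (t ^ 2 + κ ^ 2) ^ (p / 4)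

theorem sq_add_sq_pos (hκ : 0 < κ) (t : ℝ) : 0 < t ^ 2 + κ ^ 2 := by positivity

theorem contDiff_sq_add_sq : ContDiff ℝ 1 fun t : ℝ => t ^ 2 + κ ^ 2 :=
  (contDiff_id.pow 2).add contDiff_const

theorem contDiff_regPow (hκ : 0 < κ) : ContDiff ℝ 1 (regPow κ p) :=
  contDiff_id.mul (contDiff_sq_add_sq.rpow_const_of_ne fun t => (sq_add_sq_pos hκ t).ne')

theorem contDiff_regHalfPow (hκ : 0 < κ) : ContDiff ℝ 1 (regHalfPow κ p) :=
  contDiff_sq_add_sq.rpow_const_of_ne fun t => (sq_add_sq_pos hκ t).ne'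

theorem hasDerivAt_sq_add_sq (t : ℝ) : HasDerivAt (fun t : ℝ => t ^ 2 + κ ^ 2) (2 * t) t := by
  simpa using (hasDerivAt_pow 2 t).add_const (κ ^ 2)

theorem deriv_regPow (hκ : 0 < κ) : deriv (regPow κ p) t =
    (t ^ 2 + κ ^ 2) ^ ((p - 2) / 2) * (((p - 1) * t ^ 2 + κ ^ 2) / (t ^ 2 + κ ^ 2)) := by
  have hW := sq_add_sq_pos hκ t
  have h := (hasDerivAt_id t).mul ((hasDerivAt_sq_add_sq (κ := κ) t).rpow_const
    (p := (p - 2) / 2) (Or.inl hW.ne'))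
  have e : regPow κ p = id * fun t => (t ^ 2 + κ ^ 2) ^ ((p - 2) / 2) := rfl
  rw [e, h.deriv, Real.rpow_sub_one hW.ne']
  simp only [id]
  field_simp
  ring

theorem deriv_regHalfPow (hκ : 0 < κ) : deriv (regHalfPow κ p) t =
    p / 2 * t * (t ^ 2 + κ ^ 2) ^ (p / 4 - 1) := by
  have h := (hasDerivAt_sq_add_sq (κ := κ) t).rpow_const
    (p := p / 4) (Or.inl (sq_add_sq_pos hκ t).ne')
  have e : regHalfPow κ p = fun t => (t ^ 2 + κ ^ 2) ^ (p / 4) := rfl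
  rw [e, h.deriv]
  ring

theorem rpow_sq_add_sq_le (hκ : 0 < κ) (hp : p ≤ 2) :
    (t ^ 2 + κ ^ 2) ^ ((p - 2) / 2) ≤ (κ ^ 2) ^ ((p - 2) / 2) :=
  Real.rpow_le_rpow_of_nonpos (by positivity) (le_add_of_nonneg_left (sq_nonneg t)) (by linarith)

/-- For `p ≤ 2` the quotient in `deriv_regPow` is at least `p - 1`. With `p > 1` this is the
coercivity gained from testing with the regularised power. -/
theorem le_deriv_regPow (hκ : 0 < κ) (hp : p ≤ 2) :
    (p - 1) * (t ^ 2 + κ ^ 2) ^ ((p - 2) / 2) ≤ deriv (regPow κ p) t := by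
  have hW := sq_add_sq_pos hκ t
  rw [deriv_regPow hκ, mul_comm (p - 1)]
  refine mul_le_mul_of_nonneg_left ?_ (Real.rpow_nonneg hW.le _)
  rw [le_div_iff₀ hW]
  nlinarith [sq_nonneg κ]

theorem deriv_regPow_le (hκ : 0 < κ) (hp : p ≤ 2) :
    deriv (regPow κ p) t ≤ (t ^ 2 + κ ^ 2) ^ ((p - 2) / 2) := by
  have hW := sq_add_sq_pos hκ t
  rw [deriv_regPow hκ]
  refine mul_le_of_le_one_right (Real.rpow_nonneg hW.le _) ?_
  rw [div_le_one hW]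
  nlinarith [sq_nonneg t]

theorem deriv_regPow_pos (hκ : 0 < κ) (hp : 1 < p) (hp2 : p ≤ 2) : 0 < deriv (regPow κ p) t :=
  (mul_pos (sub_pos.2 hp) (Real.rpow_pos_of_pos (sq_add_sq_pos hκ t) _)).trans_le
    (le_deriv_regPow hκ hp2)

theorem abs_deriv_regPow_le (hκ : 0 < κ) (hp : 1 < p) (hp2 : p ≤ 2) :
    |deriv (regPow κ p) t| ≤ (κ ^ 2) ^ ((p - 2) / 2) := by
  rw [abs_of_pos (deriv_regPow_pos hκ hp hp2)]
  exact (deriv_regPow_le hκ hp2).trans (rpow_sq_add_sq_le hκ hp2)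

theorem abs_regPow_le (hκ : 0 < κ) : |regPow κ p t| ≤ (t ^ 2 + κ ^ 2) ^ ((p - 1) / 2) := by
  have hW := sq_add_sq_pos hκ t
  have e : (p - 1) / 2 = 1 / 2 + (p - 2) / 2 := by ring
  rw [regPow, abs_mul, abs_of_nonneg (Real.rpow_nonneg hW.le _), e, Real.rpow_add hW,
    ← Real.sqrt_eq_rpow]
  exact mul_le_mul_of_nonneg_right (Real.abs_le_sqrt (le_add_of_nonneg_right (sq_nonneg κ)))
    (Real.rpow_nonneg hW.le _)

/-- This is the error `t ^ 2 / s` left by `two_mul_abs_flux_le` when the weight `s` is the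
derivative of the power. It has the homogeneity of `|t|^p`, so it integrates to an `L^p` norm of
`u`. -/
theorem regPow_sq_div_le (hκ : 0 < κ) (hp : 1 < p) (hp2 : p ≤ 2) :
    regPow κ p t ^ 2 / deriv (regPow κ p) t ≤ (t ^ 2 + κ ^ 2) ^ (p / 2) / (p - 1) := by
  have hW := sq_add_sq_pos hκ t
  have hp1 : 0 < p - 1 := sub_pos.2 hp
  have hR := Real.rpow_pos_of_pos hW ((p - 2) / 2)
  have e : p / 2 = 1 + (p - 2) / 2 := by ring
  rw [div_le_div_iff₀ (deriv_regPow_pos hκ hp hp2) hp1, e, Real.rpow_add hW, Real.rpow_one, regPow,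
    mul_pow]
  calc t ^ 2 * ((t ^ 2 + κ ^ 2) ^ ((p - 2) / 2)) ^ 2 * (p - 1)
      = t ^ 2 * (t ^ 2 + κ ^ 2) ^ ((p - 2) / 2) * ((p - 1) * (t ^ 2 + κ ^ 2) ^ ((p - 2) / 2)) := by
        ring
    _ ≤ (t ^ 2 + κ ^ 2) * (t ^ 2 + κ ^ 2) ^ ((p - 2) / 2) * deriv (regPow κ p) t := by
        have := le_deriv_regPow (t := t) hκ hp2
        have h2 : t ^ 2 ≤ t ^ 2 + κ ^ 2 := le_add_of_nonneg_right (sq_nonneg κ)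
        gcongr

theorem regHalfPow_sq (hκ : 0 < κ) : regHalfPow κ p t ^ 2 = (t ^ 2 + κ ^ 2) ^ (p / 2) := by
  rw [regHalfPow, ← Real.rpow_mul_natCast (sq_add_sq_pos hκ t).le]
  congr 1
  push_cast
  ring

/-- Together with `le_deriv_regPow` this dominates the squared gradient of the half power of `u` by
the weighted energy that the test function produces, up to `1 / (p - 1)`. -/
theorem deriv_regHalfPow_sq_le (hκ : 0 < κ) (hp : 1 < p) (hp2 : p ≤ 2) :
    deriv (regHalfPow κ p) t ^ 2 ≤ (t ^ 2 + κ ^ 2) ^ ((p - 2) / 2) := by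
  have hW := sq_add_sq_pos hκ t
  have e : ((t ^ 2 + κ ^ 2) ^ (p / 4 - 1)) ^ 2 =
      (t ^ 2 + κ ^ 2) ^ ((p - 2) / 2) / (t ^ 2 + κ ^ 2) := by
    rw [← Real.rpow_mul_natCast hW.le, ← Real.rpow_sub_one hW.ne']
    congr 1
    push_cast
    ring
  rw [deriv_regHalfPow hκ, mul_pow, e, ← mul_div_assoc, div_le_iff₀ hW]
  rw [mul_comm]
  refine mul_le_mul_of_nonneg_left ?_ (Real.rpow_nonneg hW.le _)
  rw [mul_pow]
  have : (p / 2) ^ 2 ≤ 1 := pow_le_one₀ (by linarith) (by linarith)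
  nlinarith [sq_nonneg t, sq_nonneg κ]

theorem abs_deriv_regHalfPow_le (hκ : 0 < κ) (hp : 1 < p) (hp2 : p ≤ 2) :
    |deriv (regHalfPow κ p) t| ≤ √((κ ^ 2) ^ ((p - 2) / 2)) :=
  Real.abs_le_sqrt ((deriv_regHalfPow_sq_le hκ hp hp2).trans (rpow_sq_add_sq_le hκ hp2))

theorem abs_rpow_le_regHalfPow (hp : 0 ≤ p) : |t| ^ (p / 2) ≤ regHalfPow κ p t := by
  have e : p / 2 = 2 * (p / 4) := by ring
  rw [regHalfPow, e, Real.rpow_mul (abs_nonneg t), Real.rpow_two, sq_abs]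
  exact Real.rpow_le_rpow (sq_nonneg t) (le_add_of_nonneg_right (sq_nonneg κ)) (by positivity)

theorem sqrt_sq_add_sq_le (hκ : 0 ≤ κ) : √(t ^ 2 + κ ^ 2) ≤ |t| + κ := by
  refine Real.sqrt_le_iff.2 ⟨by positivity, ?_⟩
  rw [add_sq, sq_abs]
  nlinarith [mul_nonneg (abs_nonneg t) hκ]

end Powers

/-! ### The `L^q` estimate -/

section Lq
variable {n : ℕ} {κ p : ℝ}

/-- The pointwise inequality for powers of the solution: `z` and `d` stand for the value and the
gradient of a cutoff function. -/
theorem sum_sq_powGrad_le {M L η t z : ℝ} {A : Matrix (Fin n) (Fin n) ℝ} (hκ : 0 < κ) (hp : 1 < p)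
    (hp2 : p ≤ 2) (hM : 0 ≤ M) (hη : 0 < η) (hA : ∀ i j, |A i j| ≤ M)
    (hell : ∀ ξ : Fin n → ℝ, η * ∑ i, ξ i ^ 2 ≤ ∑ i, (∑ j, A i j * ξ j) * ξ i)
    {g d : Fin n → ℝ} (hd : ∀ i, |d i| ≤ L) :
    ∑ i, (z * (deriv (regHalfPow κ p) t * g i) + d i * regHalfPow κ p t) ^ 2 ≤
      4 / ((p - 1) * η) * ∑ i, (z * z * (deriv (regPow κ p) t * g i) +
        2 * z * d i * regPow κ p t) * ∑ j, A i j * g j +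
      (16 * n ^ 3 * M ^ 2 / ((p - 1) * η) ^ 2 + 2 * n) * (L ^ 2 * (t ^ 2 + κ ^ 2) ^ (p / 2)) := by
  have hp1 : 0 < p - 1 := sub_pos.2 hp
  set s := deriv (regPow κ p) t with hs
  set G := regPow κ p t with hG
  set H := regHalfPow κ p t with hH
  set H' := deriv (regHalfPow κ p) t with hH'
  set W := (t ^ 2 + κ ^ 2) ^ (p / 2) with hW
  have hs0 : 0 < s := deriv_regPow_pos hκ hp hp2
  have hH2 : H ^ 2 = W := regHalfPow_sq hκ
  have hW0 : 0 ≤ W := hH2 ▸ sq_nonneg H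
  have h1 : (p - 1) * H' ^ 2 ≤ s :=
    (mul_le_mul_of_nonneg_left (deriv_regHalfPow_sq_le hκ hp hp2) hp1.le).trans
      (le_deriv_regPow hκ hp2)
  have h2 : G ^ 2 / s ≤ W / (p - 1) := regPow_sq_div_le hκ hp hp2
  set Q := ∑ i, g i ^ 2 with hQ
  have hQ0 : 0 ≤ Q := Finset.sum_nonneg fun _ _ => sq_nonneg _
  set X := ∑ i, (z * z * (s * g i) + 2 * z * d i * G) * ∑ j, A i j * g j with hX
  -- The absorption is weighted by `s`, the derivative of the power, because `s |∇u|²` is the energy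
  -- at hand, not `|∇u|²`.
  have h3 : |2 * G * ∑ i, (∑ j, A i j * (z * g j)) * d i| ≤
      η / 4 * (s * ∑ i, (z * g i) ^ 2) + 4 * n ^ 3 * M ^ 2 / η * L ^ 2 * (G ^ 2 / s) :=
    two_mul_abs_flux_le hM hη hs0 hA hd
  have e1 : ∑ i, (z * g i) ^ 2 = z ^ 2 * Q := by
    rw [hQ, Finset.mul_sum]
    exact Finset.sum_congr rfl fun i _ => mul_pow _ _ _
  have e2 : X = z ^ 2 * s * ∑ i, (∑ j, A i j * g j) * g i +
      2 * G * ∑ i, (∑ j, A i j * (z * g j)) * d i := by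
    rw [hX, Finset.mul_sum, Finset.mul_sum, ← Finset.sum_add_distrib]
    refine Finset.sum_congr rfl fun i _ => ?_
    have : ∑ j, A i j * (z * g j) = z * ∑ j, A i j * g j := by
      rw [Finset.mul_sum]
      exact Finset.sum_congr rfl fun j _ => by ring
    rw [this]
    ring
  have h4 : z ^ 2 * s * (η * Q) ≤ z ^ 2 * s * ∑ i, (∑ j, A i j * g j) * g i :=
    mul_le_mul_of_nonneg_left (hell g) (by positivity)
  rw [e1] at h3
  have h5 := neg_le_of_abs_le h3
  have h6 : 4 * n ^ 3 * M ^ 2 / η * L ^ 2 * (G ^ 2 / s) ≤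
      4 * n ^ 3 * M ^ 2 / η * L ^ 2 * (W / (p - 1)) :=
    mul_le_mul_of_nonneg_left h2 (by positivity)
  have hP : 0 ≤ z ^ 2 * s * Q := by positivity
  have h7 : z ^ 2 * s * Q ≤ 2 / η * X + 2 / η * (4 * n ^ 3 * M ^ 2 / η * L ^ 2 * (W / (p - 1))) := by
    rw [← mul_add, div_mul_eq_mul_div, le_div_iff₀ hη]
    nlinarith
  have h8 : ∑ i, (z * (H' * g i) + d i * H) ^ 2 ≤ 2 * (z ^ 2 * H' ^ 2 * Q) + 2 * n * (L ^ 2 * W) := by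
    have : ∀ i, (z * (H' * g i) + d i * H) ^ 2 ≤ 2 * z ^ 2 * H' ^ 2 * g i ^ 2 + 2 * (L ^ 2 * W) :=
      fun i => by
        have hdi : d i ^ 2 ≤ L ^ 2 := sq_le_sq' (neg_le_of_abs_le (hd i)) ((le_abs_self _).trans (hd i))
        have := mul_le_mul_of_nonneg_right hdi hW0
        have h0 := sq_nonneg (z * (H' * g i) - d i * H)
        rw [← hH2] at this ⊢
        nlinarith
    refine (Finset.sum_le_sum fun i _ => this i).trans (le_of_eq ?_)
    rw [Finset.sum_add_distrib, ← Finset.mul_sum, Finset.sum_const, Finset.card_univ,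
      Fintype.card_fin, nsmul_eq_mul]
    ring
  have h9 : z ^ 2 * H' ^ 2 * Q ≤ z ^ 2 * s * Q / (p - 1) := by
    rw [le_div_iff₀ hp1]
    have := mul_le_mul_of_nonneg_left h1 (mul_nonneg (sq_nonneg z) hQ0)
    nlinarith
  have h10 : z ^ 2 * s * Q / (p - 1) ≤
      (2 / η * X + 2 / η * (4 * n ^ 3 * M ^ 2 / η * L ^ 2 * (W / (p - 1)))) / (p - 1) :=
    div_le_div_of_nonneg_right h7 hp1.le
  calc ∑ i, (z * (H' * g i) + d i * H) ^ 2
      ≤ 2 * ((2 / η * X + 2 / η * (4 * n ^ 3 * M ^ 2 / η * L ^ 2 * (W / (p - 1)))) / (p - 1)) +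
          2 * n * (L ^ 2 * W) := by linarith
    _ = _ := by
        field_simp
        ring

variable {α : Type*} [MeasurableSpace α] {μ : Measure α}

theorem toReal_eLpNorm_rpow (hp : 1 < p) {f : α → ℝ} (hf : MemLp f (ENNReal.ofReal p) μ) :
    (eLpNorm f (ENNReal.ofReal p) μ).toReal = (∫ x, |f x| ^ p ∂μ) ^ (1 / p) := by
  have hp0 : 0 < p := by linarith
  rw [hf.eLpNorm_eq_integral_rpow_norm (by simpa using hp0) ENNReal.ofReal_ne_top,
    ENNReal.toReal_ofReal hp0.le, ENNReal.toReal_ofReal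
      (Real.rpow_nonneg (integral_nonneg fun x => by positivity) _), one_div]
  rfl

theorem integral_abs_rpow (hp : 1 < p) {f : α → ℝ} (hf : MemLp f (ENNReal.ofReal p) μ) :
    ∫ x, |f x| ^ p ∂μ = (eLpNorm f (ENNReal.ofReal p) μ).toReal ^ p := by
  rw [toReal_eLpNorm_rpow hp hf, ← Real.rpow_mul (integral_nonneg fun x => by positivity),
    one_div_mul_cancel (by linarith), Real.rpow_one]

/-- Hölder with exponents `p` and `p / (p - 1)`: the power `p - 1` takes `L^p` into the conjugate
space. -/
theorem integral_abs_mul_rpow_le (hp : 1 < p) {f g : α → ℝ} (hf : MemLp f (ENNReal.ofReal p) μ)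
    (hg : MemLp g (ENNReal.ofReal p) μ) :
    Integrable (fun x => |f x| * |g x| ^ (p - 1)) μ ∧ ∫ x, |f x| * |g x| ^ (p - 1) ∂μ ≤
      (eLpNorm f (ENNReal.ofReal p) μ).toReal *
        (eLpNorm g (ENNReal.ofReal p) μ).toReal ^ (p - 1) := by
  have hp0 : 0 < p := by linarith
  have hp1 : 0 < p - 1 := sub_pos.2 hp
  have hpq : p.HolderConjugate (p / (p - 1)) := Real.HolderConjugate.conjExponent hp
  have hgq : MemLp (fun x => |g x| ^ (p - 1)) (ENNReal.ofReal (p / (p - 1))) μ := by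
    have := hg.norm_rpow_div (ENNReal.ofReal (p - 1))
    rwa [ENNReal.toReal_ofReal hp1.le, ← ENNReal.ofReal_div_of_pos hp1] at this
  have := hpq.ennrealOfReal
  refine ⟨hf.abs.integrable_mul hgq, ?_⟩
  refine (integral_mul_le_Lp_mul_Lq_of_nonneg hpq (Eventually.of_forall fun x => abs_nonneg _)
    (Eventually.of_forall fun x => Real.rpow_nonneg (abs_nonneg _) _) hf.abs hgq).trans (le_of_eq ?_)
  have e : ∀ x, (|g x| ^ (p - 1)) ^ (p / (p - 1)) = |g x| ^ p := fun x => by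
    rw [← Real.rpow_mul (abs_nonneg _), mul_div_cancel₀ _ hp1.ne']
  simp only [e]
  rw [toReal_eLpNorm_rpow hp hf, toReal_eLpNorm_rpow hp hg,
    ← Real.rpow_mul (integral_nonneg fun x => by positivity)]
  congr 2
  field_simp

/-- `φ` is the right-hand side of the equation `-div (A g) = φ` tested with compactly supported
`H¹` functions. -/
def SolvesInLp (U : Set (E n)) (A : E n → Matrix (Fin n) (Fin n) ℝ) (g : Fin n → E n → ℝ)
    (φ : E n → ℝ) : Prop :=
  ∀ (v : E n → ℝ) (w : Fin n → E n → ℝ) (K : Set (E n)), HasWeakGrad univ v w → IsCompact K →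
    K ⊆ U → (∀ x ∉ K, v x = 0) → (∀ i, ∀ x ∉ K, w i x = 0) →
    IntegrableOn (fun x => φ x * v x) U ∧
      ∑ i, ∫ x in U, w i x * flux A g i x = ∫ x in U, φ x * v x

/-- The regularised absolute value of `u`. -/
noncomputable def regAbs (κ : ℝ) (u : E n → ℝ) (x : E n) : ℝ := √(u x ^ 2 + κ ^ 2)

theorem abs_regAbs_rpow (hκ : 0 < κ) (u : E n → ℝ) (x : E n) (q : ℝ) :
    |regAbs κ u x| ^ q = (u x ^ 2 + κ ^ 2) ^ (q / 2) := by
  rw [regAbs, abs_of_nonneg (Real.sqrt_nonneg _), Real.sqrt_eq_rpow,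
    ← Real.rpow_mul (sq_add_sq_pos hκ _).le]
  congr 1
  ring

theorem memLp_regAbs {δ : ℝ} (hκ : 0 < κ) {u : E n → ℝ} {q : ℝ≥0∞}
    (hu : MemLp u q (volume.restrict (B n δ))) : MemLp (regAbs κ u) q (volume.restrict (B n δ)) := by
  have h1 : MemLp (fun x => |u x| + κ) q (volume.restrict (B n δ)) := hu.abs.add (memLp_const κ)
  refine h1.mono ?_ (Eventually.of_forall fun x => ?_)
  · exact Real.continuous_sqrt.comp_aestronglyMeasurable ((hu.1.pow 2).add_const _)
  · rw [regAbs, Real.norm_of_nonneg (Real.sqrt_nonneg _), Real.norm_of_nonneg (by positivity)]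
    exact sqrt_sq_add_sq_le hκ.le

/-- The cost of regularising is linear in `κ` on a ball of finite measure, hence disappears in the
limit. -/
theorem eLpNorm_regAbs_le {δ : ℝ} (hκ : 0 < κ) {u : E n → ℝ} (hp : 1 ≤ p)
    (hu : MemLp u (ENNReal.ofReal p) (volume.restrict (B n δ))) :
    normLp (ENNReal.ofReal p) (B n δ) (regAbs κ u) ≤
      normLp (ENNReal.ofReal p) (B n δ) u +
        κ * normLp (ENNReal.ofReal p) (B n δ) (fun _ => (1 : ℝ)) := by
  set μ := volume.restrict (B n δ)
  have hp' : (1 : ℝ≥0∞) ≤ ENNReal.ofReal p := by simpa using hp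
  have h1 : MemLp (fun _ => (1 : ℝ)) (ENNReal.ofReal p) μ := memLp_const 1
  have hk : MemLp (fun _ => κ * (1 : ℝ)) (ENNReal.ofReal p) μ := h1.const_mul κ
  have h2 : eLpNorm (regAbs κ u) (ENNReal.ofReal p) μ ≤
      eLpNorm u (ENNReal.ofReal p) μ + ENNReal.ofReal κ *
        eLpNorm (fun _ => (1 : ℝ)) (ENNReal.ofReal p) μ := by
    calc eLpNorm (regAbs κ u) (ENNReal.ofReal p) μ
        ≤ eLpNorm ((fun x => |u x|) + fun _ => κ * (1 : ℝ)) (ENNReal.ofReal p) μ := by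
          refine eLpNorm_mono_real fun x => ?_
          rw [regAbs, Real.norm_of_nonneg (Real.sqrt_nonneg _)]
          simpa using sqrt_sq_add_sq_le (t := u x) hκ.le
      _ ≤ eLpNorm (fun x => |u x|) (ENNReal.ofReal p) μ +
            eLpNorm (fun _ => κ * (1 : ℝ)) (ENNReal.ofReal p) μ := eLpNorm_add_le hu.abs.1 hk.1 hp'
      _ ≤ _ := by
          gcongr
          · exact (eLpNorm_norm u).le
          · have := eLpNorm_const_smul κ (fun _ : E n => (1 : ℝ)) (ENNReal.ofReal p) μ
            rw [Real.enorm_of_nonneg hκ.le] at this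
            exact this.le
  have h3 := ENNReal.toReal_mono (ENNReal.add_ne_top.2 ⟨hu.2.ne,
    ENNReal.mul_ne_top ENNReal.ofReal_ne_top h1.2.ne⟩) h2
  rwa [ENNReal.toReal_add hu.2.ne (ENNReal.mul_ne_top ENNReal.ofReal_ne_top h1.2.ne),
    ENNReal.toReal_mul, ENNReal.toReal_ofReal hκ.le] at h3

-- The equation is tested with `ζ²` times the regularised power of `u`, which is in `H¹` by the
-- chain rule as the power has bounded derivative for `κ > 0`. The pointwise inequality converts the
-- energy into the gradient of `ζ` times the half power, and Hölder bounds the term with `φ`.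
set_option maxHeartbeats 1000000 in
theorem SolvesInLp.integral_powGrad_le {M η δ L : ℝ} {A : E n → Matrix (Fin n) (Fin n) ℝ}
    {u φ ζ : E n → ℝ} {g : Fin n → E n → ℝ} (hκ : 0 < κ) (hp : 1 < p) (hp2 : p ≤ 2) (hM : 0 ≤ M)
    (hη : 0 < η) (hδ : 0 < δ) (hA : IsRoughCoeff (B n δ) M η A) (hu : HasWeakGrad (B n δ) u g)
    (hφ : MemLp φ (ENNReal.ofReal p) (volume.restrict (B n δ)))
    (h : SolvesInLp (B n δ) A g φ) (hζ : IsTestFun (B n δ) ζ) (hζ0 : ∀ x, 0 ≤ ζ x)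
    (hζ1 : ∀ x, ζ x ≤ 1) (hζd : ∀ i x, |pderiv i ζ x| ≤ L) :
    ∫ x in B n δ, ∑ i, (ζ x * (deriv (regHalfPow κ p) (u x) * g i x) +
        pderiv i ζ x * regHalfPow κ p (u x)) ^ 2 ≤
      4 / ((p - 1) * η) * (normLp (ENNReal.ofReal p) (B n δ) φ *
        normLp (ENNReal.ofReal p) (B n δ) (regAbs κ u) ^ (p - 1)) +
      (16 * n ^ 3 * M ^ 2 / ((p - 1) * η) ^ 2 + 2 * n) *
        (L ^ 2 * normLp (ENNReal.ofReal p) (B n δ) (regAbs κ u) ^ p) := by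
  have hp1 : 0 < p - 1 := sub_pos.2 hp
  have hUm : MeasurableSet (B n δ) := measurableSet_ball
  set μ := volume.restrict (B n δ) with hμ
  have hmem : ∀ᵐ x ∂μ, x ∈ B n δ := self_mem_ae_restrict hUm
  have hζ2 : IsTestFun (B n δ) fun x => ζ x * ζ x := hζ.mul_left hζ.smooth
  have hζ2d : ∀ i x, pderiv i (fun x => ζ x * ζ x) x = 2 * ζ x * pderiv i ζ x := fun i x => by
    rw [pderiv_mul (hζ.differentiable x) (hζ.differentiable x)]
    ring
  have hG := hu.comp hδ (contDiff_regPow (p := p) hκ) fun _ => abs_deriv_regPow_le hκ hp hp2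
  have hH := hu.comp hδ (contDiff_regHalfPow (p := p) hκ) fun _ => abs_deriv_regHalfPow_le hκ hp hp2
  have hz := (hH.cutoff hUm hζ).mono (subset_univ (B n δ))
  have hv := hG.cutoff hUm hζ2
  simp only [hζ2d] at hv
  have hv' := hv.mono (subset_univ (B n δ))
  have hFm := hA.memLp_flux hUm fun i => (hu.part i).memLp'
  have hK0 : ∀ x ∉ tsupport ζ, ζ x = 0 := fun x hx => image_eq_zero_of_notMem_tsupport hx
  have hK1 : ∀ i, ∀ x ∉ tsupport ζ, pderiv i ζ x = 0 := fun i x hx =>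
    image_eq_zero_of_notMem_tsupport fun h => hx (tsupport_pderiv_subset hζ.smooth h)
  obtain ⟨hint, heq⟩ := h _ _ (tsupport ζ) hv hζ.compact hζ.supp
    (fun x hx => by simp [hK0 x hx]) (fun i x hx => by simp [hK0 x hx])
  have hup : MemLp u (ENNReal.ofReal p) μ := hu.memLp.mono_exponent (by
    rw [← ENNReal.ofReal_ofNat 2]
    exact ENNReal.ofReal_le_ofReal hp2)
  have hN := memLp_regAbs hκ hup
  obtain ⟨i1, hol⟩ := integral_abs_mul_rpow_le hp hφ hN
  have hNp := integral_abs_rpow hp hN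
  simp only [abs_regAbs_rpow hκ] at i1 hol hNp
  have i2 : Integrable (fun x => (u x ^ 2 + κ ^ 2) ^ (p / 2)) μ :=
    hH.memLp.integrable_sq.congr (Eventually.of_forall fun x => regHalfPow_sq hκ)
  have i3 : ∀ i, Integrable (fun x => (ζ x * ζ x * (deriv (regPow κ p) (u x) * g i x) +
      2 * ζ x * pderiv i ζ x * regPow κ p (u x)) * flux A g i x) μ := fun i =>
    integrable_mul_of_memLp_two (hv'.part i).memLp' (hFm i)
  have i4 : ∀ i, Integrable (fun x => (ζ x * (deriv (regHalfPow κ p) (u x) * g i x) +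
      pderiv i ζ x * regHalfPow κ p (u x)) ^ 2) μ := fun i => (hz.part i).memLp'.integrable_sq
  rw [← integral_finsetSum _ fun i _ => i3 i] at heq
  have i5 := integrable_finsetSum Finset.univ fun i _ => i3 i
  calc ∫ x, ∑ i, (ζ x * (deriv (regHalfPow κ p) (u x) * g i x) +
        pderiv i ζ x * regHalfPow κ p (u x)) ^ 2 ∂μ
      ≤ ∫ x, (4 / ((p - 1) * η) * ∑ i, (ζ x * ζ x * (deriv (regPow κ p) (u x) * g i x) +
            2 * ζ x * pderiv i ζ x * regPow κ p (u x)) * flux A g i x +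
          (16 * n ^ 3 * M ^ 2 / ((p - 1) * η) ^ 2 + 2 * n) *
            (L ^ 2 * (u x ^ 2 + κ ^ 2) ^ (p / 2))) ∂μ := by
        refine integral_mono_ae (integrable_finsetSum _ fun i _ => i4 i)
          ((i5.const_mul _).add ((i2.const_mul _).const_mul _)) ?_
        filter_upwards [hmem] with x hx
        exact sum_sq_powGrad_le hκ hp hp2 hM hη (fun i j => hA.bdd i j x hx) (hA.elliptic x hx)
          fun i => hζd i x
    _ = 4 / ((p - 1) * η) * ∫ x, φ x * (ζ x * ζ x * regPow κ p (u x)) ∂μ +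
          (16 * n ^ 3 * M ^ 2 / ((p - 1) * η) ^ 2 + 2 * n) *
            (L ^ 2 * normLp (ENNReal.ofReal p) (B n δ) (regAbs κ u) ^ p) := by
        rw [integral_add (i5.const_mul _) ((i2.const_mul _).const_mul _), integral_const_mul,
          integral_const_mul, integral_const_mul, hNp, heq]
        rfl
    _ ≤ _ := by
        refine add_le_add_left (mul_le_mul_of_nonneg_left ?_ (by positivity)) _
        refine (integral_mono hint i1 fun x => ?_).trans hol
        have h1 : ζ x * ζ x ≤ 1 := mul_le_one₀ (hζ1 x) (hζ0 x) (hζ1 x)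
        have h2 : 0 ≤ ζ x * ζ x := mul_nonneg (hζ0 x) (hζ0 x)
        refine (le_abs_self _).trans ?_
        rw [abs_mul, abs_mul, abs_of_nonneg h2]
        refine mul_le_mul_of_nonneg_left ?_ (abs_nonneg _)
        exact (mul_le_of_le_one_left (abs_nonneg _) h1).trans (abs_regPow_le hκ)

end Lq

/-! ### From the gradient bound to `L^q`: scaling, Sobolev inequality and removal of the
regularisation -/

section LqFinal
variable {n : ℕ} {κ p : ℝ}

/-- With `a` and `b` the two summands on the right, the powers of `ε` cancel: the left side is a
combination of `b * a ^ (p - 1)` and `a ^ p`, and each is at most `(a + b) ^ p`. -/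
theorem weighted_young_le {ε T Φ c₁ c₂ : ℝ} (hp : 1 < p) (hε : 0 < ε) (hT : 0 ≤ T) (hΦ : 0 ≤ Φ)
    (hc₁ : 0 ≤ c₁) (hc₂ : 0 ≤ c₂) :
    c₁ * (Φ * T ^ (p - 1)) + c₂ * ((ε ^ 2)⁻¹ * T ^ p) ≤
      (c₁ + c₂) * (ε ^ (-2 / p) * T + ε ^ (2 * (p - 1) / p) * Φ) ^ p := by
  have hp0 : 0 < p := by linarith
  set a := ε ^ (-2 / p) * T with ha
  set b := ε ^ (2 * (p - 1) / p) * Φ with hb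
  have ha0 : 0 ≤ a := mul_nonneg (Real.rpow_nonneg hε.le _) hT
  have hb0 : 0 ≤ b := mul_nonneg (Real.rpow_nonneg hε.le _) hΦ
  have e1 : (ε ^ 2)⁻¹ * T ^ p = a ^ p := by
    rw [ha, Real.mul_rpow (Real.rpow_nonneg hε.le _) hT, ← Real.rpow_mul hε.le,
      div_mul_cancel₀ _ hp0.ne', Real.rpow_neg hε.le, Real.rpow_two]
  have e2 : Φ * T ^ (p - 1) = b * a ^ (p - 1) := by
    rw [ha, hb, Real.mul_rpow (Real.rpow_nonneg hε.le _) hT, ← Real.rpow_mul hε.le]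
    have : ε ^ (2 * (p - 1) / p) * ε ^ (-2 / p * (p - 1)) = 1 := by
      rw [← Real.rpow_add hε]
      have : 2 * (p - 1) / p + -2 / p * (p - 1) = 0 := by ring
      rw [this, Real.rpow_zero]
    linear_combination (-(Φ * T ^ (p - 1))) * this
  have h1 : a ^ p ≤ (a + b) ^ p := Real.rpow_le_rpow ha0 (le_add_of_nonneg_right hb0) hp0.le
  have h2 : b * a ^ (p - 1) ≤ (a + b) ^ p := by
    calc b * a ^ (p - 1) ≤ (a + b) * (a + b) ^ (p - 1) :=
          mul_le_mul (le_add_of_nonneg_left ha0)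
            (Real.rpow_le_rpow ha0 (le_add_of_nonneg_right hb0) (by linarith))
            (Real.rpow_nonneg ha0 _) (add_nonneg ha0 hb0)
      _ = (a + b) ^ p := by
          rw [mul_comm, Real.rpow_sub_one' (add_nonneg ha0 hb0) (by linarith)]
          by_cases h : a + b = 0
          · rw [h, mul_zero, Real.zero_rpow hp0.ne']
          · rw [div_mul_cancel₀ _ h]
  rw [e1, e2, add_mul]
  exact add_le_add (mul_le_mul_of_nonneg_left h2 hc₁) (mul_le_mul_of_nonneg_left h1 hc₂)

theorem eLpNorm_le_of_sq_integral_le {w : E n → ℝ} {δ X : ℝ}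
    (hw : MemLp w 2 (volume.restrict (B n δ))) (h0 : ∀ x ∉ B n δ, w x = 0)
    (hX : ∫ x in B n δ, w x ^ 2 ≤ X) : eLpNorm w 2 volume ≤ ENNReal.ofReal √X := by
  have hs : Function.support w ⊆ B n δ := fun x hx => by
    by_contra hxU
    exact hx (h0 x hxU)
  rw [← eLpNorm_restrict_eq_of_support_subset hs, ← ENNReal.ofReal_toReal hw.2.ne]
  refine ENNReal.ofReal_le_ofReal (Real.le_sqrt_of_sq_le ?_)
  exact (normLp_sq hw).le.trans hX

-- Sobolev is applied to `ζ` times the half power of `u`, which on the inner ball dominates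
-- `|u|^(p/2)`. Its gradient is bounded by a multiple of `S ^ (p / 2)`, so raising to the power `2 /
-- p` gives a bound linear in `S`, with a factor that does not involve `κ`.
set_option maxHeartbeats 1000000 in
theorem SolvesInLp.eLpNorm_le (hn : 3 ≤ n) {M η δ r c : ℝ} {A : E n → Matrix (Fin n) (Fin n) ℝ}
    {u φ ζ : E n → ℝ} {g : Fin n → E n → ℝ} (hκ : 0 < κ) (hp : 1 < p) (hp2 : p ≤ 2) (hM : 0 ≤ M)
    (hη : 0 < η) (hr : 0 < r) (hrδ : r < δ) (hc : 0 < c)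
    (hA : IsRoughCoeff (B n δ) M η A) (hu : HasWeakGrad (B n δ) u g)
    (hφ : MemLp φ (ENNReal.ofReal p) (volume.restrict (B n δ)))
    (h : SolvesInLp (B n δ) A g φ) (hζ : IsTestFun (B n δ) ζ) (hζ0 : ∀ x, 0 ≤ ζ x)
    (hζ1 : ∀ x, ζ x ≤ 1) (hζr : ∀ x ∈ B n r, ζ x = 1)
    (hζd : ∀ i x, |pderiv i ζ x| ≤ c / (δ - r)) :
    eLpNorm u (ENNReal.ofReal (n * p / (n - 2))) (volume.restrict (B n r)) ≤
      ENNReal.ofReal (((SNormLESNormFDerivOfEqConst ℝ (volume : Measure (E n)) 2 : ℝ) *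
        (n * √(4 / ((p - 1) * η) +
          (16 * n ^ 3 * M ^ 2 / ((p - 1) * η) ^ 2 + 2 * n) * c ^ 2))) ^ (2 / p) *
        ((δ - r) ^ (-2 / p) * normLp (ENNReal.ofReal p) (B n δ) (regAbs κ u) +
          (δ - r) ^ (2 * (p - 1) / p) * normLp (ENNReal.ofReal p) (B n δ) φ)) := by
  have hp0 : 0 < p := by linarith
  have hp1 : 0 < p - 1 := sub_pos.2 hp
  have hδ : 0 < δ := hr.trans hrδ
  have hε : 0 < δ - r := sub_pos.2 hrδ
  have hn' : (3 : ℝ) ≤ n := by exact_mod_cast hn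
  have key := h.integral_powGrad_le hκ hp hp2 hM hη hδ hA hu hφ hζ hζ0 hζ1 hζd
  set T := normLp (ENNReal.ofReal p) (B n δ) (regAbs κ u) with hT
  set Φ := normLp (ENNReal.ofReal p) (B n δ) φ with hΦ
  have hT0 : 0 ≤ T := normLp_nonneg _ _ _
  have hΦ0 : 0 ≤ Φ := normLp_nonneg _ _ _
  set c₁ := 4 / ((p - 1) * η) with hc₁
  set c₂ := (16 * n ^ 3 * M ^ 2 / ((p - 1) * η) ^ 2 + 2 * n) with hc₂
  have hc₁0 : 0 ≤ c₁ := by positivity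
  have hc₂0 : 0 ≤ c₂ := by positivity
  set S := (δ - r) ^ (-2 / p) * T + (δ - r) ^ (2 * (p - 1) / p) * Φ with hS
  have hS0 : 0 ≤ S := by
    have := Real.rpow_nonneg hε.le
    exact add_nonneg (mul_nonneg (this _) hT0) (mul_nonneg (this _) hΦ0)
  set D := c₁ + c₂ * c ^ 2 with hD
  have hD0 : 0 ≤ D := by positivity
  have key2 := weighted_young_le hp hε hT0 hΦ0 hc₁0 (mul_nonneg hc₂0 (sq_nonneg c))
  have e0 : c₂ * ((c / (δ - r)) ^ 2 * T ^ p) = c₂ * c ^ 2 * (((δ - r) ^ 2)⁻¹ * T ^ p) := by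
    rw [div_pow]
    ring
  rw [e0] at key
  replace key := key.trans key2
  -- the Sobolev inequality for the truncated power
  have hH := hu.comp hδ (contDiff_regHalfPow (p := p) hκ) fun _ => abs_deriv_regHalfPow_le hκ hp hp2
  have hz := hH.cutoff measurableSet_ball hζ
  have hz' := hz.mono (subset_univ (B n δ))
  have hsob := hz.eLpNorm_le_sobolev hn hζ.compact
    fun x hx => by simp [image_eq_zero_of_notMem_tsupport hx]
  have hgrad : ∀ i, eLpNorm (fun x => ζ x * (deriv (regHalfPow κ p) (u x) * g i x) +
      pderiv i ζ x * regHalfPow κ p (u x)) 2 volume ≤ ENNReal.ofReal √(D * S ^ p) := fun i => by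
    refine eLpNorm_le_of_sq_integral_le (hz'.part i).memLp' (fun x hx => ?_) (le_trans ?_ key)
    · simp [hζ.eq_zero hx, (hζ.pderiv (i := i)).eq_zero hx]
    · refine integral_mono (hz'.part i).memLp'.integrable_sq
        (integrable_finsetSum _ fun i _ => (hz'.part i).memLp'.integrable_sq) fun x => ?_
      exact Finset.single_le_sum (f := fun i => (ζ x * (deriv (regHalfPow κ p) (u x) * g i x) +
        pderiv i ζ x * regHalfPow κ p (u x)) ^ 2) (fun _ _ => sq_nonneg _) (Finset.mem_univ i)
  set Cs := SNormLESNormFDerivOfEqConst ℝ (volume : Measure (E n)) 2 with hCs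
  have hrt : √(D * S ^ p) = √D * S ^ (p / 2) := by
    rw [Real.sqrt_mul hD0, Real.sqrt_eq_rpow (S ^ p), ← Real.rpow_mul hS0]
    congr 2
    ring
  have hbd : eLpNorm (fun x => ζ x * regHalfPow κ p (u x)) (ENNReal.ofReal (2 * n / (n - 2)))
      volume ≤ ENNReal.ofReal ((Cs : ℝ) * (n * √D) * S ^ (p / 2)) := by
    refine hsob.trans ((mul_le_mul_right (Finset.sum_le_card_nsmul _ _ _ fun i _ => hgrad i)
      _).trans (le_of_eq ?_))
    rw [hrt, Finset.card_univ, Fintype.card_fin, nsmul_eq_mul, mul_assoc, mul_assoc,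
      ENNReal.ofReal_mul Cs.coe_nonneg, ENNReal.ofReal_coe_nnreal, ENNReal.ofReal_mul (Nat.cast_nonneg n),
      ENNReal.ofReal_natCast]
  have hpow : eLpNorm (fun x => ‖u x‖ ^ (p / 2)) (ENNReal.ofReal (2 * n / (n - 2)))
      (volume.restrict (B n r)) ≤ ENNReal.ofReal ((Cs : ℝ) * (n * √D) * S ^ (p / 2)) := by
    refine le_trans ?_ ((eLpNorm_mono_measure _ (Measure.restrict_le_self (s := B n r))).trans hbd)
    refine eLpNorm_mono_ae ?_
    filter_upwards [self_mem_ae_restrict (measurableSet_ball (x := (0 : E n)) (ε := r))] with x hx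
    rw [hζr x hx, one_mul, Real.norm_of_nonneg (Real.rpow_nonneg (norm_nonneg _) _)]
    exact (abs_rpow_le_regHalfPow hp0.le).trans (le_abs_self _)
  -- The norm of `|u|^(p/2)` in `L^(2n/(n-2))` is the power `p / 2` of the norm of `u` with exponent
  -- `2n/(n-2) · p/2 = np/(n-2)`.
  rw [eLpNorm_norm_rpow _ (by positivity), ← ENNReal.ofReal_mul
    (div_nonneg (by positivity) (by linarith))] at hpow
  have hexp : 2 * (n : ℝ) / (n - 2) * (p / 2) = n * p / (n - 2) := by ring
  rw [hexp] at hpow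
  have hfin := ENNReal.rpow_le_rpow hpow (z := 2 / p) (by positivity)
  rw [← ENNReal.rpow_mul, div_mul_div_comm, mul_comm p 2, div_self (by positivity),
    ENNReal.rpow_one, ENNReal.ofReal_rpow_of_nonneg (by positivity) (by positivity),
    Real.mul_rpow (by positivity) (Real.rpow_nonneg hS0 _), ← Real.rpow_mul hS0,
    div_mul_div_comm, mul_comm p 2, div_self (by positivity), Real.rpow_one] at hfin
  exact hfin

theorem higher_integrability_estimate (n : ℕ) (hn : 3 ≤ n) (M η p : ℝ) (hη : 0 < η) (hp : 1 < p)
    (hp2 : p ≤ 2) : ∃ C : ℝ, 0 < C ∧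
    ∀ r δ : ℝ, 0 < r → r < δ → ∀ A : E n → Matrix (Fin n) (Fin n) ℝ, IsRoughCoeff (B n δ) M η A →
    ∀ (u : E n → ℝ) (g : Fin n → E n → ℝ), HasWeakGrad (B n δ) u g →
    ∀ φ : E n → ℝ, MemLp φ (ENNReal.ofReal p) (volume.restrict (B n δ)) →
      SolvesInLp (B n δ) A g φ →
      eLpNorm u (ENNReal.ofReal (n * p / (n - 2))) (volume.restrict (B n r)) ≤
        ENNReal.ofReal (C * ((δ - r) ^ (-2 / p) * normLp (ENNReal.ofReal p) (B n δ) u +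
          (δ - r) ^ (2 * (p - 1) / p) * normLp (ENNReal.ofReal p) (B n δ) φ)) := by
  obtain ⟨c, hc, hcut⟩ := exists_cutoff
  set C₀ := ((SNormLESNormFDerivOfEqConst ℝ (volume : Measure (E n)) 2 : ℝ) *
        (n * √(4 / ((p - 1) * η) +
          (16 * n ^ 3 * M ^ 2 / ((p - 1) * η) ^ 2 + 2 * n) * c ^ 2))) ^ (2 / p) with hC₀
  have hC₀0 : 0 ≤ C₀ := Real.rpow_nonneg (by positivity) _
  -- One is added only to make the constant strictly positive.
  refine ⟨C₀ + 1, by positivity, fun r δ hr hrδ A hA u g hu φ hφ h => ?_⟩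
  have hε : 0 < δ - r := sub_pos.2 hrδ
  have i0 : Fin n := ⟨0, by omega⟩
  have hM : 0 ≤ M := (abs_nonneg _).trans
    (hA.bdd i0 i0 0 (Metric.mem_ball_self (hr.trans hrδ)))
  obtain ⟨ζ, hζ, hζ0, hζ1, hζr, hζd⟩ := hcut n r δ hr hrδ
  have hup : MemLp u (ENNReal.ofReal p) (volume.restrict (B n δ)) := hu.memLp.mono_exponent (by
    rw [← ENNReal.ofReal_ofNat 2]
    exact ENNReal.ofReal_le_ofReal hp2)
  set Y := normLp (ENNReal.ofReal p) (B n δ) u with hY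
  set V := normLp (ENNReal.ofReal p) (B n δ) (fun _ => (1 : ℝ)) with hV
  set Φ := normLp (ENNReal.ofReal p) (B n δ) φ with hΦ
  have hb : ∀ κ > 0, eLpNorm u (ENNReal.ofReal (n * p / (n - 2))) (volume.restrict (B n r)) ≤
      ENNReal.ofReal (C₀ * ((δ - r) ^ (-2 / p) * (Y + κ * V) +
        (δ - r) ^ (2 * (p - 1) / p) * Φ)) := fun κ hκ => by
    refine (h.eLpNorm_le hn hκ hp hp2 hM hη hr hrδ hc hA hu hφ hζ hζ0 hζ1 hζr hζd).trans
      (ENNReal.ofReal_le_ofReal (mul_le_mul_of_nonneg_left ?_ hC₀0))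
    exact add_le_add_left (mul_le_mul_of_nonneg_left (eLpNorm_regAbs_le hκ hp.le hup)
      (Real.rpow_nonneg hε.le _)) _
  -- The left side does not involve `κ` and the bound is continuous in it, so `κ` may be sent to
  -- zero from the right.
  have hlim : Tendsto (fun κ : ℝ => ENNReal.ofReal (C₀ * ((δ - r) ^ (-2 / p) * (Y + κ * V) +
      (δ - r) ^ (2 * (p - 1) / p) * Φ))) (𝓝[>] 0) (𝓝 (ENNReal.ofReal
      (C₀ * ((δ - r) ^ (-2 / p) * (Y + 0 * V) + (δ - r) ^ (2 * (p - 1) / p) * Φ)))) := by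
    refine (ENNReal.continuous_ofReal.comp ?_).continuousAt.tendsto.mono_left nhdsWithin_le_nhds
    fun_prop
  have := ge_of_tendsto hlim (eventually_mem_nhdsWithin.mono fun κ hκ => hb κ hκ)
  rw [zero_mul, add_zero] at this
  refine this.trans (ENNReal.ofReal_le_ofReal (mul_le_mul_of_nonneg_right (by linarith) ?_))
  have := Real.rpow_nonneg hε.le
  exact add_nonneg (mul_nonneg (this _) (normLp_nonneg _ _ _))
    (mul_nonneg (this _) (normLp_nonneg _ _ _))

theorem IsWeakSol.solvesInLp {A : E n → Matrix (Fin n) (Fin n) ℝ} {F : (E n → ℝ) → ℝ} {u : E n → ℝ}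
    {g : Fin n → E n → ℝ} {k : ℕ} {M η δ R₀ : ℝ} (hA : IsCoeff (B n R₀) k M η A) (hk : 1 ≤ k)
    (hu : IsWeakSol (B n R₀) A F u) (hg : HasWeakGrad (B n R₀) u g) (hδ : δ ≤ R₀) {φ : E n → ℝ}
    (h : ∀ v, MemH10 (B n δ) v → IntegrableOn (fun x => φ x * v x) (B n δ) ∧
      F ((B n δ).indicator v) = ∫ x in B n δ, φ x * v x) :
    SolvesInLp (B n δ) A g φ := fun v w K hvw hK hKδ hvK hwK => by
  obtain ⟨h1, h2⟩ := h v (memH10_of_compact Metric.isOpen_ball hvw hK hKδ hvK)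
  refine ⟨h1, ?_⟩
  rw [← h2]
  exact hu.sum_integral_eq Metric.isOpen_ball hA hk hg (ball_subset_ball' hδ) hvw hK hKδ hvK hwK

end LqFinal

end InteriorElliptic

open InteriorElliptic in
/-- Elements `v` of `H¹₀(B_δ)` are regarded as elements of `H¹₀(B_{R₀})` through extension by zero,
`(B n δ).indicator v`. -/
theorem theorem7p3 (n : ℕ) (hn : 2 ≤ n) (R₀ θ M η : ℝ) (hR₀ : 0 < R₀) (hθ : θ ∈ Ioo (0 : ℝ) 1)
    (hη : 0 < η) :
    -- (a)
    (∃ C : ℝ, 0 < C ∧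
      ∀ k : ℕ, 1 ≤ k →
      ∀ (A : E n → Matrix (Fin n) (Fin n) ℝ) (F : (E n → ℝ) → ℝ) (u : E n → ℝ),
        IsCoeff (B n R₀) k M η A → IsWeakSol (B n R₀) A F u →
      ∀ δ ∈ Ioo 0 R₀, ∀ δ' ∈ Ioc 0 (θ * δ),
      ∀ a b : ℝ, 0 ≤ a → 0 ≤ b →
        (∀ v, MemH10 (B n δ) v →
          |F ((B n δ).indicator v)| ≤
            a * normLp 2 (B n δ) v + b * normL2Vec (B n δ) (weakGrad (B n δ) v)) →
        normL2Vec (B n δ') (weakGrad (B n δ') u) ^ 2 ≤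
          C * (((δ - δ') ^ 2)⁻¹ * normLp 2 (B n δ) u ^ 2 + a * normLp 2 (B n δ) u + b ^ 2)) ∧
    -- (b)
    (∀ k : ℕ, 1 ≤ k → ∃ C : ℝ, 0 < C ∧
      ∀ (A : E n → Matrix (Fin n) (Fin n) ℝ) (F : (E n → ℝ) → ℝ) (u : E n → ℝ),
        IsCoeff (B n R₀) k M η A → IsWeakSol (B n R₀) A F u →
      ∀ δ ∈ Ioo 0 R₀, ∀ δ' ∈ Ioc 0 (θ * δ),
      ∀ (φ : E n → ℝ) (Φ : E n → Fin n → ℝ),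
        MemH (k - 2) (B n δ) φ → (∀ i, MemH (k - 1) (B n δ) (fun x => Φ x i)) →
        (∀ v, MemH10 (B n δ) v →
          F ((B n δ).indicator v) =
            ∫ x in B n δ, (φ x * v x + Φ x ⬝ᵥ weakGrad (B n δ) v x)) →
        MemH k (B n δ') u ∧
        ∀ j ∈ Finset.Icc 1 k,
          ∑ α ∈ Finset.piAntidiag (Finset.univ : Finset (Fin n)) j,
              normLp 2 (B n δ') (weakDeriv (B n δ') α u) ≤
            C * ((δ - δ') ^ j)⁻¹ *
              (normLp 2 (B n δ) u + (δ - δ') ^ 2 * normLp 2 (B n δ) φ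
                + (δ - δ') * normL2Vec (B n δ) Φ
                + ∑ i ∈ Finset.Icc 1 (j - 1), (δ - δ') ^ (i + 1) *
                    (normH (i - 1) (B n δ) φ + normHVec i (B n δ) Φ))) ∧
    -- (c)
    (3 ≤ n → ∀ θ' ∈ Ioo 0 θ, ∀ p ∈ Ioc (1 : ℝ) 2, ∃ C : ℝ, 0 < C ∧
      ∀ k : ℕ, 1 ≤ k →
      ∀ (A : E n → Matrix (Fin n) (Fin n) ℝ) (F : (E n → ℝ) → ℝ) (u : E n → ℝ),
        IsCoeff (B n R₀) k M η A → IsWeakSol (B n R₀) A F u →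
      ∀ δ ∈ Ioo 0 R₀, ∀ δ' ∈ Icc (θ' * δ) (θ * δ),
      ∀ φ : E n → ℝ, MemLp φ (ENNReal.ofReal p) (volume.restrict (B n δ)) →
        (∀ v, MemH10 (B n δ) v →
          IntegrableOn (fun x => φ x * v x) (B n δ) ∧
            F ((B n δ).indicator v) = ∫ x in B n δ, φ x * v x) →
        MemLp u (ENNReal.ofReal (n * p / (n - 2))) (volume.restrict (B n δ')) ∧
        normLp (ENNReal.ofReal (n * p / (n - 2))) (B n δ') u ≤
          C * ((δ - δ') ^ (-2 / p) * normLp (ENNReal.ofReal p) (B n δ) u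
            + (δ - δ') ^ (2 * (p - 1) / p) * normLp (ENNReal.ofReal p) (B n δ) φ)) := by
  have hlt : ∀ δ ∈ Ioo 0 R₀, θ * δ < δ := fun δ hδ => mul_lt_of_lt_one_left hδ.1 hθ.2
  refine ⟨?_, fun k hk => ?_, fun hn3 θ' hθ' p hp => ?_⟩
  · obtain ⟨C, hC0, hC⟩ := energy_estimate n R₀ M η hη
    exact ⟨C, hC0, fun k hk A F u hA hu δ hδ δ' hδ' a b ha hb h =>
      hC k hk A F u hA hu δ' δ hδ'.1 (hδ'.2.trans_lt (hlt δ hδ)) hδ.2.le a b ha hb h⟩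
  · obtain ⟨C, hC0, hC⟩ := regularity_estimate n R₀ M η hη k hk
    exact ⟨C, hC0, fun A F u hA hu δ hδ δ' hδ' φ Φ hφ hΦ h =>
      hC A F u hA hu δ' δ hδ'.1 (hδ'.2.trans_lt (hlt δ hδ)) hδ.2.le φ Φ hφ hΦ h⟩
  · obtain ⟨C, hC0, hC⟩ := higher_integrability_estimate n hn3 M η p hη hp.1 hp.2
    refine ⟨C, hC0, fun k hk A F u hA hu δ hδ δ' hδ' φ hφ h => ?_⟩
    -- Positivity of the inner radius, assumed outright in (a) and (b), here comes from `θ' * δ ≤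
    -- δ'`.
    have hδ'0 : 0 < δ' := (mul_pos hθ'.1 hδ.1).trans_le hδ'.1
    have hδ'δ : δ' < δ := hδ'.2.trans_lt (hlt δ hδ)
    have hg := hu.mem.hasWeakGrad Metric.isOpen_ball
    have hsub := ball_subset_ball' (n := n) hδ.2.le
    have key := hC δ' δ hδ'0 hδ'δ A ((hA.mono hsub).isRoughCoeff hk Metric.isOpen_ball) u _
      (hg.mono hsub) φ hφ (hu.solvesInLp hA hk hg hδ.2.le h)
    refine ⟨⟨((hg.mono hsub).mono (ball_subset_ball' hδ'δ.le)).memLp.1,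
      key.trans_lt ENNReal.ofReal_lt_top⟩, ENNReal.toReal_le_of_le_ofReal ?_ key⟩
    have := Real.rpow_nonneg (sub_pos.2 hδ'δ).le
    exact mul_nonneg hC0.le (add_nonneg (mul_nonneg (this _) (normLp_nonneg _ _ _))
      (mul_nonneg (this _) (normLp_nonneg _ _ _)))
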